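/- All manifolds are smooth, finite dimensional, Hausdorff, second countable and without boundary. Let $(M,g)$ be a connected Lorentzian manifold of dimension $n\ge 2$ and signature $(-,+,\dots,+)$, with $g$ smooth, and let $K$ be a static vector field on it: a smooth timelike Killing vector field whose orthogonal distribution $K^\perp$ is involutive. Put $\beta=-g(K,K)>0$ and let $g_R$ be the Riemannian metric $g_R(u,v)=g(u,v)+2\,g(u,K)\,g(v,K)/\beta$. A metric is geodesically complete if each of its geodesics defined on an open interval extends to a geodesic defined on all of $\mathbb R$. A Riemannian metric on a connected manifold is called complete if its distance is complete. A function $V$ on a connected manifold with a complete Riemannian metric with distance $d$ is at most quadratic if there are $A>0$, a point $x_0$ and a compact set $C$ such that $V(x)\le A\,d(x_0,x)^2$ for all $x\notin C$. 1. If $g$ is geodesically complete, then the vector field $K$ is complete (its maximal integral curves are defined on all of $\mathbb R$), and every integral hypersurface of $K^\perp$ (that is, every leaf: a maximal connected, injectively immersed integral manifold of $K^\perp$) is geodesically complete with the restriction of the metric $g$. 2. If $g_R$ is complete and $\beta^{-1}$ is at most quadratic on $(M,g_R)$, then $g$ is geodesically complete. In particular: (a) if $M$ is compact, then $g$ is geodesically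 complete; (b) if $(S,g_S)$ is a connected Riemannian manifold of dimension at least $1$ with $g_S$ smooth and complete, and $\beta: S\to(0,\infty)$ is a smooth function such that $\beta^{-1}$ is at most quadratic on $(S,g_S)$, then the standard static spacetime $\mathbb R\times S$ with the metric $-\beta(x)\,dt^2+g_S$ is geodesically complete. -/

import Mathlib

open Set Filter Topology Bundle
open scoped Manifold ContDiff ENNReal

noncomputable section

namespace StaticSpacetime

universe u

section Metrics

variable {E : Type*} [NormedAddCommGroup E] [NormedSpace ℝ E]
  {H : Type*} [TopologicalSpace H] (I : ModelWithCorners ℝ E H)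
  (M : Type*) [TopologicalSpace M] [ChartedSpace H M]

/-- A (not necessarily smooth or nondegenerate) field of bilinear forms on the tangent spaces. -/
abbrev MetricTensor := ∀ x : M, TangentSpace I x →L[ℝ] TangentSpace I x →L[ℝ] ℝ

variable {I M}

/-- Smoothness of a field of bilinear forms, as a section of the bundle `Hom(TM, Hom(TM, ℝ))`. -/
def MetricTensor.IsSmooth [IsManifold I 1 M] (g : MetricTensor I M) : Prop :=
  ContMDiff I (I.prod 𝓘(ℝ, E →L[ℝ] E →L[ℝ] ℝ)) ∞
    (fun x ↦ TotalSpace.mk' (E →L[ℝ] E →L[ℝ] ℝ)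
      (E := fun y : M ↦ (TangentSpace I y →L[ℝ] TangentSpace I y →L[ℝ] ℝ)) x (g x))

/-- Smooth Riemannian metrics. -/
structure MetricTensor.IsRiemannian [IsManifold I 1 M] (g : MetricTensor I M) : Prop where
  smooth : g.IsSmooth
  symm : ∀ x (u v : TangentSpace I x), g x u v = g x v u
  pos : ∀ x (v : TangentSpace I x), v ≠ 0 → 0 < g x v v

/-- Smooth Lorentzian metrics, of signature `(-, +, …, +)`: at each point there is a vector on
which the form is negative and whose orthogonal complement is positive definite. -/
structure MetricTensor.IsLorentzian [IsManifold I 1 M] (g : MetricTensor I M) : Prop where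
  smooth : g.IsSmooth
  symm : ∀ x (u v : TangentSpace I x), g x u v = g x v u
  signature : ∀ x, ∃ v : TangentSpace I x, g x v v < 0 ∧
    ∀ w : TangentSpace I x, g x v w = 0 → w ≠ 0 → 0 < g x w w

/-- The components of the metric at the point `y` of the target of the preferred chart at `x₀`,
evaluated on the coordinate vectors `v`, `w`. -/
def chartMetric (g : MetricTensor I M) (x₀ : M) (y v w : E) : ℝ :=
  g ((extChartAt I x₀).symm y) (mfderiv 𝓘(ℝ, E) I (extChartAt I x₀).symm y v)
    (mfderiv 𝓘(ℝ, E) I (extChartAt I x₀).symm y w)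

/-- Christoffel symbols of the first kind of the Levi-Civita connection in the preferred chart at
`x₀`: `Γ(u, v; w) = (∂_u g(v, w) + ∂_v g(u, w) - ∂_w g(u, v)) / 2`. -/
def christoffel (g : MetricTensor I M) (x₀ : M) (y u v w : E) : ℝ :=
  (fderiv ℝ (fun z ↦ chartMetric g x₀ z v w) y u
    + fderiv ℝ (fun z ↦ chartMetric g x₀ z u w) y v
    - fderiv ℝ (fun z ↦ chartMetric g x₀ z u v) y w) / 2

/-- `γ` is a geodesic on the open set `s` of parameters. With `c` the expression of `γ` in the
preferred chart at `γ t`, the geodesic equation at time `t` is written with lowered index: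
`g(c'', w) + Γ(c', c'; w) = 0` for all `w`. -/
def IsGeodesicOn (g : MetricTensor I M) (γ : ℝ → M) (s : Set ℝ) : Prop :=
  ∀ t ∈ s, ContMDiffAt 𝓘(ℝ, ℝ) I 2 γ t ∧
    let c : ℝ → E := fun τ ↦ extChartAt I (γ t) (γ τ)
    ∀ w : E, chartMetric g (γ t) (c t) (deriv (deriv c) t) w
      + christoffel g (γ t) (c t) (deriv c t) (deriv c t) w = 0

/-- Geodesic completeness: every geodesic defined on an open interval is the restriction of a
geodesic defined on the whole real line. -/
def GeodesicallyComplete (g : MetricTensor I M) : Prop :=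
  ∀ (s : Set ℝ) (γ : ℝ → M), IsOpen s → s.OrdConnected → IsGeodesicOn g γ s →
    ∃ γ' : ℝ → M, IsGeodesicOn g γ' univ ∧ EqOn γ' γ s

/-- The distance of a Riemannian metric: the infimum of the lengths of `C^1` paths, the length of a
tangent vector `v` being `√g(v, v)`. -/
def riemEDist (g : MetricTensor I M) (x y : M) : ℝ≥0∞ :=
  letI : ∀ z : M, ENorm (TangentSpace I z) := fun z ↦ ⟨fun v ↦ ENNReal.ofReal √(g z v v)⟩
  Manifold.riemannianEDist I x y

/-- Completeness of a Riemannian metric: every Cauchy sequence for its distance converges. (The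
distance of a Riemannian metric induces the topology of the manifold.) -/
def RiemannianComplete (g : MetricTensor I M) : Prop :=
  ∀ x : ℕ → M, (∀ ε : ℝ≥0∞, 0 < ε → ∃ N, ∀ m ≥ N, ∀ n ≥ N, riemEDist g (x m) (x n) < ε) →
    ∃ p, Tendsto x atTop (𝓝 p)

/-- `V` behaves at most quadratically at infinity for the distance of the Riemannian metric `g`. -/
def AtMostQuadratic (g : MetricTensor I M) (V : M → ℝ) : Prop :=
  ∃ A : ℝ, 0 < A ∧ ∃ (x₀ : M) (C : Set M), IsCompact C ∧
    ∀ x ∉ C, V x ≤ A * (riemEDist g x₀ x).toReal ^ 2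

end Metrics

section Fields

variable {E : Type*} [NormedAddCommGroup E] [NormedSpace ℝ E]
  {H : Type*} [TopologicalSpace H] {I : ModelWithCorners ℝ E H}
  {M : Type*} [TopologicalSpace M] [ChartedSpace H M]

/-- `K` is a Killing vector field: `L_K g = 0`, that is,
`K(g(X, Y)) = g([K, X], Y) + g(X, [K, Y])` for all local smooth vector fields `X`, `Y`. -/
def IsKilling [IsManifold I 1 M] (g : MetricTensor I M) (K : ∀ x : M, TangentSpace I x) : Prop :=
  ∀ (x : M) (X Y : ∀ y : M, TangentSpace I y),
    ContMDiffAt I I.tangent ∞ (fun y ↦ (⟨y, X y⟩ : TangentBundle I M)) x →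
    ContMDiffAt I I.tangent ∞ (fun y ↦ (⟨y, Y y⟩ : TangentBundle I M)) x →
    (mfderiv I 𝓘(ℝ, ℝ) (fun y ↦ g y (X y) (Y y)) x (K x) : ℝ) =
      g x (VectorField.mlieBracket I K X x) (Y x) + g x (X x) (VectorField.mlieBracket I K Y x)

/-- The distribution orthogonal to `K` is involutive: the bracket of two local smooth vector fields
orthogonal to `K` is orthogonal to `K`. -/
def IsIrrotational [IsManifold I 1 M] (g : MetricTensor I M) (K : ∀ x : M, TangentSpace I x) :
    Prop :=
  ∀ (x : M) (X Y : ∀ y : M, TangentSpace I y),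
    ContMDiffAt I I.tangent ∞ (fun y ↦ (⟨y, X y⟩ : TangentBundle I M)) x →
    ContMDiffAt I I.tangent ∞ (fun y ↦ (⟨y, Y y⟩ : TangentBundle I M)) x →
    (∀ᶠ y in 𝓝 x, g y (X y) (K y) = 0) → (∀ᶠ y in 𝓝 x, g y (Y y) (K y) = 0) →
    g x (VectorField.mlieBracket I X Y x) (K x) = 0

/-- `g` is a Lorentzian metric and `K` is a static vector field for `g`: smooth, timelike, Killing
and irrotational. -/
structure IsStatic [IsManifold I 1 M] (g : MetricTensor I M) (K : ∀ x : M, TangentSpace I x) :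
    Prop where
  lorentzian : g.IsLorentzian
  smooth : ContMDiff I I.tangent ∞ (fun x ↦ (⟨x, K x⟩ : TangentBundle I M))
  timelike : ∀ x, g x (K x) (K x) < 0
  killing : IsKilling g K
  irrotational : IsIrrotational g K

/-- The function `β = -g(K, K)`. -/
def beta (g : MetricTensor I M) (K : ∀ x : M, TangentSpace I x) (x : M) : ℝ := -(g x (K x) (K x))

/-- The auxiliary metric `g_R(u, v) = g(u, v) + 2 g(u, K) g(v, K) / β`; here `g(u, K)` is written
as `g(K, u)`. -/
def auxMetric (g : MetricTensor I M) (K : ∀ x : M, TangentSpace I x) : MetricTensor I M :=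
  fun x ↦ g x + (2 / beta g K x) • (g x (K x)).smulRight (g x (K x))

/-- Completeness of a vector field: through each point there is an integral curve defined on the
whole real line. -/
def CompleteField (K : ∀ x : M, TangentSpace I x) : Prop :=
  ∀ p : M, ∃ γ : ℝ → M, γ 0 = p ∧ IsMIntegralCurve γ K

variable {E' : Type*} [NormedAddCommGroup E'] [NormedSpace ℝ E']
  {H' : Type*} [TopologicalSpace H'] (I' : ModelWithCorners ℝ E' H')
  {S : Type*} [TopologicalSpace S] [ChartedSpace H' S]

/-- The pullback `f^* g`. -/
def pullbackMetric (f : S → M) (g : MetricTensor I M) : MetricTensor I' S :=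
  fun s ↦ (ContinuousLinearMap.precomp ℝ (mfderiv I' I f s)).comp
    ((g (f s)).comp (mfderiv I' I f s))

/-- `ι : S → M` is a (connected, injectively immersed) integral manifold of the distribution
orthogonal to `K`. -/
structure IsIntegralManifold (g : MetricTensor I M) (K : ∀ x : M, TangentSpace I x)
    (ι : S → M) : Prop where
  connected : ConnectedSpace S
  manifold : IsManifold I' ∞ S
  smooth : ContMDiff I' I ∞ ι
  injective : Function.Injective ι
  immersion : ∀ s, Function.Injective (mfderiv I' I ι s)
  tangent : ∀ s, range (mfderiv I' I ι s) = {v | g (ι s) v (K (ι s)) = 0}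

end Fields

section Leaves

variable {E : Type*} [NormedAddCommGroup E] [NormedSpace ℝ E]
  {H : Type*} [TopologicalSpace H] {I : ModelWithCorners ℝ E H}
  {M : Type u} [TopologicalSpace M] [ChartedSpace H M]

/-- `ι : S → M` is an integral hypersurface (a leaf) of the foliation orthogonal to `K`: the largest
connected integral manifold through its points. Nothing is lost by taking all integral manifolds in
the universe of `M`, since they are in bijection with subsets of `M`. -/
def IsLeaf (g : MetricTensor I M) (K : ∀ x : M, TangentSpace I x) {m : ℕ}
    {S : Type u} [TopologicalSpace S] [ChartedSpace (EuclideanSpace ℝ (Fin m)) S]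
    (ι : S → M) : Prop :=
  IsIntegralManifold (𝓡 m) g K ι ∧
    ∀ (S' : Type u) [TopologicalSpace S'] [ChartedSpace (EuclideanSpace ℝ (Fin m)) S']
      (ι' : S' → M), IsIntegralManifold (𝓡 m) g K ι' → (range ι ∩ range ι').Nonempty →
      range ι' ⊆ range ι

/-- All integral hypersurfaces of the foliation orthogonal to `K` are geodesically complete with the
restriction of `g`. -/
def LeavesComplete (g : MetricTensor I M) (K : ∀ x : M, TangentSpace I x) : Prop :=
  ∀ (m : ℕ) (S : Type u) [TopologicalSpace S] [ChartedSpace (EuclideanSpace ℝ (Fin m)) S]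
    (ι : S → M), IsLeaf (m := m) g K ι → GeodesicallyComplete (pullbackMetric (𝓡 m) ι g)

end Leaves

section Standard

variable {F : Type*} [NormedAddCommGroup F] [NormedSpace ℝ F]
  {G : Type*} [TopologicalSpace G] {J : ModelWithCorners ℝ F G}
  {S : Type*} [TopologicalSpace S] [ChartedSpace G S]

/-- The differential `dt` of the projection `ℝ × S → ℝ`. -/
def dt (p : ℝ × S) : TangentSpace (𝓘(ℝ, ℝ).prod J) p →L[ℝ] ℝ :=
  mfderiv (𝓘(ℝ, ℝ).prod J) 𝓘(ℝ, ℝ) (Prod.fst : ℝ × S → ℝ) p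

/-- The metric `-β(x) dt² + g_S` of a standard static spacetime `ℝ × S`. -/
def standardMetric (β : S → ℝ) (gS : MetricTensor J S) :
    MetricTensor (𝓘(ℝ, ℝ).prod J) (ℝ × S) :=
  fun p ↦ (-(β p.2)) • (dt (J := J) p).smulRight (dt (J := J) p) +
    pullbackMetric (𝓘(ℝ, ℝ).prod J) (Prod.snd : ℝ × S → S) gS p

end Standard

end StaticSpacetime

end

open StaticSpacetime

open Set Filter Topology Bundle
open scoped Manifold ContDiff ENNReal NNReal

noncomputable section

namespace StaticSpacetime

universe u

set_option maxSynthPendingDepth 3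

set_option linter.unusedSectionVars false

section LocalGeometry

variable {E : Type*} [NormedAddCommGroup E] [NormedSpace ℝ E]
  {F : Type*} [NormedAddCommGroup F] [NormedSpace ℝ F]
  {G : Type*} [NormedAddCommGroup G] [NormedSpace ℝ G]

/-- The Christoffel symbols of the first kind of a field of bilinear forms on a vector space. -/
def christ (B : E → E →L[ℝ] E →L[ℝ] ℝ) (y u v w : E) : ℝ :=
  (fderiv ℝ B y u v w + fderiv ℝ B y v u w - fderiv ℝ B y w u v) / 2

/-- The covariant acceleration, with lowered index, of a curve with position `y`, velocity `v` and
second derivative `a`. -/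
def geoRes (B : E → E →L[ℝ] E →L[ℝ] ℝ) (y v a w : E) : ℝ :=
  B y a w + christ B y v v w

lemma geoRes_self_eq (B : E → E →L[ℝ] E →L[ℝ] ℝ) (y v a w : E) :
    geoRes B y v a w = B y a w + fderiv ℝ B y v v w - fderiv ℝ B y w v v / 2 := by
  simp only [geoRes, christ]; ring

lemma hasFDerivAt_bilin_apply {B : E → E →L[ℝ] E →L[ℝ] ℝ} {y : E}
    (hB : DifferentiableAt ℝ B y) (v w : E) :
    HasFDerivAt (fun z ↦ B z v w) (((fderiv ℝ B y).flip v).flip w) y := by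
  have h1 := (hB.hasFDerivAt.clm_apply (hasFDerivAt_const v y)).clm_apply (hasFDerivAt_const w y)
  refine h1.congr_fderiv ?_
  ext u
  simp

lemma fderiv_bilin_apply {B : E → E →L[ℝ] E →L[ℝ] ℝ} {y : E}
    (hB : DifferentiableAt ℝ B y) (u v w : E) :
    fderiv ℝ (fun z ↦ B z v w) y u = fderiv ℝ B y u v w := by
  rw [(hasFDerivAt_bilin_apply hB v w).fderiv]; simp

lemma fderiv_bilin_symm {B : E → E →L[ℝ] E →L[ℝ] ℝ} {y : E}
    (hB : DifferentiableAt ℝ B y) (hs : ∀ᶠ z in 𝓝 y, ∀ v w, B z v w = B z w v) (u v w : E) :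
    fderiv ℝ B y u v w = fderiv ℝ B y u w v := by
  rw [← fderiv_bilin_apply hB, ← fderiv_bilin_apply hB]
  congr 1
  apply Filter.EventuallyEq.fderiv_eq
  filter_upwards [hs] with z hz using hz v w

/-- Derivative of `z ↦ B (f z) (X z) (Y z)`. -/
lemma hasFDerivAt_bilin_comp {B : F → F →L[ℝ] F →L[ℝ] ℝ} {f X Y : E → F} {f' X' Y' : E →L[ℝ] F}
    {y : E} (hB : DifferentiableAt ℝ B (f y)) (hf : HasFDerivAt f f' y)
    (hX : HasFDerivAt X X' y) (hY : HasFDerivAt Y Y' y) (u : E) :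
    fderiv ℝ (fun z ↦ B (f z) (X z) (Y z)) y u =
      fderiv ℝ B (f y) (f' u) (X y) (Y y) + B (f y) (X' u) (Y y) + B (f y) (X y) (Y' u) := by
  have h0 : HasFDerivAt (fun z ↦ B (f z)) ((fderiv ℝ B (f y)).comp f') y :=
    HasFDerivAt.comp (G := F →L[ℝ] F →L[ℝ] ℝ) y hB.hasFDerivAt hf
  have h2 := (h0.clm_apply hX).clm_apply hY
  rw [h2.fderiv]
  simp
  ring

/-- Naturality of the covariant acceleration under isometric maps. -/
lemma geoRes_pullback {B₁ : E → E →L[ℝ] E →L[ℝ] ℝ} {B₂ : F → F →L[ℝ] F →L[ℝ] ℝ} {f : E → F} {y : E}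
    (hB₁ : DifferentiableAt ℝ B₁ y) (hB₂ : DifferentiableAt ℝ B₂ (f y))
    (hf : ContDiffAt ℝ 2 f y)
    (hs : ∀ v w, B₂ (f y) v w = B₂ (f y) w v)
    (h : ∀ᶠ z in 𝓝 y, ∀ v w, B₁ z v w = B₂ (f z) (fderiv ℝ f z v) (fderiv ℝ f z w))
    (v a w : E) :
    geoRes B₁ y v a w =
      geoRes B₂ (f y) (fderiv ℝ f y v) (fderiv ℝ (fderiv ℝ f) y v v + fderiv ℝ f y a)
        (fderiv ℝ f y w) := by
  have hf1 : HasFDerivAt f (fderiv ℝ f y) y := (hf.differentiableAt (by norm_num)).hasFDerivAt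
  have hf2 : HasFDerivAt (fderiv ℝ f) (fderiv ℝ (fderiv ℝ f) y) y :=
    ((hf.fderiv_right (m := 1) (by norm_num)).differentiableAt (by norm_num)).hasFDerivAt
  have hsym : ∀ u v, fderiv ℝ (fderiv ℝ f) y u v = fderiv ℝ (fderiv ℝ f) y v u :=
    fun u v ↦ hf.isSymmSndFDerivAt (by simp) u v
  have key : ∀ u v w, fderiv ℝ B₁ y u v w = fderiv ℝ B₂ (f y) (fderiv ℝ f y u) (fderiv ℝ f y v)
      (fderiv ℝ f y w) + B₂ (f y) (fderiv ℝ (fderiv ℝ f) y u v) (fderiv ℝ f y w)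
      + B₂ (f y) (fderiv ℝ f y v) (fderiv ℝ (fderiv ℝ f) y u w) := by
    intro u v w
    rw [← fderiv_bilin_apply hB₁]
    have : (fun z ↦ B₁ z v w) =ᶠ[𝓝 y] fun z ↦ B₂ (f z) (fderiv ℝ f z v) (fderiv ℝ f z w) := by
      filter_upwards [h] with z hz using hz v w
    rw [this.fderiv_eq]
    have e1 := hf2.clm_apply (hasFDerivAt_const v y)
    have e2 := hf2.clm_apply (hasFDerivAt_const w y)
    rw [hasFDerivAt_bilin_comp hB₂ hf1 e1 e2]
    simp
  rw [geoRes_self_eq, geoRes_self_eq, key, key, h.self_of_nhds, hsym w v]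
  rw [hs (fderiv ℝ f y v) (fderiv ℝ (fderiv ℝ f) y v w)]
  simp only [map_add, add_apply]
  ring

lemma contDiffAt_deriv {c : ℝ → E} {t : ℝ} (hc : ContDiffAt ℝ 2 c t) :
    ContDiffAt ℝ 1 (deriv c) t := by
  have h1 : ContDiffAt ℝ 1 (fderiv ℝ c) t := hc.fderiv_right (m := 1) (by norm_num)
  have h2 : deriv c = fun τ ↦ fderiv ℝ c τ 1 := by ext τ; simp
  rw [h2]
  exact h1.clm_apply contDiffAt_const

/-- The second derivative of `f ∘ c`. -/
lemma deriv_deriv_comp {f : E → F} {c : ℝ → E} {t : ℝ} (hf : ContDiffAt ℝ 2 f (c t))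
    (hc : ContDiffAt ℝ 2 c t) :
    deriv (f ∘ c) t = fderiv ℝ f (c t) (deriv c t) ∧
    deriv (deriv (f ∘ c)) t = fderiv ℝ (fderiv ℝ f) (c t) (deriv c t) (deriv c t)
      + fderiv ℝ f (c t) (deriv (deriv c) t) := by
  have hf2 : HasFDerivAt (fderiv ℝ f) (fderiv ℝ (fderiv ℝ f) (c t)) (c t) :=
    ((hf.fderiv_right (m := 1) (by norm_num)).differentiableAt (by norm_num)).hasFDerivAt
  have hc1 : HasDerivAt c (deriv c t) t := (hc.differentiableAt (by norm_num)).hasDerivAt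
  have hc2 : HasDerivAt (deriv c) (deriv (deriv c) t) t :=
    ((contDiffAt_deriv hc).differentiableAt (by norm_num)).hasDerivAt
  have hfe : ∀ᶠ τ in 𝓝 t, DifferentiableAt ℝ f (c τ) :=
    hc.continuousAt.eventually
      ((hf.eventually (by simp)).mono fun z hz ↦ hz.differentiableAt (by norm_num))
  have hce : ∀ᶠ τ in 𝓝 t, DifferentiableAt ℝ c τ :=
    (hc.eventually (by simp)).mono fun z hz ↦ hz.differentiableAt (by norm_num)
  have h1 : deriv (f ∘ c) =ᶠ[𝓝 t] fun τ ↦ fderiv ℝ f (c τ) (deriv c τ) := by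
    filter_upwards [hfe, hce] with τ h1 h2
    exact (h1.hasFDerivAt.comp_hasDerivAt τ h2.hasDerivAt).deriv
  refine ⟨h1.self_of_nhds, ?_⟩
  rw [h1.deriv_eq]
  exact ((hf2.comp_hasDerivAt t hc1).clm_apply hc2).deriv

/-- Derivative of `t ↦ B (c t) (X t) (Y t)` along a curve. -/
lemma hasDerivAt_bilin_comp {B : E → E →L[ℝ] E →L[ℝ] ℝ} {c X Y : ℝ → E} {c' X' Y' : E} {t : ℝ}
    (hB : DifferentiableAt ℝ B (c t)) (hc : HasDerivAt c c' t) (hX : HasDerivAt X X' t)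
    (hY : HasDerivAt Y Y' t) :
    HasDerivAt (fun τ ↦ B (c τ) (X τ) (Y τ))
      (fderiv ℝ B (c t) c' (X t) (Y t) + B (c t) X' (Y t) + B (c t) (X t) Y') t := by
  have h0 : HasDerivAt (fun τ ↦ B (c τ)) (fderiv ℝ B (c t) c') t :=
    HasFDerivAt.comp_hasDerivAt t hB.hasFDerivAt hc
  refine ((h0.clm_apply hX).clm_apply hY).congr_deriv ?_
  simp

lemma hasDerivAt_energy {B : E → E →L[ℝ] E →L[ℝ] ℝ} {c : ℝ → E} {t : ℝ}
    (hB : DifferentiableAt ℝ B (c t)) (hs : ∀ v w, B (c t) v w = B (c t) w v)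
    (hc : ContDiffAt ℝ 2 c t) :
    HasDerivAt (fun τ ↦ B (c τ) (deriv c τ) (deriv c τ))
      (2 * geoRes B (c t) (deriv c t) (deriv (deriv c) t) (deriv c t)) t := by
  have hc1 : HasDerivAt c (deriv c t) t := (hc.differentiableAt (by norm_num)).hasDerivAt
  have hc2 : HasDerivAt (deriv c) (deriv (deriv c) t) t :=
    ((contDiffAt_deriv hc).differentiableAt (by norm_num)).hasDerivAt
  refine (hasDerivAt_bilin_comp hB hc1 hc2 hc2).congr_deriv ?_
  rw [geoRes_self_eq, hs (deriv c t)]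
  ring

/-- The Killing equation for a field of bilinear forms on a vector space. -/
def KillingAt (B : E → E →L[ℝ] E →L[ℝ] ℝ) (K : E → E) (y : E) : Prop :=
  ∀ u w, fderiv ℝ B y (K y) u w + B y (fderiv ℝ K y u) w + B y u (fderiv ℝ K y w) = 0

lemma hasDerivAt_momentum {B : E → E →L[ℝ] E →L[ℝ] ℝ} {K : E → E} {c : ℝ → E} {t : ℝ}
    (hB : DifferentiableAt ℝ B (c t)) (hs : ∀ v w, B (c t) v w = B (c t) w v)
    (hK : DifferentiableAt ℝ K (c t)) (hKB : KillingAt B K (c t))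
    (hc : ContDiffAt ℝ 2 c t) :
    HasDerivAt (fun τ ↦ B (c τ) (deriv c τ) (K (c τ)))
      (geoRes B (c t) (deriv c t) (deriv (deriv c) t) (K (c t))) t := by
  have hc1 : HasDerivAt c (deriv c t) t := (hc.differentiableAt (by norm_num)).hasDerivAt
  have hc2 : HasDerivAt (deriv c) (deriv (deriv c) t) t :=
    ((contDiffAt_deriv hc).differentiableAt (by norm_num)).hasDerivAt
  refine (hasDerivAt_bilin_comp hB hc1 hc2 (hK.hasFDerivAt.comp_hasDerivAt t hc1)).congr_deriv ?_
  have := hKB (deriv c t) (deriv c t)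
  rw [hs _ (deriv c t)] at this
  rw [geoRes_self_eq]
  simp only [Function.comp_apply]
  linarith

/-- The Christoffel symbol `Γ(v, v; ·)` as a linear form. -/
def christForm (B : E → E →L[ℝ] E →L[ℝ] ℝ) (y v : E) : E →L[ℝ] ℝ :=
  fderiv ℝ B y v v - (1 / 2 : ℝ) • (((fderiv ℝ B y).flip v).flip v)

lemma christForm_apply (B : E → E →L[ℝ] E →L[ℝ] ℝ) (y v w : E) :
    christForm B y v w = christ B y v v w := by
  simp [christForm, christ]; ring

/-- The geodesic spray: the second derivative of a geodesic with position `y` and velocity `v`. -/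
def spray (B : E → E →L[ℝ] E →L[ℝ] ℝ) (y v : E) : E :=
  -((B y).inverse (christForm B y v))

variable [FiniteDimensional ℝ E]

lemma contDiffAt_clm_of_apply {n : ℕ∞ω} {f : F → E →L[ℝ] G} {x : F}
    (h : ∀ y, ContDiffAt ℝ n (fun z ↦ f z y) x) : ContDiffAt ℝ n f x := by
  let e₁ := ContinuousLinearEquiv.ofFinrankEq (𝕜 := ℝ) (E := E)
    (F := Fin (Module.finrank ℝ E) → ℝ) (Module.finrank_fin_fun ℝ).symm
  let e₂ := (e₁.arrowCongr (1 : G ≃L[ℝ] G)).trans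
    (ContinuousLinearEquiv.piRing (Fin (Module.finrank ℝ E)))
  rw [← Function.id_comp f, ← e₂.symm_comp_self]
  exact e₂.symm.contDiff.contDiffAt.comp x (contDiffAt_pi.mpr fun i ↦ h _)

/-- A nondegenerate bilinear form identifies a finite-dimensional space with its dual. -/
lemma exists_equiv_of_nondegenerate {b : E →L[ℝ] E →L[ℝ] ℝ}
    (hb : ∀ v, (∀ w, b v w = 0) → v = 0) :
    ∃ e : E ≃L[ℝ] (E →L[ℝ] ℝ), (e : E →L[ℝ] (E →L[ℝ] ℝ)) = b := by
  have hinj : Function.Injective b.toLinearMap := by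
    rw [injective_iff_map_eq_zero]
    intro v hv
    exact hb v fun w ↦ by simpa using DFunLike.congr_fun hv w
  have hfr : Module.finrank ℝ E = Module.finrank ℝ (E →L[ℝ] ℝ) := by
    rw [← LinearEquiv.finrank_eq (LinearMap.toContinuousLinearMap (𝕜 := ℝ) (E := E) (F' := ℝ))]
    exact (Subspace.dual_finrank_eq (K := ℝ) (V := E)).symm
  refine ⟨(LinearEquiv.ofInjectiveOfFinrankEq b.toLinearMap hinj hfr).toContinuousLinearEquiv, ?_⟩
  ext v w
  rfl

lemma geoRes_eq_zero_iff {B : E → E →L[ℝ] E →L[ℝ] ℝ} {y : E}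
    (hb : ∀ v, (∀ w, B y v w = 0) → v = 0) (v a : E) :
    (∀ w, geoRes B y v a w = 0) ↔ a = spray B y v := by
  obtain ⟨e, he⟩ := exists_equiv_of_nondegenerate hb
  have h1 : B y (spray B y v) = -christForm B y v := by
    rw [spray, ← he]; simp
  constructor
  · intro h
    rw [← sub_eq_zero]
    refine hb _ fun w ↦ ?_
    have := h w
    rw [map_sub, sub_apply, h1, neg_apply, christForm_apply]
    simpa [geoRes] using this
  · rintro rfl w
    rw [geoRes, h1, neg_apply, christForm_apply]; ring

lemma bilin_spray {B : E → E →L[ℝ] E →L[ℝ] ℝ} {y : E}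
    (hb : ∀ v, (∀ w, B y v w = 0) → v = 0) (v w : E) :
    B y (spray B y v) w = - christ B y v v w := by
  have := (geoRes_eq_zero_iff hb v (spray B y v)).2 rfl w
  rw [geoRes] at this; linarith

lemma contDiffAt_spray {B : E → E →L[ℝ] E →L[ℝ] ℝ} {y : E} (hB : ContDiffAt ℝ ∞ B y)
    (hb : ∀ v, (∀ w, B y v w = 0) → v = 0) (v : E) :
    ContDiffAt ℝ ∞ (fun z : E × E ↦ spray B z.1 z.2) (y, v) := by
  obtain ⟨e, he⟩ := exists_equiv_of_nondegenerate hb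
  have h1 : ContDiffAt ℝ ∞ (fun z : E × E ↦ B z.1) (y, v) :=
    ContDiffAt.comp (g := B) (y, v) hB contDiffAt_fst
  have h2 : ContDiffAt ℝ ∞ (fun z : E × E ↦ (B z.1).inverse) (y, v) := by
    refine ContDiffAt.comp (g := ContinuousLinearMap.inverse) (y, v) ?_ h1
    rw [← he]
    exact contDiffAt_map_inverse e
  have h3 : ContDiffAt ℝ ∞ (fun z : E × E ↦ fderiv ℝ B z.1) (y, v) :=
    ContDiffAt.comp (g := fderiv ℝ B) (y, v) (hB.fderiv_right (m := ∞) (by simp)) contDiffAt_fst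
  have h4 : ContDiffAt ℝ ∞ (fun z : E × E ↦ christForm B z.1 z.2) (y, v) := by
    refine contDiffAt_clm_of_apply fun w ↦ ?_
    simp only [christForm_apply, christ]
    have s : ContDiffAt ℝ ∞ (fun z : E × E ↦ z.2) (y, v) := contDiffAt_snd
    have k : ContDiffAt ℝ ∞ (fun _ : E × E ↦ w) (y, v) := contDiffAt_const
    exact ((((h3.clm_apply s).clm_apply s).clm_apply k).add
      (((h3.clm_apply s).clm_apply s).clm_apply k)).sub
      (((h3.clm_apply k).clm_apply s).clm_apply s) |>.div_const 2
  exact (h2.clm_apply h4).neg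

end LocalGeometry

section KillingFlow

variable {E : Type*} [NormedAddCommGroup E] [NormedSpace ℝ E]

/-- The geodesic vector field on the tangent bundle of a vector space. -/
def geodesicField (B : E → E →L[ℝ] E →L[ℝ] ℝ) (z : E × E) : E × E := (z.2, spray B z.1 z.2)

/-- The complete lift of a vector field to the tangent bundle of a vector space. -/
def liftField (K : E → E) (z : E × E) : E × E := (K z.1, fderiv ℝ K z.1 z.2)

lemma contDiffAt_liftField {K : E → E} {y : E} (hK : ContDiffAt ℝ ∞ K y) (v : E) :
    ContDiffAt ℝ ∞ (liftField K) (y, v) := by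
  have h1 : ContDiffAt ℝ ∞ (fun z : E × E ↦ K z.1) (y, v) :=
    ContDiffAt.comp (g := K) (y, v) hK contDiffAt_fst
  have h2 : ContDiffAt ℝ ∞ (fun z : E × E ↦ fderiv ℝ K z.1) (y, v) :=
    ContDiffAt.comp (g := fderiv ℝ K) (y, v) (hK.fderiv_right (m := ∞) (by simp)) contDiffAt_fst
  exact h1.prodMk (h2.clm_apply contDiffAt_snd)

lemma contDiffAt_geodesicField [FiniteDimensional ℝ E] {B : E → E →L[ℝ] E →L[ℝ] ℝ} {y : E}
    (hB : ContDiffAt ℝ ∞ B y)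
    (hb : ∀ v, (∀ w, B y v w = 0) → v = 0) (v : E) :
    ContDiffAt ℝ ∞ (geodesicField B) (y, v) :=
  contDiffAt_snd.prodMk (contDiffAt_spray hB hb v)

lemma fderiv_liftField {K : E → E} {y : E} (hK : ContDiffAt ℝ ∞ K y) (v k ξ : E) :
    fderiv ℝ (liftField K) (y, v) (k, ξ) =
      (fderiv ℝ K y k, fderiv ℝ (fderiv ℝ K) y k v + fderiv ℝ K y ξ) := by
  have hfst : HasFDerivAt (Prod.fst : E × E → E) (ContinuousLinearMap.fst ℝ E E) (y, v) :=
    hasFDerivAt_fst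
  have hsnd : HasFDerivAt (Prod.snd : E × E → E) (ContinuousLinearMap.snd ℝ E E) (y, v) :=
    hasFDerivAt_snd
  have h1 : HasFDerivAt (fun z : E × E ↦ K z.1) _ (y, v) :=
    HasFDerivAt.comp (g := K) (y, v) (hK.differentiableAt (by simp)).hasFDerivAt hfst
  have h2 : HasFDerivAt (fun z : E × E ↦ fderiv ℝ K z.1) _ (y, v) :=
    HasFDerivAt.comp (g := fderiv ℝ K) (y, v)
      ((hK.fderiv_right (m := ∞) (by simp)).differentiableAt (by simp)).hasFDerivAt hfst
  have h3 : HasFDerivAt (liftField K) _ (y, v) := h1.prodMk (h2.clm_apply hsnd)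
  rw [h3.fderiv]
  simp [add_comm]

/-- The derivative of the Killing equation. -/
lemma fderiv_killing {B : E → E →L[ℝ] E →L[ℝ] ℝ} {K : E → E} {y : E}
    (hB : ContDiffAt ℝ ∞ B y) (hK : ContDiffAt ℝ ∞ K y) (hKB : ∀ᶠ z in 𝓝 y, KillingAt B K z)
    (z u w : E) :
    fderiv ℝ (fderiv ℝ B) y z (K y) u w + fderiv ℝ B y (fderiv ℝ K y z) u w
      + fderiv ℝ B y z (fderiv ℝ K y u) w + B y (fderiv ℝ (fderiv ℝ K) y z u) w
      + fderiv ℝ B y z u (fderiv ℝ K y w) + B y u (fderiv ℝ (fderiv ℝ K) y z w) = 0 := by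
  have hB1 := (hB.differentiableAt (by simp)).hasFDerivAt
  have hB2 := ((hB.fderiv_right (m := ∞) (by simp)).differentiableAt (by simp)).hasFDerivAt
  have hK1 := (hK.differentiableAt (by simp)).hasFDerivAt
  have hK2 := ((hK.fderiv_right (m := ∞) (by simp)).differentiableAt (by simp)).hasFDerivAt
  have cu := hasFDerivAt_const (𝕜 := ℝ) u y
  have cw := hasFDerivAt_const (𝕜 := ℝ) w y
  have h := (((hB2.clm_apply hK1).clm_apply cu).clm_apply cw).add
    ((hB1.clm_apply (hK2.clm_apply cu)).clm_apply cw) |>.add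
    ((hB1.clm_apply cu).clm_apply (hK2.clm_apply cw))
  have h0 : (fun x ↦ fderiv ℝ B x (K x) u w + B x (fderiv ℝ K x u) w + B x u (fderiv ℝ K x w))
      =ᶠ[𝓝 y] fun _ ↦ (0 : ℝ) := by
    filter_upwards [hKB] with x hx using hx u w
  have h1 := (h0.fderiv_eq (𝕜 := ℝ)).trans (hasFDerivAt_const (𝕜 := ℝ) (0 : ℝ) y).fderiv
  have h2 := h.fderiv
  have h3 := DFunLike.congr_fun (h2.symm.trans h1) z
  simp at h3
  linarith

/-- The complete lift of a Killing vector field commutes with the geodesic vector field. -/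
lemma commute_liftField_geodesicField [FiniteDimensional ℝ E] {B : E → E →L[ℝ] E →L[ℝ] ℝ}
    {K : E → E} {y : E}
    (hB : ContDiffAt ℝ ∞ B y) (hK : ContDiffAt ℝ ∞ K y) (hKB : ∀ᶠ z in 𝓝 y, KillingAt B K z)
    (hs : ∀ᶠ z in 𝓝 y, ∀ v w, B z v w = B z w v)
    (hb : ∀ᶠ z in 𝓝 y, ∀ v, (∀ w, B z v w = 0) → v = 0) (v : E) :
    fderiv ℝ (liftField K) (y, v) (geodesicField B (y, v)) =
      fderiv ℝ (geodesicField B) (y, v) (liftField K (y, v)) := by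
  have hfst : HasFDerivAt (Prod.fst : E × E → E) (ContinuousLinearMap.fst ℝ E E) (y, v) :=
    hasFDerivAt_fst
  have hsnd : HasFDerivAt (Prod.snd : E × E → E) (ContinuousLinearMap.snd ℝ E E) (y, v) :=
    hasFDerivAt_snd
  have hsp := ((contDiffAt_spray hB hb.self_of_nhds v).differentiableAt (by simp)).hasFDerivAt
  have hgeo : HasFDerivAt (geodesicField B) _ (y, v) := hsnd.prodMk hsp
  rw [hgeo.fderiv, geodesicField, liftField, fderiv_liftField hK]
  simp only [ContinuousLinearMap.prod_apply, ContinuousLinearMap.coe_snd', Prod.mk.injEq, true_and]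
  have hB1 : HasFDerivAt (fun z : E × E ↦ B z.1) _ (y, v) :=
    HasFDerivAt.comp (g := B) (y, v) (hB.differentiableAt (by simp)).hasFDerivAt hfst
  have hB2 : HasFDerivAt (fun z : E × E ↦ fderiv ℝ B z.1) _ (y, v) :=
    HasFDerivAt.comp (g := fderiv ℝ B) (y, v)
      ((hB.fderiv_right (m := ∞) (by simp)).differentiableAt (by simp)).hasFDerivAt hfst
  have hsym2 : ∀ u w, fderiv ℝ (fderiv ℝ B) y u w = fderiv ℝ (fderiv ℝ B) y w u :=
    fun u w ↦ hB.isSymmSndFDerivAt (by simp; exact WithTop.coe_le_coe.2 le_top) u w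
  have hsD : ∀ u v w, fderiv ℝ B y u v w = fderiv ℝ B y u w v :=
    fderiv_bilin_symm (hB.differentiableAt (by simp)) hs
  have hs0 := hs.self_of_nhds
  rw [← sub_eq_zero]
  refine hb.self_of_nhds _ fun w ↦ ?_
  have cw := hasFDerivAt_const (𝕜 := ℝ) w (y, v)
  -- differentiate the equation of the spray
  have hL := (hB1.clm_apply hsp).clm_apply cw
  have hR := ((((hB2.clm_apply hsnd).clm_apply hsnd).clm_apply cw).sub
    ((((hB2.clm_apply cw).clm_apply hsnd).clm_apply hsnd).const_mul (1 / 2 : ℝ))).neg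
  have heq : (fun z : E × E ↦ B z.1 (spray B z.1 z.2) w) =ᶠ[𝓝 (y, v)]
      fun z ↦ -(fderiv ℝ B z.1 z.2 z.2 w - 1 / 2 * fderiv ℝ B z.1 w z.2 z.2) := by
    have : ∀ᶠ z : E × E in 𝓝 (y, v), ∀ v, (∀ w, B z.1 v w = 0) → v = 0 :=
      (continuousAt_fst (p := (y, v))).eventually hb
    filter_upwards [this] with z hz
    rw [bilin_spray hz, christ]; ring
  have h3 := DFunLike.congr_fun (hL.fderiv.symm.trans (heq.fderiv_eq.trans hR.fderiv))
    (K y, fderiv ℝ K y v)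
  simp [sub_eq_add_neg] at h3
  simp only [map_sub, map_add, add_apply, sub_apply]
  have k1 := fderiv_killing hB hK hKB v v w
  have k2 := fderiv_killing hB hK hKB w v v
  have k3 := hKB.self_of_nhds (spray B y v) w
  have k4 := bilin_spray hb.self_of_nhds v (fderiv ℝ K y w)
  rw [christ] at k4
  have hsK : fderiv ℝ (fderiv ℝ K) y w v = fderiv ℝ (fderiv ℝ K) y v w :=
    hK.isSymmSndFDerivAt (by simp; exact WithTop.coe_le_coe.2 le_top) w v
  rw [hsym2 v (K y)] at k1
  rw [hsym2 w (K y), hsK, hs0 _ v] at k2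
  linarith

end KillingFlow

section TimeForm

variable {E : Type*} [NormedAddCommGroup E] [NormedSpace ℝ E]

/-- The one-form `g(K, ·) / g(K, K)`, which takes the value `1` on `K`. -/
def timeForm (B : E → E →L[ℝ] E →L[ℝ] ℝ) (K : E → E) (y : E) : E →L[ℝ] ℝ :=
  (B y (K y) (K y))⁻¹ • B y (K y)

lemma timeForm_apply (B : E → E →L[ℝ] E →L[ℝ] ℝ) (K : E → E) (y v : E) :
    timeForm B K y v = (B y (K y) (K y))⁻¹ * B y (K y) v := by
  simp [timeForm]

/-- The projection of the constant field `u` to the distribution orthogonal to `K`. -/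
def horizontalField (B : E → E →L[ℝ] E →L[ℝ] ℝ) (K : E → E) (u y : E) : E :=
  u - timeForm B K y u • K y

lemma timeForm_self {B : E → E →L[ℝ] E →L[ℝ] ℝ} {K : E → E} {y : E}
    (h : B y (K y) (K y) ≠ 0) : timeForm B K y (K y) = 1 := by
  rw [timeForm_apply, inv_mul_cancel₀ h]

lemma timeForm_horizontalField {B : E → E →L[ℝ] E →L[ℝ] ℝ} {K : E → E} {y : E}
    (h : B y (K y) (K y) ≠ 0) (u : E) : B y (K y) (horizontalField B K u y) = 0 := by
  rw [horizontalField, map_sub, map_smul, timeForm_apply, smul_eq_mul]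
  field_simp
  ring

lemma contDiffAt_timeForm {B : E → E →L[ℝ] E →L[ℝ] ℝ} {K : E → E} {y : E}
    (hB : ContDiffAt ℝ ∞ B y) (hK : ContDiffAt ℝ ∞ K y) (h : B y (K y) (K y) ≠ 0) :
    ContDiffAt ℝ ∞ (timeForm B K) y :=
  (((hB.clm_apply hK).clm_apply hK).inv h).smul (hB.clm_apply hK)

lemma contDiffAt_horizontalField {B : E → E →L[ℝ] E →L[ℝ] ℝ} {K : E → E} {y : E}
    (hB : ContDiffAt ℝ ∞ B y) (hK : ContDiffAt ℝ ∞ K y) (h : B y (K y) (K y) ≠ 0) (u : E) :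
    ContDiffAt ℝ ∞ (horizontalField B K u) y :=
  contDiffAt_const.sub (((contDiffAt_timeForm hB hK h).clm_apply contDiffAt_const).smul hK)

/-- For a Killing field with involutive orthogonal distribution, the form `g(K, ·) / g(K, K)` is
closed. -/
lemma fderiv_timeForm_symm {B : E → E →L[ℝ] E →L[ℝ] ℝ} {K : E → E} {y : E}
    (hB : ContDiffAt ℝ ∞ B y) (hK : ContDiffAt ℝ ∞ K y) (hKB : KillingAt B K y)
    (h : B y (K y) (K y) ≠ 0)
    (hirr : ∀ u w, B y (K y)
      (VectorField.lieBracket ℝ (horizontalField B K u) (horizontalField B K w) y) = 0)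
    (u w : E) :
    fderiv ℝ (timeForm B K) y u w = fderiv ℝ (timeForm B K) y w u := by
  set η := timeForm B K with hη
  have hηd : HasFDerivAt η (fderiv ℝ η y) y :=
    ((contDiffAt_timeForm hB hK h).differentiableAt (by simp)).hasFDerivAt
  have hBd := (hB.differentiableAt (by simp)).hasFDerivAt
  have hKd := (hK.differentiableAt (by simp)).hasFDerivAt
  have hne : ∀ᶠ z in 𝓝 y, B z (K z) (K z) ≠ 0 :=
    ((hB.continuousAt.clm_apply hK.continuousAt).clm_apply hK.continuousAt).eventually_ne h
  have hηy : ∀ v, B y (K y) v = B y (K y) (K y) * η y v := by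
    intro v; rw [hη, timeForm_apply]; field_simp
  -- differentiate `g(K, K) η = g(K, ·)` along `K`
  have e2 : ∀ v, fderiv ℝ η y (K y) v = - η y (fderiv ℝ K y v) := by
    intro v
    have h1 : (fun x ↦ B x (K x) (K x) * η x v) =ᶠ[𝓝 y] fun x ↦ B x (K x) v := by
      filter_upwards [hne] with x hx
      rw [hη, timeForm_apply]; field_simp
    have cv := hasFDerivAt_const (𝕜 := ℝ) v y
    have h2 := (((hBd.clm_apply hKd).clm_apply hKd).mul (hηd.clm_apply cv)).fderiv.symm.trans
      ((h1.fderiv_eq (𝕜 := ℝ)).trans ((hBd.clm_apply hKd).clm_apply cv).fderiv)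
    have h3 := DFunLike.congr_fun h2 (K y)
    simp at h3
    have k1 := hKB (K y) v
    have k2 := hKB (K y) (K y)
    have k3 := hηy (fderiv ℝ K y v)
    have k4 : B y (K y) (K y) * (fderiv ℝ η y (K y) v + η y (fderiv ℝ K y v)) = 0 := by
      linear_combination h3 + k1 - k3 - η y v * k2
    have := (mul_eq_zero.1 k4).resolve_left h
    linarith
  have e3 := hirr u w
  rw [hηy, mul_eq_zero, or_iff_right h, VectorField.lieBracket_eq] at e3
  have hX : ∀ u z, fderiv ℝ (horizontalField B K u) y z =
      -(fderiv ℝ η y z u • K y + η y u • fderiv ℝ K y z) := by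
    intro u z
    have h1 := (hasFDerivAt_const (𝕜 := ℝ) u y).sub
      ((hηd.clm_apply (hasFDerivAt_const (𝕜 := ℝ) u y)).smul hKd)
    have h2 : HasFDerivAt (horizontalField B K u) _ y := h1
    rw [h2.fderiv]
    simp [add_comm]
  simp only [hX, horizontalField, ← hη] at e3
  simp only [map_sub, map_neg, map_add, map_smul, smul_eq_mul, hη, timeForm_self h] at e3
  simp only [← hη, sub_apply, smul_apply, smul_eq_mul] at e3
  linear_combination -e3 + η y u * e2 w - η y w * e2 u

end TimeForm

section Ode

open Metric

variable {F : Type*} [NormedAddCommGroup F] [NormedSpace ℝ F]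

/-- The Picard-Lindelöf theorem, with control of the location of the solution. -/
lemma exists_solution_mem_closedBall [CompleteSpace F] {f : ℝ → F → F} {tmin tmax : ℝ}
    {t₀ : Icc tmin tmax} {x₀ x : F} {a r L K : ℝ≥0}
    (hf : IsPicardLindelof f t₀ x₀ a r L K) (hx : x ∈ closedBall x₀ r) :
    ∃ α : ℝ → F, α t₀ = x ∧ ∀ t ∈ Ioo tmin tmax, HasDerivAt α (f t (α t)) t ∧
      α t ∈ closedBall x₀ a := by
  obtain ⟨α, hα⟩ := ODE.FunSpace.exists_isFixedPt_next hf hx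
  refine ⟨α.compProj, by rw [ODE.FunSpace.compProj_val, ← hα, ODE.FunSpace.next_apply₀],
    fun t ht ↦ ⟨?_, α.compProj_mem_closedBall hf.mul_max_le⟩⟩
  refine HasDerivWithinAt.hasDerivAt ?_ (Icc_mem_nhds ht.1 ht.2)
  apply ODE.hasDerivWithinAt_picard_Icc t₀.2 hf.continuousOn_uncurry
    α.continuous_compProj.continuousOn (fun _ ht' ↦ α.compProj_mem_closedBall hf.mul_max_le)
    x (Ioo_subset_Icc_self ht) |>.congr_of_mem _ (Ioo_subset_Icc_self ht)
  intro t' ht'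
  nth_rw 1 [← hα]
  rw [ODE.FunSpace.compProj_of_mem ht', ODE.FunSpace.next_apply]

/-- Local solutions of an autonomous equation exist for a uniform time and stay in a given
neighbourhood. -/
lemma exists_local_flow [CompleteSpace F] {Y : F → F} {z₀ : F} (hY : ContDiffAt ℝ 1 Y z₀)
    {R : ℝ} (hR : 0 < R) :
    ∃ r > 0, ∃ δ > 0, ∀ z ∈ ball z₀ r, ∀ t₀ : ℝ, ∃ α : ℝ → F, α t₀ = z ∧
      ∀ t ∈ Ioo (t₀ - δ) (t₀ + δ), HasDerivAt α (Y (α t)) t ∧ α t ∈ ball z₀ R := by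
  obtain ⟨K, s, hs, hl⟩ := hY.exists_lipschitzOnWith
  obtain ⟨a', ha', has⟩ := Metric.mem_nhds_iff.mp hs
  obtain ⟨a, ha, haa, haR⟩ : ∃ a : ℝ, 0 < a ∧ a < a' ∧ a < R :=
    ⟨min a' R / 2, by positivity, by have := min_le_left a' R; linarith,
      by have := min_le_right a' R; linarith [lt_min ha' hR]⟩
  have hsub : closedBall z₀ a ⊆ s := (closedBall_subset_ball haa).trans has
  set L : ℝ := K * a + ‖Y z₀‖ + 1 with hL
  have hL0 : 0 < L := by positivity
  have hb : ∀ x ∈ closedBall z₀ a, ‖Y x‖ ≤ L := by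
    intro x hx
    have h1 := hl.norm_sub_le (hsub hx) (mem_of_mem_nhds hs)
    have h2 : ‖x - z₀‖ ≤ a := by rwa [← mem_closedBall_iff_norm]
    have h3 : ‖Y x‖ ≤ ‖Y x - Y z₀‖ + ‖Y z₀‖ := norm_le_norm_sub_add _ _
    have h4 : (K : ℝ) * ‖x - z₀‖ ≤ K * a := by gcongr
    linarith
  refine ⟨a / 2, by positivity, a / (2 * L), by positivity, fun z hz t₀ ↦ ?_⟩
  have hδ : 0 < a / (2 * L) := by positivity
  have hpl : IsPicardLindelof (fun _ ↦ Y) (tmin := t₀ - a / (2 * L)) (tmax := t₀ + a / (2 * L))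
      ⟨t₀, by simp [hδ.le]⟩ z₀ ⟨a, ha.le⟩ ⟨a / 2, by positivity⟩ ⟨L, hL0.le⟩ K := by
    refine IsPicardLindelof.of_time_independent hb (hl.mono hsub) ?_
    simp only [add_sub_cancel_left, sub_sub_cancel, max_self]
    change L * (a / (2 * L)) ≤ a - a / 2
    field_simp
    linarith
  obtain ⟨α, h0, hα⟩ := exists_solution_mem_closedBall hpl (x := z) (ball_subset_closedBall hz)
  exact ⟨α, h0, fun t ht ↦ ⟨(hα t ht).1, closedBall_subset_ball haR (hα t ht).2⟩⟩

/-- Linear equations with coefficients bounded by `C` have solutions for a time `1 / (2 * C)`. -/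
lemma exists_linear_solution [CompleteSpace F] {A : ℝ → F →L[ℝ] F} {t₀ δ C : ℝ} (hδ : 0 < δ)
    (hC : 0 ≤ C)
    (hA : ContinuousOn A (Icc (t₀ - δ) (t₀ + δ))) (hb : ∀ t ∈ Icc (t₀ - δ) (t₀ + δ), ‖A t‖ ≤ C)
    (hδC : C * δ ≤ 1 / 2) (w : F) :
    ∃ x : ℝ → F, x t₀ = w ∧ ∀ t ∈ Ioo (t₀ - δ) (t₀ + δ), HasDerivAt x (A t (x t)) t := by
  have hpl : IsPicardLindelof (fun t x ↦ A t x) (tmin := t₀ - δ) (tmax := t₀ + δ)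
      ⟨t₀, by simp [hδ.le]⟩ w ⟨‖w‖ + 1, by positivity⟩ 0 ⟨C * (2 * ‖w‖ + 1), by positivity⟩
      ⟨C, hC⟩ := by
    refine ⟨fun t ht ↦ ?_, fun x _ ↦ ?_, fun t ht x hx ↦ ?_, ?_⟩
    · refine (LipschitzWith.of_dist_le_mul fun x y ↦ ?_).lipschitzOnWith
      rw [dist_eq_norm, ← map_sub, dist_eq_norm]
      exact ((A t).le_opNorm _).trans (by gcongr; exact hb t ht)
    · exact hA.clm_apply continuousOn_const
    · have h1 : ‖x‖ ≤ 2 * ‖w‖ + 1 := by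
        have h2 : ‖x - w‖ ≤ ‖w‖ + 1 := by rw [← mem_closedBall_iff_norm]; exact hx
        have := norm_le_norm_sub_add x w
        linarith
      exact ((A t).le_opNorm _).trans (mul_le_mul (hb t ht) h1 (norm_nonneg _) hC)
    · simp only [add_sub_cancel_left, sub_sub_cancel, max_self, NNReal.coe_zero, sub_zero]
      change C * (2 * ‖w‖ + 1) * δ ≤ ‖w‖ + 1
      nlinarith [norm_nonneg w]
  obtain ⟨α, h0, hα⟩ := exists_solution_mem_closedBall hpl (x := w) (mem_closedBall_self le_rfl)
  exact ⟨α, h0, fun t ht ↦ (hα t ht).1⟩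

lemma linear_solution_unique {A : ℝ → F →L[ℝ] F} {x y : ℝ → F} {a b t₀ C : ℝ}
    (hb : ∀ t ∈ Ioo a b, ‖A t‖ ≤ C) (ht₀ : t₀ ∈ Ioo a b)
    (hx : ∀ t ∈ Ioo a b, HasDerivAt x (A t (x t)) t)
    (hy : ∀ t ∈ Ioo a b, HasDerivAt y (A t (y t)) t) (h : x t₀ = y t₀) :
    EqOn x y (Ioo a b) := by
  have hC : 0 ≤ C := (norm_nonneg _).trans (hb _ ht₀)
  refine ODE_solution_unique_of_mem_Ioo (v := fun t x ↦ A t x) (s := fun _ ↦ univ)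
    (K := ⟨C, hC⟩) (fun t ht ↦ ?_) ht₀ (fun t ht ↦ ⟨hx t ht, mem_univ _⟩)
    (fun t ht ↦ ⟨hy t ht, mem_univ _⟩) h
  refine (LipschitzWith.of_dist_le_mul fun x y ↦ ?_).lipschitzOnWith
  rw [dist_eq_norm, ← map_sub, dist_eq_norm]
  exact ((A t).le_opNorm _).trans (by gcongr; exact hb t ht)

/-- If `X` and `Y` commute, the flow of `Y` maps integral curves of `X` to integral curves of `X`:
version forward in time, with explicit bounds. -/
lemma commuting_flow_forward {X Y : F → F} {z₀ : F} {R C₁ C₂ : ℝ} {L : ℝ≥0} (hC₂ : 0 ≤ C₂)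
    (hL : LipschitzOnWith L Y (ball z₀ (2 * R)))
    (hT : ∀ z ∈ ball z₀ R, ∀ k : F, ‖k‖ < R → ‖Y (z + k) - Y z - fderiv ℝ Y z k‖ ≤ C₂ * ‖k‖ ^ 2)
    (hX : ∀ z ∈ ball z₀ R, DifferentiableAt ℝ X z) (hX' : ∀ z ∈ ball z₀ R, ‖X z‖ ≤ C₁)
    (hcomm : ∀ z ∈ ball z₀ R, fderiv ℝ X z (Y z) = fderiv ℝ Y z (X z))
    {ζ : ℝ → ℝ → F} {t₁ s₂ s : ℝ} (hs : s₂ ≤ s)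
    (hζ : ∀ᶠ t in 𝓝 t₁, ∀ σ ∈ Icc s₂ s, HasDerivAt (ζ t) (Y (ζ t σ)) σ ∧ ζ t σ ∈ ball z₀ R)
    (h₂ : HasDerivAt (fun t ↦ ζ t s₂) (X (ζ t₁ s₂)) t₁) :
    HasDerivAt (fun t ↦ ζ t s) (X (ζ t₁ s)) t₁ := by
  have hζ₁ := hζ.self_of_nhds
  have hR : 0 < R := pos_of_mem_ball (hζ₁ s ⟨hs, le_rfl⟩).2
  have hC₁ : 0 ≤ C₁ := (norm_nonneg _).trans (hX' _ (hζ₁ s ⟨hs, le_rfl⟩).2)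
  rw [hasDerivAt_iff_isLittleO] at h₂ ⊢
  have hsmall : ∀ᶠ t in 𝓝 t₁, |t - t₁| * (C₁ + 1) < R := by
    have : Tendsto (fun t ↦ |t - t₁| * (C₁ + 1)) (𝓝 t₁) (𝓝 (|t₁ - t₁| * (C₁ + 1))) :=
      Continuous.tendsto (by fun_prop) t₁
    simp only [sub_self, abs_zero, zero_mul] at this
    exact this.eventually (gt_mem_nhds hR)
  have hbound : ∀ᶠ t in 𝓝 t₁, ‖ζ t s - ζ t₁ s - (t - t₁) • X (ζ t₁ s)‖ ≤
      Real.exp ((L + 1) * (s - s₂)) * ‖‖ζ t s₂ - ζ t₁ s₂ - (t - t₁) • X (ζ t₁ s₂)‖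
        + C₂ * C₁ ^ 2 * (t - t₁) ^ 2‖ := by
    filter_upwards [hζ, hsmall] with t ht hts
    set h := t - t₁ with hh
    have hk : ∀ σ ∈ Icc s₂ s, ‖h • X (ζ t₁ σ)‖ ≤ |h| * C₁ := fun σ hσ ↦ by
      rw [norm_smul, Real.norm_eq_abs]
      gcongr
      exact hX' _ (hζ₁ σ hσ).2
    have hkR : |h| * C₁ < R := lt_of_le_of_lt (by gcongr; linarith) hts
    have hmem : ∀ σ ∈ Icc s₂ s, ζ t₁ σ + h • X (ζ t₁ σ) ∈ ball z₀ (2 * R) := fun σ hσ ↦ by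
      have h1 := (hζ₁ σ hσ).2
      rw [mem_ball_iff_norm] at h1 ⊢
      have h2 : ζ t₁ σ + h • X (ζ t₁ σ) - z₀ = (ζ t₁ σ - z₀) + h • X (ζ t₁ σ) := by abel
      rw [h2]
      linarith [norm_add_le (ζ t₁ σ - z₀) (h • X (ζ t₁ σ)), hk σ hσ]
    have hder : ∀ σ ∈ Icc s₂ s, HasDerivAt (fun σ ↦ ζ t₁ σ + h • X (ζ t₁ σ))
        (Y (ζ t₁ σ) + h • fderiv ℝ X (ζ t₁ σ) (Y (ζ t₁ σ))) σ := fun σ hσ ↦ by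
      refine (hζ₁ σ hσ).1.add (HasDerivAt.const_smul h ?_)
      exact (hX _ (hζ₁ σ hσ).2).hasFDerivAt.comp_hasDerivAt σ (hζ₁ σ hσ).1
    have hL' : LipschitzOnWith (L + 1) Y (ball z₀ (2 * R)) := hL.weaken (by simp)
    have hG := dist_le_of_approx_trajectories_ODE_of_mem (v := fun _ ↦ Y)
      (s := fun _ ↦ ball z₀ (2 * R)) (K := L + 1) (f := ζ t)
      (g := fun σ ↦ ζ t₁ σ + h • X (ζ t₁ σ)) (f' := fun σ ↦ Y (ζ t σ))
      (g' := fun σ ↦ Y (ζ t₁ σ) + h • fderiv ℝ X (ζ t₁ σ) (Y (ζ t₁ σ))) (a := s₂) (b := s)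
      (εf := 0) (εg := C₂ * C₁ ^ 2 * h ^ 2)
      (δ := ‖ζ t s₂ - ζ t₁ s₂ - h • X (ζ t₁ s₂)‖)
      (fun _ _ ↦ hL')
      (fun σ hσ ↦ (ht σ hσ).1.continuousAt.continuousWithinAt)
      (fun σ hσ ↦ (ht σ (Ico_subset_Icc_self hσ)).1.hasDerivWithinAt)
      (fun σ _ ↦ by simp)
      (fun σ hσ ↦ ball_subset_ball (by linarith) (ht σ (Ico_subset_Icc_self hσ)).2)
      (fun σ hσ ↦ (hder σ hσ).continuousAt.continuousWithinAt)
      (fun σ hσ ↦ (hder σ (Ico_subset_Icc_self hσ)).hasDerivWithinAt)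
      (fun σ hσ ↦ by
        have hσ' := Ico_subset_Icc_self hσ
        rw [dist_comm, dist_eq_norm, hcomm _ (hζ₁ σ hσ').2, ← map_smul, ← sub_sub]
        refine (hT _ (hζ₁ σ hσ').2 _ ((hk σ hσ').trans_lt hkR)).trans ?_
        have : ‖h • X (ζ t₁ σ)‖ ^ 2 ≤ (|h| * C₁) ^ 2 := by gcongr; exact hk σ hσ'
        calc C₂ * ‖h • X (ζ t₁ σ)‖ ^ 2 ≤ C₂ * (|h| * C₁) ^ 2 := by gcongr
          _ = C₂ * C₁ ^ 2 * h ^ 2 := by rw [mul_pow, sq_abs]; ring)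
      (fun σ hσ ↦ hmem σ (Ico_subset_Icc_self hσ))
      (by rw [dist_eq_norm, sub_sub]) s ⟨hs, le_rfl⟩
    rw [dist_eq_norm, ← sub_sub, gronwallBound_of_K_ne_0 (by positivity)] at hG
    refine hG.trans ?_
    rw [Real.norm_of_nonneg (by positivity)]
    set e := Real.exp ((L + 1) * (s - s₂)) with he
    have he' : Real.exp (((L + 1 : ℝ≥0) : ℝ) * (s - s₂)) = e := by rw [he]; push_cast; rfl
    have he1 : 1 ≤ e := Real.one_le_exp (by have := sub_nonneg.2 hs; positivity)
    beta_reduce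
    rw [he']
    have hdiv : (0 + C₂ * C₁ ^ 2 * h ^ 2) / ((L + 1 : ℝ≥0) : ℝ) ≤ C₂ * C₁ ^ 2 * h ^ 2 := by
      rw [zero_add]
      exact div_le_self (by positivity) (by push_cast; linarith [L.coe_nonneg])
    have : (0 + C₂ * C₁ ^ 2 * h ^ 2) / ((L + 1 : ℝ≥0) : ℝ) * (e - 1) ≤ C₂ * C₁ ^ 2 * h ^ 2 * e :=
      mul_le_mul hdiv (by linarith) (by linarith) (by positivity)
    linarith
  refine (Asymptotics.IsBigO.of_bound _ hbound).trans_isLittleO ?_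
  refine h₂.norm_left.add ?_
  refine Asymptotics.IsLittleO.const_mul_left ?_ _
  have h1 : Tendsto (fun t ↦ t - t₁) (𝓝 t₁) (𝓝 0) := by
    simpa using (continuous_id.sub continuous_const).tendsto (x := t₁) (f := fun t ↦ t - t₁)
  exact (Asymptotics.isLittleO_pow_id one_lt_two).comp_tendsto h1

/-- If `X` and `Y` commute near `z₀`, the flow of `Y` near `z₀` maps integral curves of `X` to
integral curves of `X`. -/
lemma commuting_flow {X Y : F → F} {z₀ : F} (hX : ContDiffAt ℝ 2 X z₀) (hY : ContDiffAt ℝ 2 Y z₀)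
    (hcomm : ∀ᶠ z in 𝓝 z₀, fderiv ℝ X z (Y z) = fderiv ℝ Y z (X z)) :
    ∃ R > 0, ∀ (ζ : ℝ → ℝ → F) (t₁ s₂ s : ℝ),
      (∀ᶠ t in 𝓝 t₁, ∀ σ ∈ uIcc s₂ s, HasDerivAt (ζ t) (Y (ζ t σ)) σ ∧ ζ t σ ∈ ball z₀ R) →
      HasDerivAt (fun t ↦ ζ t s₂) (X (ζ t₁ s₂)) t₁ →
      HasDerivAt (fun t ↦ ζ t s) (X (ζ t₁ s)) t₁ := by
  obtain ⟨L, U₁, hU₁, hL⟩ := (hY.of_le (m := 1) (by norm_num)).exists_lipschitzOnWith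
  obtain ⟨L₂, U₂, hU₂, hL₂⟩ := (hY.fderiv_right (m := 1) (by norm_num)).exists_lipschitzOnWith
  have hXd : ∀ᶠ z in 𝓝 z₀, DifferentiableAt ℝ X z :=
    (hX.eventually (by simp)).mono fun z hz ↦ hz.differentiableAt (by norm_num)
  have hYd : ∀ᶠ z in 𝓝 z₀, DifferentiableAt ℝ Y z :=
    (hY.eventually (by simp)).mono fun z hz ↦ hz.differentiableAt (by norm_num)
  have hXb : ∀ᶠ z in 𝓝 z₀, ‖X z‖ < ‖X z₀‖ + 1 :=
    hX.continuousAt.norm.eventually (gt_mem_nhds (by linarith))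
  obtain ⟨R', hR', hsub⟩ := Metric.eventually_nhds_iff_ball.1
    (hcomm.and (hXd.and (hYd.and (hXb.and
      ((eventually_mem_set.2 hU₁).and (eventually_mem_set.2 hU₂))))))
  have hR'2 : 2 * (R' / 2) = R' := by ring
  have hle : ball z₀ (R' / 2) ⊆ ball z₀ R' := ball_subset_ball (by linarith)
  have hL' : LipschitzOnWith L Y (ball z₀ (2 * (R' / 2))) := by
    rw [hR'2]; exact hL.mono fun z hz ↦ (hsub z hz).2.2.2.2.1
  have hT : ∀ z ∈ ball z₀ (R' / 2), ∀ k : F, ‖k‖ < R' / 2 →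
      ‖Y (z + k) - Y z - fderiv ℝ Y z k‖ ≤ L₂ * ‖k‖ ^ 2 := by
    intro z hz k hk
    have hseg : ∀ x ∈ ball z₀ R' ∩ closedBall z ‖k‖, ‖fderiv ℝ Y x - fderiv ℝ Y z‖ ≤ L₂ * ‖k‖ := by
      intro x hx
      refine (hL₂.norm_sub_le (hsub x hx.1).2.2.2.2.2 (hsub z (hle hz)).2.2.2.2.2).trans ?_
      gcongr
      rw [← mem_closedBall_iff_norm]; exact hx.2
    have hconv : Convex ℝ (ball z₀ R' ∩ closedBall z ‖k‖) :=
      (convex_ball _ _).inter (convex_closedBall _ _)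
    have hzk : z + k ∈ ball z₀ R' := by
      rw [mem_ball_iff_norm] at hz ⊢
      have : z + k - z₀ = (z - z₀) + k := by abel
      rw [this]
      linarith [norm_add_le (z - z₀) k]
    have := hconv.norm_image_sub_le_of_norm_fderiv_le' (f := Y) (φ := fderiv ℝ Y z)
      (fun x hx ↦ (hsub x hx.1).2.2.1) hseg (x := z) (y := z + k)
      ⟨hle hz, mem_closedBall_self (norm_nonneg _)⟩ ⟨hzk, by simp⟩
    simp only [add_sub_cancel_left] at this
    calc _ ≤ L₂ * ‖k‖ * ‖k‖ := this
      _ = _ := by ring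
  refine ⟨R' / 2, by positivity, fun ζ t₁ s₂ s hζ h₂ ↦ ?_⟩
  rcases le_total s₂ s with h | h
  · rw [uIcc_of_le h] at hζ
    exact commuting_flow_forward L₂.coe_nonneg hL' hT (fun z hz ↦ (hsub z (hle hz)).2.1)
      (fun z hz ↦ (hsub z (hle hz)).2.2.2.1.le) (fun z hz ↦ (hsub z (hle hz)).1) h hζ h₂
  · rw [uIcc_of_ge h] at hζ
    have hnegd : ∀ z, fderiv ℝ (fun z ↦ -Y z) z = -fderiv ℝ Y z := fun z ↦ fderiv_fun_neg
    have := commuting_flow_forward (X := X) (Y := fun z ↦ -Y z) (ζ := fun t σ ↦ ζ t (-σ))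
      (t₁ := t₁) (s₂ := -s₂) (s := -s) (R := R' / 2) (L := L) (C₂ := L₂) (C₁ := ‖X z₀‖ + 1)
      (z₀ := z₀) L₂.coe_nonneg (fun x hx y hy ↦ by
        simpa [edist_neg_neg] using hL' hx hy) (fun z hz k hk ↦ by
        rw [hnegd, neg_apply, ← norm_neg]
        refine le_trans (le_of_eq ?_) (hT z hz k hk)
        congr 1; abel) (fun z hz ↦ (hsub z (hle hz)).2.1)
      (fun z hz ↦ (hsub z (hle hz)).2.2.2.1.le) (fun z hz ↦ by
        rw [hnegd, neg_apply, map_neg, (hsub z (hle hz)).1]) (by linarith) (by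
        filter_upwards [hζ] with t ht σ hσ
        have hσ' : -σ ∈ Icc s s₂ := ⟨by linarith [hσ.2], by linarith [hσ.1]⟩
        refine ⟨?_, (ht _ hσ').2⟩
        have := (ht _ hσ').1.scomp σ (hasDerivAt_neg σ)
        rw [neg_one_smul] at this
        exact this) (by simpa using h₂)
    simpa using this

end Ode

section Exponential

open Metric

variable {E : Type*} [NormedAddCommGroup E] [NormedSpace ℝ E]

lemma hasDerivAt_fst_comp {F : Type*} [NormedAddCommGroup F] [NormedSpace ℝ F]
    {α : ℝ → E × F} {α' : E × F} {t : ℝ} (h : HasDerivAt α α' t) :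
    HasDerivAt (fun t ↦ (α t).1) α'.1 t :=
  (ContinuousLinearMap.fst ℝ E F).hasFDerivAt.comp_hasDerivAt t h

lemma hasDerivAt_snd_comp {F : Type*} [NormedAddCommGroup F] [NormedSpace ℝ F]
    {α : ℝ → E × F} {α' : E × F} {t : ℝ} (h : HasDerivAt α α' t) :
    HasDerivAt (fun t ↦ (α t).2) α'.2 t :=
  (ContinuousLinearMap.snd ℝ E F).hasFDerivAt.comp_hasDerivAt t h

/-- The exponential map of a second order equation with the constant solutions covers a
neighbourhood. -/
lemma exists_solution_through [CompleteSpace E] {S : E × E → E} {y₀ : E}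
    (hS : ContDiffAt ℝ 1 S (y₀, 0)) (hS0 : S (y₀, 0) = 0) {R : ℝ} (hR : 0 < R) :
    ∃ h > 0, ∃ δ > h, ∀ᶠ y in 𝓝 y₀, ∃ α : ℝ → E × E, (α 0).1 = y₀ ∧ (α h).1 = y ∧
      ∀ t ∈ Ioo (-δ) δ, HasDerivAt α ((α t).2, S (α t)) t ∧ α t ∈ ball (y₀, 0) R := by
  set Y : E × E → E × E := fun z ↦ (z.2, S z) with hYdef
  have hY : ContDiffAt ℝ 1 Y (y₀, 0) := contDiffAt_snd.prodMk hS
  obtain ⟨L, U, hU, hL⟩ := hY.exists_lipschitzOnWith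
  obtain ⟨R₁, hR₁, hRU⟩ := Metric.mem_nhds_iff.1 hU
  obtain ⟨r, hr, δ, hδ, hflow⟩ := exists_local_flow hY (lt_min hR hR₁)
  have hLb : LipschitzOnWith L Y (ball (y₀, 0) (min R R₁)) :=
    hL.mono ((ball_subset_ball (min_le_right _ _)).trans hRU)
  have hv : ∀ v ∈ ball (0 : E) r, (y₀, v) ∈ ball (y₀, (0 : E)) r := fun v hv ↦ by
    rw [← ball_prod_same]; exact ⟨mem_ball_self hr, hv⟩
  have hex : ∀ v : E, ∃ α : ℝ → E × E, v ∈ ball (0 : E) r → α 0 = (y₀, v) ∧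
      ∀ t ∈ Ioo (-δ) δ, HasDerivAt α (Y (α t)) t ∧ α t ∈ ball (y₀, 0) (min R R₁) := by
    intro v
    by_cases h : v ∈ ball (0 : E) r
    · obtain ⟨α, h0, hα⟩ := hflow _ (hv v h) 0
      exact ⟨α, fun _ ↦ ⟨h0, by simpa using hα⟩⟩
    · exact ⟨fun _ ↦ 0, fun h' ↦ absurd h' h⟩
  choose α hα using hex
  set D : ℝ := Real.exp (L * δ) with hD
  have hD0 : 0 < D := Real.exp_pos _
  obtain ⟨h, hh, hhδ, hhL⟩ : ∃ h : ℝ, 0 < h ∧ h < δ ∧ L * D * h ≤ 1 / 2 := by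
    refine ⟨min (δ / 2) (1 / (2 * (L * D + 1))), by positivity,
      (min_le_left _ _).trans_lt (by linarith), ?_⟩
    have h1 : L * D * min (δ / 2) (1 / (2 * (L * D + 1))) ≤ L * D * (1 / (2 * (L * D + 1))) := by
      gcongr; exact min_le_right _ _
    refine h1.trans ?_
    rw [mul_one_div, div_le_div_iff₀ (by positivity) (by norm_num)]
    nlinarith [L.coe_nonneg]
  have hIcc : Icc 0 h ⊆ Ioo (-δ) δ := fun t ht ↦ ⟨by linarith [ht.1], by linarith [ht.2]⟩
  have hlip : ∀ v ∈ ball (0 : E) r, ∀ w ∈ ball (0 : E) r, ∀ t ∈ Icc 0 h,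
      ‖α v t - α w t‖ ≤ D * ‖v - w‖ := by
    intro v hv' w hw t ht
    have := dist_le_of_trajectories_ODE_of_mem (v := fun _ ↦ Y)
      (s := fun _ ↦ ball (y₀, 0) (min R R₁)) (K := L) (f := α v) (g := α w) (a := 0) (b := h)
      (δ := ‖v - w‖) (fun _ _ ↦ hLb)
      (fun σ hσ ↦ ((hα v hv').2 σ (hIcc hσ)).1.continuousAt.continuousWithinAt)
      (fun σ hσ ↦ ((hα v hv').2 σ (hIcc (Ico_subset_Icc_self hσ))).1.hasDerivWithinAt)
      (fun σ hσ ↦ ((hα v hv').2 σ (hIcc (Ico_subset_Icc_self hσ))).2)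
      (fun σ hσ ↦ ((hα w hw).2 σ (hIcc hσ)).1.continuousAt.continuousWithinAt)
      (fun σ hσ ↦ ((hα w hw).2 σ (hIcc (Ico_subset_Icc_self hσ))).1.hasDerivWithinAt)
      (fun σ hσ ↦ ((hα w hw).2 σ (hIcc (Ico_subset_Icc_self hσ))).2)
      (by rw [(hα v hv').1, (hα w hw).1, dist_eq_norm]; simp [Prod.norm_def]) t ht
    rw [dist_eq_norm, mul_comm] at this
    refine this.trans ?_
    gcongr
    rw [hD]
    gcongr
    linarith [ht.2]
  have hbd2 : ∀ v ∈ ball (0 : E) r, ∀ w ∈ ball (0 : E) r, ∀ t ∈ Icc 0 h,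
      ‖(α v t).2 - (α w t).2 - (v - w)‖ ≤ L * D * ‖v - w‖ * h := by
    intro v hv' w hw t ht
    have := (convex_Icc 0 h).norm_image_sub_le_of_norm_hasDerivWithin_le
      (f := fun t ↦ (α v t).2 - (α w t).2) (f' := fun t ↦ (Y (α v t)).2 - (Y (α w t)).2)
      (C := L * D * ‖v - w‖) (x := 0) (y := t)
      (fun σ hσ ↦ (((hasDerivAt_snd_comp ((hα v hv').2 σ (hIcc hσ)).1)).sub
        (hasDerivAt_snd_comp ((hα w hw).2 σ (hIcc hσ)).1)).hasDerivWithinAt)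
      (fun σ hσ ↦ by
        have h1 := hLb.norm_sub_le ((hα v hv').2 σ (hIcc hσ)).2 ((hα w hw).2 σ (hIcc hσ)).2
        have h2 : ‖(Y (α v σ)).2 - (Y (α w σ)).2‖ ≤ ‖Y (α v σ) - Y (α w σ)‖ :=
          norm_snd_le (Y (α v σ) - Y (α w σ))
        have h3 := hlip v hv' w hw σ hσ
        calc _ ≤ L * ‖α v σ - α w σ‖ := h2.trans h1
          _ ≤ L * (D * ‖v - w‖) := by gcongr
          _ = _ := by ring) ⟨le_rfl, hh.le⟩ ht
    simp only [(hα v hv').1, (hα w hw).1, sub_zero] at this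
    refine this.trans ?_
    rw [Real.norm_of_nonneg ht.1]
    gcongr
    exact ht.2
  have hbd1 : ∀ v ∈ ball (0 : E) r, ∀ w ∈ ball (0 : E) r,
      ‖(α v h).1 - (α w h).1 - h • (v - w)‖ ≤ 1 / 2 * ‖v - w‖ * h := by
    intro v hv' w hw
    have := (convex_Icc 0 h).norm_image_sub_le_of_norm_hasDerivWithin_le
      (f := fun t ↦ (α v t).1 - (α w t).1 - t • (v - w))
      (f' := fun t ↦ (α v t).2 - (α w t).2 - (v - w))
      (C := L * D * ‖v - w‖ * h) (x := 0) (y := h)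
      (fun σ hσ ↦ by
        have h1 := (hasDerivAt_fst_comp ((hα v hv').2 σ (hIcc hσ)).1).sub
          (hasDerivAt_fst_comp ((hα w hw).2 σ (hIcc hσ)).1)
        have h2 := (hasDerivAt_id σ).smul_const (v - w)
        rw [one_smul] at h2
        exact (h1.sub h2).hasDerivWithinAt)
      (fun σ hσ ↦ hbd2 v hv' w hw σ hσ) ⟨le_rfl, hh.le⟩ ⟨hh.le, le_rfl⟩
    simp only [(hα v hv').1, (hα w hw).1, sub_zero, sub_self, zero_smul] at this
    refine this.trans ?_
    rw [Real.norm_of_nonneg hh.le]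
    calc L * D * ‖v - w‖ * h * h = (L * D * h) * (‖v - w‖ * h) := by ring
      _ ≤ 1 / 2 * (‖v - w‖ * h) := mul_le_mul_of_nonneg_right hhL (by positivity)
      _ = 1 / 2 * ‖v - w‖ * h := by ring
  have happ : ApproximatesLinearOn (fun v ↦ h⁻¹ • (α v h).1) (ContinuousLinearMap.id ℝ E)
      (ball 0 r) (1 / 2) := by
    intro v hv' w hw
    have h1 := hbd1 v hv' w hw
    have h2 : h⁻¹ • (α v h).1 - h⁻¹ • (α w h).1 - (v - w) =
        h⁻¹ • ((α v h).1 - (α w h).1 - h • (v - w)) := by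
      rw [smul_sub, smul_sub, smul_smul, inv_mul_cancel₀ hh.ne', one_smul]
    change ‖h⁻¹ • (α v h).1 - h⁻¹ • (α w h).1 - (v - w)‖ ≤ _
    rw [h2, norm_smul, norm_inv, Real.norm_of_nonneg hh.le, inv_mul_le_iff₀ hh]
    refine h1.trans (le_of_eq ?_)
    push_cast; ring
  have h0 : (0 : E) ∈ ball (0 : E) r := mem_ball_self hr
  have hconst : α 0 h = (y₀, 0) := by
    have := ODE_solution_unique_of_mem_Ioo (v := fun _ ↦ Y)
      (s := fun _ ↦ ball (y₀, 0) (min R R₁)) (K := L) (f := α 0) (g := fun _ ↦ (y₀, 0))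
      (a := -δ) (b := δ) (t₀ := 0) (fun _ _ ↦ hLb) ⟨by linarith, hδ⟩
      (fun t ht ↦ (hα 0 h0).2 t ht)
      (fun t _ ↦ ⟨by
        have : Y (y₀, 0) = 0 := by simp [hYdef, hS0]
        rw [this]; exact hasDerivAt_const t _, mem_ball_self (lt_min hR hR₁)⟩) (hα 0 h0).1
    exact this ⟨by linarith, hhδ⟩
  let inv : (ContinuousLinearMap.id ℝ E).NonlinearRightInverse :=
    { toFun := id, nnnorm := 1, bound' := fun y ↦ by simp, right_inv' := fun y ↦ rfl }
  have himg := happ.image_mem_nhds inv (ball_mem_nhds 0 hr) (Or.inr (by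
    change (1 / 2 : ℝ≥0) < 1⁻¹
    rw [inv_one]; exact NNReal.half_lt_self one_ne_zero))
  rw [hconst] at himg
  have hcont : Tendsto (fun y : E ↦ h⁻¹ • y) (𝓝 y₀) (𝓝 (h⁻¹ • y₀)) :=
    (continuous_const_smul _).tendsto _
  refine ⟨h, hh, δ, hhδ, ?_⟩
  filter_upwards [hcont himg] with y hy
  obtain ⟨v, hv', hvy⟩ := hy
  refine ⟨α v, by rw [(hα v hv').1], ?_, fun t ht ↦ ⟨((hα v hv').2 t ht).1,
    ball_subset_ball (min_le_left _ _) ((hα v hv').2 t ht).2⟩⟩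
  have := congrArg (fun x ↦ h • x) hvy
  simpa [smul_smul, hh.ne'] using this

end Exponential

section Extension

variable {N : Type*}

/-- A curve with a local property extends beyond the right end of its interval of definition. -/
lemma exists_extension_right {P : (ℝ → N) → ℝ → Prop}
    (hloc : ∀ f g t, f =ᶠ[𝓝 t] g → P f t → P g t) {A s : Set ℝ} (hA : A.OrdConnected)
    (hr : ∀ f a b, a < b → b ∈ A → Ioo a b ⊆ A → (∀ t ∈ Ioo a b, P f t) →
      ∃ f', f' =ᶠ[𝓝[<] b] f ∧ P f' b)
    (hopen : ∀ f t, P f t → ∀ᶠ u in 𝓝 t, u ∈ A → P f u)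
    (hAo : IsOpen A)
    (hs : IsOpen s) (hsc : s.OrdConnected) (hsA : s ⊆ A) {f : ℝ → N} (hf : ∀ t ∈ s, P f t)
    {x₀ x : ℝ} (hx₀ : x₀ ∈ s) (hx : x ∈ A) (hxs : x ∉ s) (hxx : x₀ ≤ x) :
    ∃ (s' : Set ℝ) (f' : ℝ → N), IsOpen s' ∧ s'.OrdConnected ∧ s ⊆ s' ∧ s' ⊆ A ∧ s' ≠ s ∧
      EqOn f' f s ∧ ∀ t ∈ s', P f' t := by
  have hub : ∀ y ∈ s, y < x := fun y hy ↦ lt_of_not_ge fun h ↦ hxs (hsc.out hx₀ hy ⟨hxx, h⟩)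
  have hbdd : BddAbove s := ⟨x, fun y hy ↦ (hub y hy).le⟩
  set b := sSup s with hb
  have hlub : IsLUB s b := isLUB_csSup ⟨x₀, hx₀⟩ hbdd
  have hbs : b ∉ s := by
    intro h
    obtain ⟨e, he, hes⟩ := Metric.isOpen_iff.1 hs b h
    have h1 : b + e / 2 ∈ s := hes (by simp [abs_of_pos he]; linarith)
    linarith [hlub.1 h1]
  have hltb : ∀ y ∈ s, y < b := fun y hy ↦ lt_of_le_of_ne (hlub.1 hy) fun h ↦ hbs (h ▸ hy)
  have hIs : Ioo x₀ b ⊆ s := by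
    intro y hy
    obtain ⟨z, hz, hyz, -⟩ := hlub.exists_between hy.2
    exact hsc.out hx₀ hz ⟨hy.1.le, hyz.le⟩
  have hbx : b ≤ x := hlub.2 fun y hy ↦ (hub y hy).le
  have hbA : b ∈ A := hA.out (hsA hx₀) hx ⟨(hltb x₀ hx₀).le, hbx⟩
  obtain ⟨f', hf', hPb⟩ := hr f x₀ b (hltb x₀ hx₀) hbA (hIs.trans hsA) fun t ht ↦ hf t (hIs ht)
  have hnear : ∀ᶠ u in 𝓝 b, P f' u ∧ u ∈ A := by
    filter_upwards [hopen f' b hPb, hAo.mem_nhds hbA] with u hu hu' using ⟨hu hu', hu'⟩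
  obtain ⟨e, he, hes⟩ := Metric.eventually_nhds_iff_ball.1 hnear
  set f'' : ℝ → N := fun t ↦ if t < b then f t else f' t with hf''
  have hfb : f'' =ᶠ[𝓝 b] f' := by
    rw [Filter.EventuallyEq, eventually_nhdsWithin_iff] at hf'
    filter_upwards [hf'] with u hu
    by_cases h : u < b
    · simp [hf'', h, hu h]
    · simp [hf'', h]
  refine ⟨s ∪ Ioo x₀ (b + e), f'', hs.union isOpen_Ioo, ?_, subset_union_left, ?_, ?_, ?_, ?_⟩
  · have : IsPreconnected (s ∪ Ioo x₀ (b + e)) := by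
      have h1 : (s ∩ Ioo x₀ (b + e)).Nonempty := by
        obtain ⟨z, hz, hyz, hzb⟩ := hlub.exists_between (hltb x₀ hx₀)
        exact ⟨z, hz, hyz, by linarith⟩
      exact hsc.isPreconnected.union' h1 isPreconnected_Ioo
    exact this.ordConnected
  · refine union_subset hsA fun y hy ↦ ?_
    rcases lt_or_ge y b with h | h
    · exact hsA (hIs ⟨hy.1, h⟩)
    · refine (hes y ?_).2
      rw [Metric.mem_ball, Real.dist_eq, abs_of_nonneg (by linarith)]
      linarith [hy.2]
  · intro h
    exact hbs (h ▸ Or.inr ⟨hltb x₀ hx₀, by linarith⟩)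
  · intro y hy
    simp [hf'', hltb y hy]
  · intro t ht
    rcases lt_trichotomy t b with h | h | h
    · have hts : t ∈ s := ht.elim id fun h' ↦ hIs ⟨h'.1, h⟩
      refine hloc f f'' t ?_ (hf t hts)
      filter_upwards [Iio_mem_nhds h] with u hu
      simp [hf'', mem_Iio.1 hu]
    · subst h
      exact hloc f' f'' _ hfb.symm hPb
    · have ht' : t ∈ Ioo x₀ (b + e) := ht.elim (fun h' ↦ absurd (hltb t h') h.not_gt) id
      refine hloc f' f'' t ?_ (hes t ?_).1
      · filter_upwards [Ioi_mem_nhds h] with u hu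
        simp [hf'', (mem_Ioi.1 hu).not_gt]
      · rw [Metric.mem_ball, Real.dist_eq, abs_of_nonneg (by linarith)]
        linarith [ht'.2]

/-- A curve with a local property that extends beyond both ends of any interval extends as far as
possible. -/
theorem exists_extension {P : (ℝ → N) → ℝ → Prop}
    (hloc : ∀ f g t, f =ᶠ[𝓝 t] g → P f t → P g t) {A s : Set ℝ} (hA : A.OrdConnected)
    (hAo : IsOpen A)
    (hr : ∀ f a b, a < b → b ∈ A → Ioo a b ⊆ A → (∀ t ∈ Ioo a b, P f t) →
      ∃ f', f' =ᶠ[𝓝[<] b] f ∧ P f' b)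
    (hl : ∀ f a b, a < b → a ∈ A → Ioo a b ⊆ A → (∀ t ∈ Ioo a b, P f t) →
      ∃ f', f' =ᶠ[𝓝[>] a] f ∧ P f' a)
    (hopen : ∀ f t, P f t → ∀ᶠ u in 𝓝 t, u ∈ A → P f u)
    (hs : IsOpen s) (hsc : s.OrdConnected) (hsA : s ⊆ A) (hne : s.Nonempty) {f : ℝ → N}
    (hf : ∀ t ∈ s, P f t) :
    ∃ f', EqOn f' f s ∧ ∀ t ∈ A, P f' t := by
  let T := {p : Set ℝ × (ℝ → N) // IsOpen p.1 ∧ p.1.OrdConnected ∧ s ⊆ p.1 ∧ p.1 ⊆ A ∧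
    EqOn p.2 f s ∧ ∀ t ∈ p.1, P p.2 t}
  let r : T → T → Prop := fun p q ↦ p.1.1 ⊆ q.1.1 ∧ EqOn q.1.2 p.1.2 p.1.1
  have hex : ∃ m : T, ∀ a, r m a → r a m := by
    refine exists_maximal_of_chains_bounded (r := r) (fun c hc ↦ ?_) (fun {p q o} h1 h2 ↦
      ⟨h1.1.trans h2.1, fun t ht ↦ (h2.2 (h1.1 ht)).trans (h1.2 ht)⟩)
    rcases c.eq_empty_or_nonempty with rfl | ⟨p₀, hp₀⟩
    · exact ⟨⟨(s, f), hs, hsc, Subset.rfl, hsA, fun _ _ ↦ rfl, hf⟩, by simp⟩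
    classical
    let F : ℝ → N := fun t ↦ if h : ∃ p ∈ c, t ∈ p.1.1 then h.choose.1.2 t else f t
    have hF : ∀ p ∈ c, EqOn F p.1.2 p.1.1 := by
      intro p hp t ht
      have h : ∃ p ∈ c, t ∈ p.1.1 := ⟨p, hp, ht⟩
      have e : F t = h.choose.1.2 t := dif_pos h
      rw [e]
      by_cases hpq : h.choose = p
      · rw [hpq]
      rcases hc h.choose_spec.1 hp hpq with h' | h'
      · exact (h'.2 h.choose_spec.2).symm
      · exact h'.2 ht
    have hsub : s ⊆ ⋃ p ∈ c, p.1.1 := fun t ht ↦ mem_iUnion₂.2 ⟨p₀, hp₀, p₀.2.2.2.1 ht⟩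
    refine ⟨⟨(⋃ p ∈ c, p.1.1, F), isOpen_biUnion fun p _ ↦ p.2.1, ?_, hsub, ?_, ?_, ?_⟩, ?_⟩
    · obtain ⟨y, hy⟩ := hne
      have : IsPreconnected (⋃ p ∈ c, p.1.1) := by
        rw [← sUnion_image]
        refine isPreconnected_sUnion y _ ?_ ?_
        · rintro _ ⟨p, hp, rfl⟩
          exact p.2.2.2.1 hy
        · rintro _ ⟨p, hp, rfl⟩
          exact p.2.2.1.isPreconnected
      exact this.ordConnected
    · exact iUnion₂_subset fun p _ ↦ p.2.2.2.2.1
    · intro t ht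
      exact (hF p₀ hp₀ (p₀.2.2.2.1 ht)).trans (p₀.2.2.2.2.2.1 ht)
    · intro t ht
      obtain ⟨p, hp, ht⟩ := mem_iUnion₂.1 ht
      refine hloc p.1.2 F t ?_ (p.2.2.2.2.2.2 t ht)
      filter_upwards [p.2.1.mem_nhds ht] with u hu using (hF p hp hu).symm
    · intro p hp
      exact ⟨fun t ht ↦ mem_iUnion₂.2 ⟨p, hp, ht⟩, hF p hp⟩
  obtain ⟨⟨⟨S, F⟩, hSo, hSc, hsS, hSA, hFs, hPF⟩, hmax⟩ := hex
  simp only at hSo hSc hsS hSA hFs hPF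
  obtain ⟨x₀, hx₀⟩ := hne
  have hkey : ∀ (S' : Set ℝ) (F' : ℝ → N), IsOpen S' → S'.OrdConnected → S ⊆ S' → S' ⊆ A →
      S' ≠ S → EqOn F' F S → ¬ ∀ t ∈ S', P F' t := by
    intro S' F' h1 h2 h3 h4 h5 h6 h7
    exact h5 ((hmax ⟨(S', F'), h1, h2, hsS.trans h3, h4,
      fun t ht ↦ (h6 (hsS ht)).trans (hFs ht), h7⟩ ⟨h3, h6⟩).1.antisymm h3)
  have hAS : A ⊆ S := by
    intro x hx
    by_contra hxS
    rcases le_total x₀ x with h | h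
    · obtain ⟨S', F', h1, h2, h3, h4, h5, h6, h7⟩ := exists_extension_right hloc hA hr hopen hAo
        hSo hSc hSA hPF (hsS hx₀) hx hxS h
      exact hkey S' F' h1 h2 h3 h4 h5 h6 h7
    · have hneg : ∀ {B : Set ℝ} {y : ℝ}, y ∈ -B ↔ -y ∈ B := Set.mem_neg
      have hoc : ∀ B : Set ℝ, B.OrdConnected → (-B).OrdConnected := fun B hB ↦
        ⟨fun y hy z hz u hu ↦ hB.out hz hy ⟨by linarith [hu.2], by linarith [hu.1]⟩⟩
      have htend : ∀ t : ℝ, Tendsto (fun u : ℝ ↦ -u) (𝓝 (-t)) (𝓝 t) := fun t ↦ by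
        simpa using (continuous_neg (G := ℝ)).tendsto (-t)
      have htend' : ∀ t : ℝ, Tendsto (fun u : ℝ ↦ -u) (𝓝 t) (𝓝 (-t)) := fun t ↦
        (continuous_neg (G := ℝ)).tendsto t
      obtain ⟨S', F', h1, h2, h3, h4, h5, h6, h7⟩ := exists_extension_right
        (P := fun f t ↦ P (fun u ↦ f (-u)) (-t)) (A := -A) (s := -S) (f := fun t ↦ F (-t))
        (x₀ := -x₀) (x := -x)
        (fun f g t hfg ↦ hloc _ _ _ ((htend t).eventually hfg)) (hoc A hA)
        (fun f a b hab hb hAab hP ↦ by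
          obtain ⟨f', hf', hP'⟩ := hl (fun u ↦ f (-u)) (-b) (-a) (by linarith) hb
            (fun y hy ↦ by
              have := @hAab (-y) ⟨by linarith [hy.2], by linarith [hy.1]⟩
              simpa using this)
            (fun t ht ↦ by simpa using hP (-t) ⟨by linarith [ht.2], by linarith [ht.1]⟩)
          refine ⟨fun u ↦ f' (-u), ?_, by simpa using hP'⟩
          rw [Filter.EventuallyEq, eventually_nhdsWithin_iff] at hf' ⊢
          filter_upwards [(htend' b).eventually hf'] with u hu hub
          simpa using hu (by simpa using hub))
        (fun f t hP ↦ by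
          filter_upwards [(htend' t).eventually (hopen _ _ hP)] with u hu hu' using hu hu')
        hAo.neg hSo.neg (hoc S hSc) (neg_subset_neg.2 hSA)
        (fun t ht ↦ by simpa using hPF (-t) ht) (by simpa using hsS hx₀) (by simpa using hx)
        (by simpa using hxS) (by linarith)
      refine hkey (-S') (fun t ↦ F' (-t)) h1.neg (hoc S' h2) ?_ ?_ ?_ ?_ ?_
      · intro y hy; exact h3 (by simpa using hy)
      · intro y hy; simpa using h4 hy
      · intro h; exact h5 (by rw [← h, neg_neg])
      · intro y hy; simpa using h6 (x := -y) (by simpa using hy)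
      · intro t ht; simpa using h7 (-t) ht
  exact ⟨F, hFs, fun t ht ↦ hPF t (hAS ht)⟩

end Extension

section Charts

variable {E : Type*} [NormedAddCommGroup E] [NormedSpace ℝ E]
  {H : Type*} [TopologicalSpace H] {I : ModelWithCorners ℝ E H}
  {M : Type*} [TopologicalSpace M] [ChartedSpace H M]
  {E' : Type*} [NormedAddCommGroup E'] [NormedSpace ℝ E']
  {H' : Type*} [TopologicalSpace H'] {I' : ModelWithCorners ℝ E' H'}
  {S : Type*} [TopologicalSpace S] [ChartedSpace H' S]
  {E'' : Type*} [NormedAddCommGroup E''] [NormedSpace ℝ E'']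
  {H'' : Type*} [TopologicalSpace H''] {I'' : ModelWithCorners ℝ E'' H''}
  {R : Type*} [TopologicalSpace R] [ChartedSpace H'' R]

lemma metric_congr (g : MetricTensor I M) {x y : M} (h : x = y) (u v : E) :
    g x (u : TangentSpace I x) (v : TangentSpace I x) =
      g y (u : TangentSpace I y) (v : TangentSpace I y) := by
  subst h; rfl

lemma pullbackMetric_comp (g : MetricTensor I M) {f : S → M} {h : R → S} {r : R}
    (hf : MDifferentiableAt I' I f (h r)) (hh : MDifferentiableAt I'' I' h r) (v w : E'') :
    pullbackMetric I'' (f ∘ h) g r v w =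
      pullbackMetric I' f g (h r) (mfderiv I'' I' h r v) (mfderiv I'' I' h r w) := by
  simp only [pullbackMetric, mfderiv_comp r hf hh]
  rfl

lemma pullbackMetric_congr (g : MetricTensor I M) {f f' : S → M} {s : S} (h : f =ᶠ[𝓝 s] f')
    (v w : E') : pullbackMetric I' f g s v w = pullbackMetric I' f' g s v w := by
  change g (f s) (mfderiv I' I f s v) (mfderiv I' I f s w) =
    g (f' s) (mfderiv I' I f' s v) (mfderiv I' I f' s w)
  have h1 := h.mfderiv_eq (I := I') (I' := I)
  have h2 : ∀ u : E', (mfderiv I' I f s u : E) = mfderiv I' I f' s u := fun u ↦ by rw [h1]; rfl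
  rw [show g (f s) (mfderiv I' I f s v) (mfderiv I' I f s w) = _ from
    metric_congr g h.eq_of_nhds _ _, h2 v, h2 w]

/-- The metric in the preferred chart at `q`, as a field of bilinear forms on the model space. -/
def chartForm (g : MetricTensor I M) (q : M) : E → E →L[ℝ] E →L[ℝ] ℝ :=
  pullbackMetric 𝓘(ℝ, E) (extChartAt I q).symm g

lemma chartForm_apply (g : MetricTensor I M) (q : M) (y v w : E) :
    chartForm g q y v w = chartMetric g q y v w := rfl

lemma extChartAt_source_mem_nhds_of_mem {q x : M} (hx : x ∈ (extChartAt I q).source) :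
    (extChartAt I q).source ∈ 𝓝 x := (isOpen_extChartAt_source q).mem_nhds hx

lemma extChartAt_target_mem_nhds_of_mem [I.Boundaryless] {q : M} {y : E}
    (hy : y ∈ (extChartAt I q).target) :
    (extChartAt I q).target ∈ 𝓝 y := (isOpen_extChartAt_target q).mem_nhds hy

section Manifold

variable [IsManifold I ∞ M]

lemma mdifferentiableAt_extChartAt' {q x : M} (hx : x ∈ (extChartAt I q).source) :
    MDifferentiableAt I 𝓘(ℝ, E) (extChartAt I q) x :=
  (contMDiffAt_extChartAt' (n := 1) (by simpa using hx)).mdifferentiableAt (by simp)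

lemma contMDiffAt_chart_comp {f : S → M} {s : S} {q : M} {n : ℕ∞}
    (hf : ContMDiffAt I' I n f s) (hq : f s ∈ (extChartAt I q).source) :
    ContMDiffAt I' 𝓘(ℝ, E) n (extChartAt I q ∘ f) s :=
  ContMDiffAt.comp s ((contMDiffAt_extChartAt' (n := ∞) (by simpa using hq)).of_le
    (by exact_mod_cast le_top)) hf

lemma contDiffAt_chart_comp {f : E' → M} {s : E'} {q : M} {n : ℕ∞}
    (hf : ContMDiffAt 𝓘(ℝ, E') I n f s) (hq : f s ∈ (extChartAt I q).source) :
    ContDiffAt ℝ n (extChartAt I q ∘ f) s :=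
  (contMDiffAt_chart_comp hf hq).contDiffAt

variable [I.Boundaryless]

lemma contMDiffAt_extChartAt_symm {q : M} {y : E} (hy : y ∈ (extChartAt I q).target) :
    ContMDiffAt 𝓘(ℝ, E) I ∞ (extChartAt I q).symm y :=
  (contMDiffOn_extChartAt_symm q).contMDiffAt ((isOpen_extChartAt_target q).mem_nhds hy)

lemma mdifferentiableAt_extChartAt_symm {q : M} {y : E} (hy : y ∈ (extChartAt I q).target) :
    MDifferentiableAt 𝓘(ℝ, E) I (extChartAt I q).symm y :=
  (contMDiffAt_extChartAt_symm hy).mdifferentiableAt (by simp)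

/-- A pulled back metric, computed in a chart of the target. -/
lemma pullbackMetric_eq_chartForm (g : MetricTensor I M) {f : S → M} {s : S} {q : M}
    (hf : MDifferentiableAt I' I f s) (hq : f s ∈ (extChartAt I q).source) (v w : E') :
    pullbackMetric I' f g s v w = chartForm g q (extChartAt I q (f s))
      (mfderiv I' 𝓘(ℝ, E) (extChartAt I q ∘ f) s v)
      (mfderiv I' 𝓘(ℝ, E) (extChartAt I q ∘ f) s w) := by
  have h1 : f =ᶠ[𝓝 s] (extChartAt I q).symm ∘ (extChartAt I q ∘ f) := by
    filter_upwards [hf.continuousAt (extChartAt_source_mem_nhds_of_mem hq)] with z hz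
    exact ((extChartAt I q).left_inv hz).symm
  exact (pullbackMetric_congr g h1 v w).trans (pullbackMetric_comp (h := extChartAt I q ∘ f) g
    (mdifferentiableAt_extChartAt_symm ((extChartAt I q).map_source hq))
    ((mdifferentiableAt_extChartAt' hq).comp s hf) v w)

lemma metric_eq_chartForm (g : MetricTensor I M) {x q : M} (hq : x ∈ (extChartAt I q).source)
    (v w : TangentSpace I x) :
    g x v w = chartForm g q (extChartAt I q x) (mfderiv I 𝓘(ℝ, E) (extChartAt I q) x v)
      (mfderiv I 𝓘(ℝ, E) (extChartAt I q) x w) := by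
  have h := pullbackMetric_eq_chartForm (I' := I) (S := M) (f := id) g mdifferentiableAt_id hq v w
  rw [Function.comp_id] at h
  refine Eq.trans ?_ h
  simp [pullbackMetric]

variable [IsManifold I' ∞ S] [I'.Boundaryless]

/-- The expression of a pulled back metric in charts. -/
lemma chartForm_pullbackMetric (g : MetricTensor I M) {f : S → M} {s₀ : S} {q : M} {y : E'}
    (hy : y ∈ (extChartAt I' s₀).target)
    (hf : MDifferentiableAt I' I f ((extChartAt I' s₀).symm y))
    (hq : f ((extChartAt I' s₀).symm y) ∈ (extChartAt I q).source) (v w : E') :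
    chartForm (pullbackMetric I' f g) s₀ y v w =
      chartForm g q ((extChartAt I q ∘ f ∘ (extChartAt I' s₀).symm) y)
        (fderiv ℝ (extChartAt I q ∘ f ∘ (extChartAt I' s₀).symm) y v)
        (fderiv ℝ (extChartAt I q ∘ f ∘ (extChartAt I' s₀).symm) y w) := by
  have h1 := mdifferentiableAt_extChartAt_symm hy
  have h2 := pullbackMetric_comp (I'' := 𝓘(ℝ, E')) g hf h1 v w
  have h3 := pullbackMetric_eq_chartForm (I' := 𝓘(ℝ, E')) (q := q) g (hf.comp y h1) hq v w
  rw [mfderiv_eq_fderiv] at h3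
  exact h2.symm.trans h3

/-- The change of charts. -/
lemma chartForm_chart_change (g : MetricTensor I M) {q q' : M} {y : E}
    (hy : y ∈ (extChartAt I q).target)
    (hq : (extChartAt I q).symm y ∈ (extChartAt I q').source) (v w : E) :
    chartForm g q y v w =
      chartForm g q' ((extChartAt I q' ∘ (extChartAt I q).symm) y)
        (fderiv ℝ (extChartAt I q' ∘ (extChartAt I q).symm) y v)
        (fderiv ℝ (extChartAt I q' ∘ (extChartAt I q).symm) y w) := by
  have h3 := pullbackMetric_eq_chartForm (I' := 𝓘(ℝ, E)) (q := q') g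
    (mdifferentiableAt_extChartAt_symm hy) hq v w
  rw [mfderiv_eq_fderiv] at h3
  exact h3

end Manifold

end Charts

section Geodesics

variable {E : Type*} [NormedAddCommGroup E] [NormedSpace ℝ E]
  {H : Type*} [TopologicalSpace H] {I : ModelWithCorners ℝ E H}
  {M : Type*} [TopologicalSpace M] [ChartedSpace H M]

/-- Smooth symmetric nondegenerate metrics, with smoothness expressed in the preferred charts. -/
structure IsPseudoRiemannian (g : MetricTensor I M) : Prop where
  smooth : ∀ (q : M) (y : E), y ∈ (extChartAt I q).target → ContDiffAt ℝ ∞ (chartForm g q) y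
  symm : ∀ x (u v : TangentSpace I x), g x u v = g x v u
  nondegenerate : ∀ x (u : TangentSpace I x), (∀ v, g x u v = 0) → u = 0

lemma IsPseudoRiemannian.differentiableAt {g : MetricTensor I M} (hg : IsPseudoRiemannian g)
    {q : M} {y : E} (hy : y ∈ (extChartAt I q).target) : DifferentiableAt ℝ (chartForm g q) y :=
  (hg.smooth q y hy).differentiableAt (by simp)

/-- The geodesic equation at time `t`, in the chart at `q`. -/
def GeodesicAt (g : MetricTensor I M) (q : M) (γ : ℝ → M) (t : ℝ) : Prop :=
  ContMDiffAt 𝓘(ℝ, ℝ) I 2 γ t ∧ ∀ w : E, geoRes (chartForm g q) (extChartAt I q (γ t))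
    (deriv (extChartAt I q ∘ γ) t) (deriv (deriv (extChartAt I q ∘ γ)) t) w = 0

lemma isGeodesicOn_iff {g : MetricTensor I M} {γ : ℝ → M} {s : Set ℝ}
    (hg : ∀ t ∈ s, DifferentiableAt ℝ (chartForm g (γ t)) (extChartAt I (γ t) (γ t))) :
    IsGeodesicOn g γ s ↔ ∀ t ∈ s, GeodesicAt g (γ t) γ t := by
  refine forall₂_congr fun t ht ↦ and_congr_right fun _ ↦ forall_congr' fun w ↦ ?_
  simp only [geoRes, christ, christoffel, ← chartForm_apply, fderiv_bilin_apply (hg t ht)]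
  rfl

/-- Position and velocity of a curve, in the chart at `q`. -/
def chartState (I : ModelWithCorners ℝ E H) (q : M) (γ : ℝ → M) (t : ℝ) : E × E :=
  (extChartAt I q (γ t), deriv (extChartAt I q ∘ γ) t)

lemma chartState_congr {q : M} {γ₁ γ₂ : ℝ → M} {t : ℝ} (h : γ₁ =ᶠ[𝓝 t] γ₂) :
    chartState I q γ₁ t = chartState I q γ₂ t := by
  have h1 : extChartAt I q ∘ γ₁ =ᶠ[𝓝 t] extChartAt I q ∘ γ₂ :=
    h.fun_comp (extChartAt I q)
  simp only [chartState, h.eq_of_nhds, h1.deriv_eq]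

lemma GeodesicAt.congr {g : MetricTensor I M} {q : M} {γ₁ γ₂ : ℝ → M} {t : ℝ}
    (h : γ₁ =ᶠ[𝓝 t] γ₂) (hγ : GeodesicAt g q γ₁ t) : GeodesicAt g q γ₂ t := by
  have h1 : extChartAt I q ∘ γ₁ =ᶠ[𝓝 t] extChartAt I q ∘ γ₂ :=
    h.fun_comp (extChartAt I q)
  refine ⟨hγ.1.congr_of_eventuallyEq h.symm, fun w ↦ ?_⟩
  rw [← h1.deriv_eq, ← h1.deriv.deriv_eq, ← h.eq_of_nhds]
  exact hγ.2 w

lemma IsPseudoRiemannian.isGeodesicOn_iff {g : MetricTensor I M}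
    (hg : IsPseudoRiemannian g) {γ : ℝ → M} {s : Set ℝ} :
    IsGeodesicOn g γ s ↔ ∀ t ∈ s, GeodesicAt g (γ t) γ t :=
  StaticSpacetime.isGeodesicOn_iff fun t _ ↦ hg.differentiableAt (mem_extChartAt_target (γ t))

variable [IsManifold I ∞ M]

lemma contDiffAt_chart_curve {γ : ℝ → M} {t : ℝ} {q : M} (hγ : ContMDiffAt 𝓘(ℝ, ℝ) I 2 γ t)
    (hq : γ t ∈ (extChartAt I q).source) : ContDiffAt ℝ 2 (extChartAt I q ∘ γ) t :=
  contDiffAt_chart_comp (n := 2) hγ hq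

variable [I.Boundaryless] {g : MetricTensor I M}

lemma contDiffAt_chart_change {q q' : M} {y : E} (hy : y ∈ (extChartAt I q).target)
    (hq : (extChartAt I q).symm y ∈ (extChartAt I q').source) :
    ContDiffAt ℝ ∞ (extChartAt I q' ∘ (extChartAt I q).symm) y :=
  contDiffAt_chart_comp (n := ⊤) (contMDiffAt_extChartAt_symm hy) hq

/-- The derivative of a change of charts is inverse to that of the reverse change. -/
lemma fderiv_chart_change_comp {q q' : M} {x : M} (hq : x ∈ (extChartAt I q).source)
    (hq' : x ∈ (extChartAt I q').source) (w : E) :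
    fderiv ℝ (extChartAt I q' ∘ (extChartAt I q).symm) (extChartAt I q x)
      (fderiv ℝ (extChartAt I q ∘ (extChartAt I q').symm) (extChartAt I q' x) w) = w := by
  set f := extChartAt I q' ∘ (extChartAt I q).symm with hf
  set f' := extChartAt I q ∘ (extChartAt I q').symm with hf'
  have e1 : (extChartAt I q).symm (extChartAt I q x) = x := (extChartAt I q).left_inv hq
  have e2 : (extChartAt I q').symm (extChartAt I q' x) = x := (extChartAt I q').left_inv hq'
  have h0 : f' (extChartAt I q' x) = extChartAt I q x := by simp only [hf', Function.comp_apply, e2]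
  have h1 : DifferentiableAt ℝ f (extChartAt I q x) := (contDiffAt_chart_change
    ((extChartAt I q).map_source hq) (by rwa [e1])).differentiableAt (by simp)
  have h2 : DifferentiableAt ℝ f' (extChartAt I q' x) := (contDiffAt_chart_change
    ((extChartAt I q').map_source hq') (by rwa [e2])).differentiableAt (by simp)
  have h3 : f ∘ f' =ᶠ[𝓝 (extChartAt I q' x)] id := by
    have hc : ContinuousAt (extChartAt I q').symm (extChartAt I q' x) :=
      (contMDiffAt_extChartAt_symm ((extChartAt I q').map_source hq')).continuousAt
    have h4 := hc (extChartAt_source_mem_nhds_of_mem (I := I) (q := q) (by rwa [e2]))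
    filter_upwards [h4, extChartAt_target_mem_nhds_of_mem ((extChartAt I q').map_source hq')]
      with z hz hz'
    have h5 : (extChartAt I q).symm ((extChartAt I q) ((extChartAt I q').symm z)) =
      (extChartAt I q').symm z := (extChartAt I q).left_inv hz
    simp only [hf, hf', Function.comp_apply, h5, (extChartAt I q').right_inv hz', id]
  have h4 := h3.fderiv_eq (𝕜 := ℝ)
  rw [fderiv_comp (extChartAt I q' x) (by rwa [h0]) h2, h0, fderiv_id] at h4
  exact DFunLike.congr_fun h4 w

lemma GeodesicAt.chart_change (hg : IsPseudoRiemannian g) {q q' : M} {γ : ℝ → M} {t : ℝ}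
    (hγ : GeodesicAt g q γ t) (hq : γ t ∈ (extChartAt I q).source)
    (hq' : γ t ∈ (extChartAt I q').source) : GeodesicAt g q' γ t := by
  refine ⟨hγ.1, fun w ↦ ?_⟩
  set f := extChartAt I q' ∘ (extChartAt I q).symm with hf
  have hy := (extChartAt I q).map_source hq
  have hy' := (extChartAt I q').map_source hq'
  have e1 : (extChartAt I q).symm (extChartAt I q (γ t)) = γ t := (extChartAt I q).left_inv hq
  have hfy : f (extChartAt I q (γ t)) = extChartAt I q' (γ t) := by
    simp only [hf, Function.comp_apply, e1]
  have hcf : ContDiffAt ℝ 2 f (extChartAt I q (γ t)) :=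
    (contDiffAt_chart_change hy (by rwa [e1])).of_le (WithTop.coe_le_coe.2 le_top)
  have hc := contDiffAt_chart_curve hγ.1 hq
  have hcomp : f ∘ (extChartAt I q ∘ γ) =ᶠ[𝓝 t] extChartAt I q' ∘ γ := by
    filter_upwards [hγ.1.continuousAt (extChartAt_source_mem_nhds_of_mem hq)] with τ hτ
    have : (extChartAt I q).symm (extChartAt I q (γ τ)) = γ τ := (extChartAt I q).left_inv hτ
    simp only [hf, Function.comp_apply, this]
  have hd := deriv_deriv_comp (c := extChartAt I q ∘ γ) hcf hc
  rw [hcomp.deriv_eq, hcomp.deriv.deriv_eq] at hd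
  have hw := fderiv_chart_change_comp (I := I) hq hq' w
  have hnear : ∀ᶠ z in 𝓝 (extChartAt I q (γ t)), ∀ v w, chartForm g q z v w =
      chartForm g q' (f z) (fderiv ℝ f z v) (fderiv ℝ f z w) := by
    have hcs : ContinuousAt (extChartAt I q).symm (extChartAt I q (γ t)) :=
      (contMDiffAt_extChartAt_symm hy).continuousAt
    filter_upwards [extChartAt_target_mem_nhds_of_mem hy,
      hcs (extChartAt_source_mem_nhds_of_mem (I := I) (q := q') (by rwa [e1]))] with z hz hz' v w
    exact chartForm_chart_change g hz hz' v w
  have := geoRes_pullback (hg.differentiableAt hy) (by rw [hfy]; exact hg.differentiableAt hy')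
    hcf (fun v w ↦ hg.symm _ _ _) hnear (deriv (extChartAt I q ∘ γ) t)
    (deriv (deriv (extChartAt I q ∘ γ)) t)
    (fderiv ℝ (extChartAt I q ∘ (extChartAt I q').symm) (extChartAt I q' (γ t)) w)
  rw [hγ.2, hw, hfy] at this
  rw [hd.1, hd.2]
  exact this.symm

lemma mfderiv_symm_mfderiv {q x : M} (hx : x ∈ (extChartAt I q).source) (v : TangentSpace I x) :
    (mfderiv 𝓘(ℝ, E) I (extChartAt I q).symm (extChartAt I q x)
      (mfderiv I 𝓘(ℝ, E) (extChartAt I q) x v) : E) = v := by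
  have h1 : (extChartAt I q).symm ∘ extChartAt I q =ᶠ[𝓝 x] id := by
    filter_upwards [extChartAt_source_mem_nhds_of_mem hx] with z hz
    exact (extChartAt I q).left_inv hz
  have h2 := h1.mfderiv_eq (I := I) (I' := I)
  rw [mfderiv_comp x (mdifferentiableAt_extChartAt_symm ((extChartAt I q).map_source hx))
    (mdifferentiableAt_extChartAt' hx), mfderiv_id] at h2
  exact DFunLike.congr_fun h2 v

lemma mfderiv_mfderiv_symm {q : M} {y : E} (hy : y ∈ (extChartAt I q).target) (w : E) :
    (mfderiv I 𝓘(ℝ, E) (extChartAt I q) ((extChartAt I q).symm y)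
      (mfderiv 𝓘(ℝ, E) I (extChartAt I q).symm y w) : E) = w := by
  have h1 : extChartAt I q ∘ (extChartAt I q).symm =ᶠ[𝓝 y] id := by
    filter_upwards [extChartAt_target_mem_nhds_of_mem hy] with z hz
    exact (extChartAt I q).right_inv hz
  have h2 := h1.mfderiv_eq (I := 𝓘(ℝ, E)) (I' := 𝓘(ℝ, E))
  rw [mfderiv_comp y (mdifferentiableAt_extChartAt' ((extChartAt I q).map_target hy))
    (mdifferentiableAt_extChartAt_symm hy), mfderiv_id] at h2
  exact DFunLike.congr_fun h2 w

lemma chartForm_nondegenerate (hg : IsPseudoRiemannian g) {q : M} {y : E}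
    (hy : y ∈ (extChartAt I q).target) (v : E) (hv : ∀ w, chartForm g q y v w = 0) : v = 0 := by
  set x := (extChartAt I q).symm y with hx
  have hxs : x ∈ (extChartAt I q).source := (extChartAt I q).map_target hy
  have hxy : extChartAt I q x = y := (extChartAt I q).right_inv hy
  have h0 : mfderiv 𝓘(ℝ, E) I (extChartAt I q).symm y v = 0 := by
    refine hg.nondegenerate x _ fun u ↦ ?_
    have h := metric_eq_chartForm g hxs (mfderiv 𝓘(ℝ, E) I (extChartAt I q).symm y v) u
    rw [mfderiv_mfderiv_symm hy v, hxy] at h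
    rw [h]; exact hv _
  have := mfderiv_mfderiv_symm hy v
  rw [h0, map_zero] at this
  exact this.symm

end Geodesics

section GeodesicFlow

variable {E : Type*} [NormedAddCommGroup E] [NormedSpace ℝ E]
  {H : Type*} [TopologicalSpace H] {I : ModelWithCorners ℝ E H}
  {M : Type*} [TopologicalSpace M] [ChartedSpace H M]
  [FiniteDimensional ℝ E] [IsManifold I ∞ M] [I.Boundaryless] {g : MetricTensor I M}

lemma contDiffAt_geodesicField_chartForm (hg : IsPseudoRiemannian g) {q : M} {z : E × E}
    (hz : z.1 ∈ (extChartAt I q).target) :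
    ContDiffAt ℝ ∞ (geodesicField (chartForm g q)) z :=
  contDiffAt_geodesicField (hg.smooth q z.1 hz) (chartForm_nondegenerate hg hz) z.2

lemma GeodesicAt.hasDerivAt (hg : IsPseudoRiemannian g) {q : M} {γ : ℝ → M} {t : ℝ}
    (hγ : GeodesicAt g q γ t) (hq : γ t ∈ (extChartAt I q).source) :
    HasDerivAt (chartState I q γ)
      (geodesicField (chartForm g q) (chartState I q γ t)) t := by
  have hc := contDiffAt_chart_curve hγ.1 hq
  have h1 : HasDerivAt (extChartAt I q ∘ γ) (deriv (extChartAt I q ∘ γ) t) t :=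
    (hc.differentiableAt (by norm_num)).hasDerivAt
  have h2 : HasDerivAt (deriv (extChartAt I q ∘ γ)) (deriv (deriv (extChartAt I q ∘ γ)) t) t :=
    ((contDiffAt_deriv hc).differentiableAt (by norm_num)).hasDerivAt
  rw [(geoRes_eq_zero_iff (chartForm_nondegenerate hg ((extChartAt I q).map_source hq))
    _ _).1 hγ.2] at h2
  exact h1.prodMk h2

/-- A solution of the geodesic equation in a chart is a geodesic. -/
lemma isGeodesicOn_of_hasDerivAt (hg : IsPseudoRiemannian g) {q : M} {U : Set ℝ} (hU : IsOpen U)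
    {α : ℝ → E × E} (hα : ∀ t ∈ U, HasDerivAt α (geodesicField (chartForm g q) (α t)) t)
    (hαt : ∀ t ∈ U, (α t).1 ∈ (extChartAt I q).target) :
    IsGeodesicOn g (fun t ↦ (extChartAt I q).symm (α t).1) U ∧
      ∀ t ∈ U, chartState I q (fun t ↦ (extChartAt I q).symm (α t).1) t = α t := by
  have h1 : ∀ t ∈ U, HasDerivAt (fun τ ↦ (α τ).1) (α t).2 t := fun t ht ↦
    hasDerivAt_fst_comp (hα t ht)
  have h2 : ∀ t ∈ U, HasDerivAt (fun τ ↦ (α τ).2) (spray (chartForm g q) (α t).1 (α t).2) t :=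
    fun t ht ↦ hasDerivAt_snd_comp (hα t ht)
  have hc2 : ContDiffOn ℝ 1 (fun τ ↦ (α τ).2) U := by
    rw [show (1 : ℕ∞ω) = 0 + 1 from rfl, contDiffOn_succ_iff_deriv_of_isOpen hU]
    refine ⟨fun t ht ↦ (h2 t ht).differentiableAt.differentiableWithinAt, by simp, ?_⟩
    rw [contDiffOn_zero]
    refine ContinuousOn.congr (f := fun t ↦ (geodesicField (chartForm g q) (α t)).2) ?_
      fun t ht ↦ (h2 t ht).deriv
    intro t ht
    have := (contDiffAt_geodesicField_chartForm hg (hαt t ht)).continuousAt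
    exact (continuousAt_snd.comp (this.comp (hα t ht).continuousAt)).continuousWithinAt
  have hc1 : ContDiffOn ℝ 2 (fun τ ↦ (α τ).1) U := by
    rw [show (2 : ℕ∞ω) = 1 + 1 from by norm_num, contDiffOn_succ_iff_deriv_of_isOpen hU]
    exact ⟨fun t ht ↦ (h1 t ht).differentiableAt.differentiableWithinAt, by simp,
      hc2.congr fun t ht ↦ (h1 t ht).deriv⟩
  set γ : ℝ → M := fun t ↦ (extChartAt I q).symm (α t).1 with hγ
  have hγs : ∀ t ∈ U, γ t ∈ (extChartAt I q).source := fun t ht ↦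
    (extChartAt I q).map_target (hαt t ht)
  have hφγ : ∀ t ∈ U, extChartAt I q (γ t) = (α t).1 := fun t ht ↦
    (extChartAt I q).right_inv (hαt t ht)
  have hev : ∀ t ∈ U, extChartAt I q ∘ γ =ᶠ[𝓝 t] fun τ ↦ (α τ).1 := fun t ht ↦ by
    filter_upwards [hU.mem_nhds ht] with τ hτ using hφγ τ hτ
  have hd : ∀ t ∈ U, deriv (extChartAt I q ∘ γ) t = (α t).2 := fun t ht ↦
    (hev t ht).deriv_eq.trans (h1 t ht).deriv
  have hdd : ∀ t ∈ U, deriv (deriv (extChartAt I q ∘ γ)) t =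
      spray (chartForm g q) (α t).1 (α t).2 := fun t ht ↦ by
    have : deriv (extChartAt I q ∘ γ) =ᶠ[𝓝 t] fun τ ↦ (α τ).2 := by
      filter_upwards [hU.mem_nhds ht] with τ hτ using hd τ hτ
    exact this.deriv_eq.trans (h2 t ht).deriv
  refine ⟨hg.isGeodesicOn_iff.2 fun t ht ↦ ?_, fun t ht ↦ ?_⟩
  · have : GeodesicAt g q γ t := by
      refine ⟨?_, ?_⟩
      · have e1 := (contMDiffAt_extChartAt_symm (hαt t ht)).of_le
          (show (2 : ℕ∞ω) ≤ (∞ : ℕ∞ω) from WithTop.coe_le_coe.2 le_top)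
        exact ContMDiffAt.comp t e1 (hc1.contDiffAt (hU.mem_nhds ht)).contMDiffAt
      · rw [hφγ t ht, hd t ht, hdd t ht]
        exact (geoRes_eq_zero_iff (chartForm_nondegenerate hg (hαt t ht)) _ _).2 rfl
    exact this.chart_change hg (hγs t ht) (mem_extChartAt_source (γ t))
  · exact Prod.ext (hφγ t ht) (hd t ht)

lemma IsGeodesicOn.geodesicAt (hg : IsPseudoRiemannian g) {γ : ℝ → M} {U : Set ℝ} {t : ℝ} {q : M}
    (hγ : IsGeodesicOn g γ U) (ht : t ∈ U) (hq : γ t ∈ (extChartAt I q).source) :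
    GeodesicAt g q γ t :=
  (hg.isGeodesicOn_iff.1 hγ t ht).chart_change hg (mem_extChartAt_source (γ t)) hq

lemma IsGeodesicOn.mono {γ : ℝ → M} {U V : Set ℝ} (hγ : IsGeodesicOn g γ U) (h : V ⊆ U) :
    IsGeodesicOn g γ V := fun t ht ↦ hγ t (h ht)

/-- Local existence of geodesics, with uniform time of existence. -/
lemma exists_geodesic (hg : IsPseudoRiemannian g) {q : M} {z₀ : E × E}
    (hz₀ : z₀.1 ∈ (extChartAt I q).target) {R : ℝ} (hR : 0 < R) :
    ∃ r > 0, ∃ δ > 0, ∀ z ∈ Metric.ball z₀ r, ∀ t₀ : ℝ, ∃ γ : ℝ → M,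
      IsGeodesicOn g γ (Ioo (t₀ - δ) (t₀ + δ)) ∧ chartState I q γ t₀ = z ∧
      ∀ t ∈ Ioo (t₀ - δ) (t₀ + δ), γ t ∈ (extChartAt I q).source ∧
        chartState I q γ t ∈ Metric.ball z₀ R := by
  obtain ⟨R₁, hR₁, hsub⟩ := Metric.isOpen_iff.1
    ((isOpen_extChartAt_target (I := I) q).preimage (continuous_fst (Y := E))) z₀ hz₀
  obtain ⟨r, hr, δ, hδ, h⟩ := exists_local_flow
    ((contDiffAt_geodesicField_chartForm hg hz₀).of_le (by simp)) (lt_min hR hR₁)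
  refine ⟨r, hr, δ, hδ, fun z hz t₀ ↦ ?_⟩
  obtain ⟨α, hα0, hα⟩ := h z hz t₀
  have hαt : ∀ t ∈ Ioo (t₀ - δ) (t₀ + δ), (α t).1 ∈ (extChartAt I q).target := fun t ht ↦
    hsub (Metric.ball_subset_ball (min_le_right _ _) (hα t ht).2)
  obtain ⟨h1, h2⟩ := isGeodesicOn_of_hasDerivAt hg isOpen_Ioo (fun t ht ↦ (hα t ht).1) hαt
  refine ⟨_, h1, ?_, fun t ht ↦ ⟨(extChartAt I q).map_target (hαt t ht), ?_⟩⟩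
  · rw [h2 t₀ ⟨by linarith, by linarith⟩, hα0]
  · rw [h2 t ht]
    exact Metric.ball_subset_ball (min_le_left _ _) (hα t ht).2

/-- Geodesics are determined near a point by position and velocity. -/
lemma IsGeodesicOn.eventuallyEq (hg : IsPseudoRiemannian g) {γ₁ γ₂ : ℝ → M} {U : Set ℝ}
    (hU : IsOpen U) (h₁ : IsGeodesicOn g γ₁ U) (h₂ : IsGeodesicOn g γ₂ U) {t : ℝ} (ht : t ∈ U)
    {q : M} (hq₁ : γ₁ t ∈ (extChartAt I q).source) (hq₂ : γ₂ t ∈ (extChartAt I q).source)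
    (h : chartState I q γ₁ t = chartState I q γ₂ t) : γ₁ =ᶠ[𝓝 t] γ₂ := by
  have hz : (chartState I q γ₁ t).1 ∈ (extChartAt I q).target := (extChartAt I q).map_source hq₁
  obtain ⟨L, s, hs, hL⟩ := ((contDiffAt_geodesicField_chartForm hg hz).of_le
    (show (1 : ℕ∞ω) ≤ (∞ : ℕ∞ω) by simp)).exists_lipschitzOnWith
  have key : ∀ γ : ℝ → M, IsGeodesicOn g γ U → γ t ∈ (extChartAt I q).source →
      chartState I q γ t = chartState I q γ₁ t → ∀ᶠ τ in 𝓝 t,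
      γ τ ∈ (extChartAt I q).source ∧
      HasDerivAt (chartState I q γ) (geodesicField (chartForm g q) (chartState I q γ τ)) τ ∧
      chartState I q γ τ ∈ s := by
    intro γ hγ hγq he
    have hcont := ((hγ.geodesicAt hg ht hγq).hasDerivAt hg hγq).continuousAt
    filter_upwards [hU.mem_nhds ht,
      (hγ t ht).1.continuousAt (extChartAt_source_mem_nhds_of_mem hγq),
      hcont (by rwa [he])] with τ h1 h2 h3
    exact ⟨h2, (hγ.geodesicAt hg h1 h2).hasDerivAt hg h2, h3⟩
  have e1 := key γ₁ h₁ hq₁ rfl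
  have e2 := key γ₂ h₂ hq₂ h.symm
  have := ODE_solution_unique_of_eventually (v := fun _ ↦ geodesicField (chartForm g q))
    (s := fun _ ↦ s) (K := L) (Eventually.of_forall fun _ ↦ hL) (e1.mono fun _ h ↦ h.2)
    (e2.mono fun _ h ↦ h.2) h
  filter_upwards [this, e1, e2] with τ h1 h2 h3
  exact (extChartAt I q).injOn h2.1 h3.1 (congrArg Prod.fst h1)

/-- Uniqueness of geodesics. -/
lemma IsGeodesicOn.eqOn [T2Space M] (hg : IsPseudoRiemannian g) {γ₁ γ₂ : ℝ → M} {U : Set ℝ}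
    (hU : IsOpen U) (hUc : U.OrdConnected) (h₁ : IsGeodesicOn g γ₁ U) (h₂ : IsGeodesicOn g γ₂ U)
    {t : ℝ} (ht : t ∈ U) (h : γ₁ =ᶠ[𝓝 t] γ₂) : EqOn γ₁ γ₂ U := by
  have hsub : U ⊆ {τ | γ₁ =ᶠ[𝓝 τ] γ₂} := by
    refine hUc.isPreconnected.subset_of_closure_inter_subset
      isOpen_setOfPred_eventually_nhds ⟨t, ht, h⟩ ?_
    rintro τ ⟨hτ, hτU⟩
    have hfr : ∃ᶠ σ in 𝓝 τ, γ₁ =ᶠ[𝓝 σ] γ₂ := mem_closure_iff_frequently.1 hτ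
    have hc1 := (h₁ τ hτU).1.continuousAt
    have hc2 := (h₂ τ hτU).1.continuousAt
    have heq : γ₁ τ = γ₂ τ := by
      by_contra hne
      have := hfr.and_eventually ((hc1.prodMk hc2).eventually
        (isClosed_diagonal.isOpen_compl.mem_nhds (x := (γ₁ τ, γ₂ τ)) hne))
      obtain ⟨σ, h1, h2⟩ := this.exists
      exact h2 h1.eq_of_nhds
    have hq1 := mem_extChartAt_source (I := I) (γ₁ τ)
    have hq2 : γ₂ τ ∈ (extChartAt I (γ₁ τ)).source := by rw [← heq]; exact hq1
    refine h₁.eventuallyEq hg hU h₂ hτU hq1 hq2 ?_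
    have hs1 := ((h₁.geodesicAt hg hτU hq1).hasDerivAt hg hq1).continuousAt
    have hs2 := ((h₂.geodesicAt hg hτU hq2).hasDerivAt hg hq2).continuousAt
    by_contra hne
    have := hfr.and_eventually ((hs1.prodMk hs2).eventually
        (isClosed_diagonal.isOpen_compl.mem_nhds
          (x := (chartState I (γ₁ τ) γ₁ τ, chartState I (γ₁ τ) γ₂ τ)) hne))
    obtain ⟨σ, h1, h2⟩ := this.exists
    exact h2 (chartState_congr h1)
  exact fun τ hτ ↦ (hsub hτ).eq_of_nhds

end GeodesicFlow

section Fields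

variable {E : Type*} [NormedAddCommGroup E] [NormedSpace ℝ E]
  {H : Type*} [TopologicalSpace H] {I : ModelWithCorners ℝ E H}
  {M : Type*} [TopologicalSpace M] [ChartedSpace H M]
  [FiniteDimensional ℝ E] [IsManifold I ∞ M] [I.Boundaryless] {g : MetricTensor I M}

/-- The expression of a vector field in the chart at `q`. -/
def chartField (K : ∀ x : M, TangentSpace I x) (q : M) (y : E) : E :=
  mfderiv I 𝓘(ℝ, E) (extChartAt I q) ((extChartAt I q).symm y) (K ((extChartAt I q).symm y))

lemma mfderiv_extChartAt_field (K : ∀ x : M, TangentSpace I x) {q x : M}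
    (hx : x ∈ (extChartAt I q).source) :
    mfderiv I 𝓘(ℝ, E) (extChartAt I q) x (K x) = chartField K q (extChartAt I q x) := by
  have h : (extChartAt I q).symm (extChartAt I q x) = x := (extChartAt I q).left_inv hx
  simp only [chartField]
  rw [h]

/-- The vector field on the manifold with expression `X` in the chart at `q`. -/
def ofChart (I : ModelWithCorners ℝ E H) (q : M) (X : E → E) : ∀ x : M, TangentSpace I x :=
  VectorField.mpullback I 𝓘(ℝ, E) (extChartAt I q) X

lemma mfderiv_ofChart {q x : M} (hx : x ∈ (extChartAt I q).source) (X : E → E) :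
    mfderiv I 𝓘(ℝ, E) (extChartAt I q) x (ofChart I q X x) = X (extChartAt I q x) := by
  have := isInvertible_mfderiv_extChartAt (I := I) hx
  exact this.self_apply_inverse _

lemma eq_of_mfderiv_eq {q x : M} (hx : x ∈ (extChartAt I q).source) {u v : TangentSpace I x}
    (h : mfderiv I 𝓘(ℝ, E) (extChartAt I q) x u = mfderiv I 𝓘(ℝ, E) (extChartAt I q) x v) :
    u = v :=
  (isInvertible_mfderiv_extChartAt (I := I) hx).injective h

lemma ofChart_chartField (K : ∀ x : M, TangentSpace I x) {q x : M}
    (hx : x ∈ (extChartAt I q).source) : ofChart I q (chartField K q) x = K x :=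
  eq_of_mfderiv_eq hx <| by rw [mfderiv_ofChart hx, mfderiv_extChartAt_field K hx]

lemma contMDiffAt_ofChart {q x : M} (hx : x ∈ (extChartAt I q).source) {X : E → E}
    (hX : ContDiffAt ℝ ∞ X (extChartAt I q x)) :
    ContMDiffAt I I.tangent ∞ (fun y ↦ (⟨y, ofChart I q X y⟩ : TangentBundle I M)) x :=
  ContMDiffAt.mpullback_vectorField_preimage (n := ∞)
    (contMDiffAt_vectorSpace_iff_contDiffAt.2 hX)
    (contMDiffAt_extChartAt' (n := ∞) (by simpa using hx)) (isInvertible_mfderiv_extChartAt hx)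
    (by simp)

lemma contDiffAt_chartField {K : ∀ x : M, TangentSpace I x}
    (hK : ContMDiff I I.tangent ∞ (fun x ↦ (⟨x, K x⟩ : TangentBundle I M))) {q : M} {y : E}
    (hy : y ∈ (extChartAt I q).target) : ContDiffAt ℝ ∞ (chartField K q) y := by
  have hinv : ∀ z ∈ (extChartAt I q).target,
      (mfderiv 𝓘(ℝ, E) I (extChartAt I q).symm z).IsInvertible := by
    intro z hz
    refine ContinuousLinearMap.IsInvertible.of_inverse
      (g := mfderiv I 𝓘(ℝ, E) (extChartAt I q) ((extChartAt I q).symm z)) ?_ ?_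
    · ext v
      have := mfderiv_symm_mfderiv ((extChartAt I q).map_target hz) v
      rw [(extChartAt I q).right_inv hz] at this
      exact this
    · ext w
      exact mfderiv_mfderiv_symm hz w
  have h1 := ContMDiffAt.mpullback_vectorField_preimage (n := ∞) (m := ∞) (I := 𝓘(ℝ, E)) (I' := I)
    (f := (extChartAt I q).symm) (V := K) (x₀ := y) (hK _) (contMDiffAt_extChartAt_symm hy)
    (hinv y hy) (by simp)
  have h2 := contMDiffAt_vectorSpace_iff_contDiffAt.1 h1
  refine h2.congr_of_eventuallyEq ?_
  filter_upwards [extChartAt_target_mem_nhds_of_mem hy] with z hz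
  have h3 := (hinv z hz).self_apply_inverse (K ((extChartAt I q).symm z))
  have h4 := mfderiv_mfderiv_symm hz (VectorField.mpullback 𝓘(ℝ, E) I (extChartAt I q).symm K z)
  rw [← h4]
  simp only [chartField]
  congr 1
  exact h3.symm

lemma chartForm_chartField (K L : ∀ x : M, TangentSpace I x) {q x : M}
    (hx : x ∈ (extChartAt I q).source) :
    chartForm g q (extChartAt I q x) (chartField K q (extChartAt I q x))
      (chartField L q (extChartAt I q x)) = g x (K x) (L x) := by
  rw [metric_eq_chartForm g hx, mfderiv_extChartAt_field K hx, mfderiv_extChartAt_field L hx]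

lemma metric_ofChart {q x : M} (hx : x ∈ (extChartAt I q).source) (X Y : E → E) :
    g x (ofChart I q X x) (ofChart I q Y x) =
      chartForm g q (extChartAt I q x) (X (extChartAt I q x)) (Y (extChartAt I q x)) := by
  rw [metric_eq_chartForm g hx, mfderiv_ofChart hx, mfderiv_ofChart hx]

lemma contDiffAt_chartForm (hg : g.IsSmooth) {q : M} {y : E} (hy : y ∈ (extChartAt I q).target) :
    ContDiffAt ℝ ∞ (chartForm g q) y := by
  refine contDiffAt_clm_of_apply fun v ↦ contDiffAt_clm_of_apply fun w ↦ ?_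
  have hx := (extChartAt I q).map_target hy
  set x := (extChartAt I q).symm y with hxdef
  have h1 : ContMDiffAt I 𝓘(ℝ, ℝ) ∞
      (fun z ↦ g z (ofChart I q (fun _ ↦ v) z) (ofChart I q (fun _ ↦ w) z)) x := by
    have : ContMDiffAt I (I.prod 𝓘(ℝ)) ∞
      (fun m ↦ TotalSpace.mk' ℝ (E := Bundle.Trivial M ℝ) m
        (g m (ofChart I q (fun _ ↦ v) m) (ofChart I q (fun _ ↦ w) m))) x := by
      apply ContMDiffAt.clm_bundle_apply₂ (F₁ := E) (F₂ := E)
      · exact hg x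
      · exact contMDiffAt_ofChart hx contDiffAt_const
      · exact contMDiffAt_ofChart hx contDiffAt_const
    simp only [contMDiffAt_totalSpace] at this
    exact this.2
  have h2 := (ContMDiffAt.comp y h1 (contMDiffAt_extChartAt_symm hy)).contDiffAt
  refine h2.congr_of_eventuallyEq ?_
  filter_upwards [extChartAt_target_mem_nhds_of_mem hy] with z hz
  have := metric_ofChart (g := g) ((extChartAt I q).map_target hz) (fun _ ↦ v) (fun _ ↦ w)
  rw [(extChartAt I q).right_inv hz] at this
  exact this.symm

lemma chartForm_symm (hs : ∀ x (u v : TangentSpace I x), g x u v = g x v u) (q : M) (y v w : E) :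
    chartForm g q y v w = chartForm g q y w v := hs _ _ _

lemma mlieBracket_ofChart {q x : M} (hx : x ∈ (extChartAt I q).source) {X Y : E → E}
    (hX : ContDiffAt ℝ ∞ X (extChartAt I q x)) (hY : ContDiffAt ℝ ∞ Y (extChartAt I q x)) :
    mfderiv I 𝓘(ℝ, E) (extChartAt I q) x
      (VectorField.mlieBracket I (ofChart I q X) (ofChart I q Y) x) =
      VectorField.lieBracket ℝ X Y (extChartAt I q x) := by
  have h1 : ∀ {Z : E → E}, ContDiffAt ℝ ∞ Z (extChartAt I q x) →
      MDifferentiableAt 𝓘(ℝ, E) 𝓘(ℝ, E).tangent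
        (fun y ↦ (⟨y, Z y⟩ : TangentBundle 𝓘(ℝ, E) E)) (extChartAt I q x) := fun hZ ↦
    (contMDiffAt_vectorSpace_iff_contDiffAt.2 hZ).mdifferentiableAt (by simp)
  have hle : minSmoothness ℝ 2 ≤ (∞ : ℕ∞ω) := by
    rw [minSmoothness_of_isRCLikeNormedField]; exact WithTop.coe_le_coe.2 le_top
  have : IsManifold I (minSmoothness ℝ 2) M := IsManifold.of_le (n := ∞) hle
  have h2 := VectorField.mpullback_mlieBracket (I := I) (n := ∞) (h1 hX) (h1 hY)
    (contMDiffAt_extChartAt' (n := ∞) (by simpa using hx)) hle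
  change _ = VectorField.mlieBracket I (ofChart I q X) (ofChart I q Y) x at h2
  rw [← h2]
  have h3 := mfderiv_ofChart hx (VectorField.mlieBracket 𝓘(ℝ, E) X Y)
  have h4 := congrFun (VectorField.mlieBracketWithin_eq_lieBracketWithin (𝕜 := ℝ) (V := X) (W := Y)
    (s := univ)) (extChartAt I q x)
  rw [VectorField.lieBracketWithin_univ] at h4
  exact h3.trans ((congrFun VectorField.mlieBracketWithin_univ _).symm.trans h4)

lemma killingAt_chartField (hg : g.IsSmooth) {K : ∀ x : M, TangentSpace I x}
    (hKs : ContMDiff I I.tangent ∞ (fun x ↦ (⟨x, K x⟩ : TangentBundle I M)))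
    (hK : IsKilling g K) {q : M} {y : E} (hy : y ∈ (extChartAt I q).target) :
    KillingAt (chartForm g q) (chartField K q) y := by
  intro u w
  have hx := (extChartAt I q).map_target hy
  set x := (extChartAt I q).symm y with hxdef
  have hxy : extChartAt I q x = y := (extChartAt I q).right_inv hy
  have hKd := contDiffAt_chartField hKs hy
  have hB : DifferentiableAt ℝ (chartForm g q) y :=
    (contDiffAt_chartForm hg hy).differentiableAt (by simp)
  have hbr : ∀ v : E, mfderiv I 𝓘(ℝ, E) (extChartAt I q) x
      (VectorField.mlieBracket I K (ofChart I q fun _ ↦ v) x) =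
        -(fderiv ℝ (chartField K q) y v) := by
    intro v
    have h1 : K =ᶠ[𝓝 x] ofChart I q (chartField K q) := by
      filter_upwards [extChartAt_source_mem_nhds_of_mem hx] with z hz
      exact (ofChart_chartField K hz).symm
    have h2 := h1.mlieBracket_vectorField_eq (EventuallyEq.refl (𝓝 x) (ofChart I q fun _ ↦ v))
    have h3 := mlieBracket_ofChart hx (X := chartField K q) (Y := fun _ ↦ v) (by rwa [hxy])
      contDiffAt_const
    refine (congrArg _ h2).trans (h3.trans ?_)
    rw [hxy, VectorField.lieBracket]
    simp
    rfl
  have h1 := hK x (ofChart I q fun _ ↦ u) (ofChart I q fun _ ↦ w)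
    (contMDiffAt_ofChart hx contDiffAt_const) (contMDiffAt_ofChart hx contDiffAt_const)
  have e1 : g x (VectorField.mlieBracket I K (ofChart I q fun _ ↦ u) x)
      (ofChart I q (fun _ ↦ w) x) = chartForm g q y (-(fderiv ℝ (chartField K q) y u)) w := by
    rw [metric_eq_chartForm g hx, hbr, mfderiv_ofChart hx, hxy]
  have e2 : g x (ofChart I q (fun _ ↦ u) x)
      (VectorField.mlieBracket I K (ofChart I q fun _ ↦ w) x) =
      chartForm g q y u (-(fderiv ℝ (chartField K q) y w)) := by
    rw [metric_eq_chartForm g hx, hbr, mfderiv_ofChart hx, hxy]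
  rw [e1, e2] at h1
  have h2 : (fun z ↦ g z (ofChart I q (fun _ ↦ u) z) (ofChart I q (fun _ ↦ w) z)) =ᶠ[𝓝 x]
      (fun z ↦ chartForm g q z u w) ∘ extChartAt I q := by
    filter_upwards [extChartAt_source_mem_nhds_of_mem hx] with z hz
    exact metric_ofChart hz _ _
  have hd := hasFDerivAt_bilin_apply hB u w
  have h3 : mfderiv I 𝓘(ℝ, ℝ) ((fun z ↦ chartForm g q z u w) ∘ extChartAt I q) x (K x) =
      fderiv ℝ (chartForm g q) y (chartField K q y) u w := by
    rw [mfderiv_comp x (I' := 𝓘(ℝ, E))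
      (by rw [hxy]; exact hd.differentiableAt.mdifferentiableAt)
      (mdifferentiableAt_extChartAt' hx), mfderiv_eq_fderiv, hxy, hd.fderiv]
    have := mfderiv_extChartAt_field K hx
    rw [hxy] at this
    exact congrArg (((fderiv ℝ (chartForm g q) y).flip u).flip w) this
  have h4 : mfderiv I 𝓘(ℝ, ℝ) (fun z ↦ g z (ofChart I q (fun _ ↦ u) z)
      (ofChart I q (fun _ ↦ w) z)) x (K x) =
      fderiv ℝ (chartForm g q) y (chartField K q y) u w :=
    (DFunLike.congr_fun h2.mfderiv_eq (K x)).trans h3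
  have h5 := h4.symm.trans h1
  rw [h5]
  simp

lemma irrotational_chartField (hg : g.IsSmooth)
    (hs : ∀ x (u v : TangentSpace I x), g x u v = g x v u) {K : ∀ x : M, TangentSpace I x}
    (hKs : ContMDiff I I.tangent ∞ (fun x ↦ (⟨x, K x⟩ : TangentBundle I M)))
    (hne : ∀ x, g x (K x) (K x) ≠ 0)
    (hK : IsIrrotational g K) {q : M} {y : E} (hy : y ∈ (extChartAt I q).target) (u w : E) :
    chartForm g q y (chartField K q y) (VectorField.lieBracket ℝ
      (horizontalField (chartForm g q) (chartField K q) u)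
      (horizontalField (chartForm g q) (chartField K q) w) y) = 0 := by
  have hx := (extChartAt I q).map_target hy
  set x := (extChartAt I q).symm y with hxdef
  have hxy : extChartAt I q x = y := (extChartAt I q).right_inv hy
  set B := chartForm g q
  set L := chartField K q
  have hBne : ∀ z ∈ (extChartAt I q).target, B z (L z) (L z) ≠ 0 := by
    intro z hz
    have := chartForm_chartField (g := g) K K ((extChartAt I q).map_target hz)
    rw [(extChartAt I q).right_inv hz] at this
    rw [this]; exact hne _
  have hh : ∀ v : E, ContDiffAt ℝ ∞ (horizontalField B L v) (extChartAt I q x) := fun v ↦ by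
    rw [hxy]
    exact contDiffAt_horizontalField (contDiffAt_chartForm hg hy) (contDiffAt_chartField hKs hy)
      (hBne y hy) v
  have horth : ∀ v : E, ∀ᶠ z in 𝓝 x, g z (ofChart I q (horizontalField B L v) z) (K z) = 0 := by
    intro v
    filter_upwards [extChartAt_source_mem_nhds_of_mem hx] with z hz
    rw [metric_eq_chartForm g hz, mfderiv_ofChart hz, mfderiv_extChartAt_field K hz,
      chartForm_symm hs]
    have h1 := hBne _ ((extChartAt I q).map_source hz)
    exact timeForm_horizontalField h1 v
  have := hK x _ _ (contMDiffAt_ofChart hx (hh u)) (contMDiffAt_ofChart hx (hh w)) (horth u)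
    (horth w)
  rw [metric_eq_chartForm g hx, mlieBracket_ofChart hx (hh u) (hh w),
    mfderiv_extChartAt_field K hx, hxy, chartForm_symm hs] at this
  exact this

end Fields

section Completeness

variable {E : Type*} [NormedAddCommGroup E] [NormedSpace ℝ E]
  {H : Type*} [TopologicalSpace H] {I : ModelWithCorners ℝ E H}
  {M : Type*} [TopologicalSpace M] [ChartedSpace H M]

lemma geoRes_neg (B : E → E →L[ℝ] E →L[ℝ] ℝ) (y v a w : E) :
    geoRes B y (-v) a w = geoRes B y v a w := by
  simp [geoRes, christ]

/-- Geodesics may be run backwards. -/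
lemma IsGeodesicOn.comp_neg {g : MetricTensor I M} (hg : IsPseudoRiemannian g) {γ : ℝ → M}
    {U : Set ℝ} (hγ : IsGeodesicOn g γ U) : IsGeodesicOn g (fun t ↦ γ (-t)) (-U) := by
  rw [hg.isGeodesicOn_iff] at hγ ⊢
  intro t ht
  obtain ⟨h1, h2⟩ := hγ (-t) ht
  refine ⟨?_, fun w ↦ ?_⟩
  · exact ContMDiffAt.comp t h1 (contDiff_neg (𝕜 := ℝ) (F := ℝ)).contDiffAt.contMDiffAt
  · have e1 : ∀ c : ℝ → E, deriv (fun τ ↦ c (-τ)) = fun τ ↦ -deriv c (-τ) := fun c ↦ by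
      ext τ; exact deriv_comp_neg c τ
    have e2 : deriv (extChartAt I (γ (-t)) ∘ fun t ↦ γ (-t)) =
        fun τ ↦ -deriv (extChartAt I (γ (-t)) ∘ γ) (-τ) := e1 (extChartAt I (γ (-t)) ∘ γ)
    have e3 : deriv (deriv (extChartAt I (γ (-t)) ∘ fun t ↦ γ (-t))) t =
        deriv (deriv (extChartAt I (γ (-t)) ∘ γ)) (-t) := by
      rw [e2, deriv.fun_neg, e1]
      simp
    rw [e3, e2]
    simp only [geoRes_neg]
    exact h2 w

lemma isGeodesicOn_const {g : MetricTensor I M} (hg : IsPseudoRiemannian g) (p : M) (U : Set ℝ) :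
    IsGeodesicOn g (fun _ ↦ p) U := by
  rw [hg.isGeodesicOn_iff]
  intro t _
  refine ⟨contMDiffAt_const, fun w ↦ ?_⟩
  have : (extChartAt I p ∘ fun _ : ℝ ↦ p) = fun _ ↦ extChartAt I p p := rfl
  rw [this]
  simp [geoRes, christ]

/-- The velocity of a curve. -/
def velocity (I : ModelWithCorners ℝ E H) (γ : ℝ → M) (t : ℝ) : TangentSpace I (γ t) :=
  mfderiv 𝓘(ℝ, ℝ) I γ t (1 : ℝ)

variable [IsManifold I ∞ M]

lemma mfderiv_velocity {q : M} {γ : ℝ → M} {t : ℝ} (hγ : MDifferentiableAt 𝓘(ℝ, ℝ) I γ t)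
    (hq : γ t ∈ (extChartAt I q).source) :
    mfderiv I 𝓘(ℝ, E) (extChartAt I q) (γ t) (velocity I γ t) =
      deriv (extChartAt I q ∘ γ) t := by
  have h1 := mfderiv_comp t (mdifferentiableAt_extChartAt' hq) hγ
  rw [mfderiv_eq_fderiv] at h1
  have h2 := DFunLike.congr_fun h1 (1 : ℝ)
  exact h2.symm.trans (fderiv_apply_one_eq_deriv (f := extChartAt I q ∘ γ) (x := t))

variable [I.Boundaryless] [FiniteDimensional ℝ E] {g : MetricTensor I M}

lemma metric_velocity (g : MetricTensor I M) {q : M} {γ : ℝ → M} {t : ℝ}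
    (hγ : MDifferentiableAt 𝓘(ℝ, ℝ) I γ t) (hq : γ t ∈ (extChartAt I q).source) :
    g (γ t) (velocity I γ t) (velocity I γ t) = chartForm g q (extChartAt I q (γ t))
      (deriv (extChartAt I q ∘ γ) t) (deriv (extChartAt I q ∘ γ) t) := by
  rw [metric_eq_chartForm g hq, mfderiv_velocity hγ hq]

lemma metric_velocity_field (g : MetricTensor I M) (K : ∀ x : M, TangentSpace I x) {q : M}
    {γ : ℝ → M} {t : ℝ} (hγ : MDifferentiableAt 𝓘(ℝ, ℝ) I γ t)
    (hq : γ t ∈ (extChartAt I q).source) :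
    g (γ t) (velocity I γ t) (K (γ t)) = chartForm g q (extChartAt I q (γ t))
      (deriv (extChartAt I q ∘ γ) t) (chartField K q (extChartAt I q (γ t))) := by
  rw [metric_eq_chartForm g hq, mfderiv_velocity hγ hq, mfderiv_extChartAt_field K hq]

lemma eventually_mdifferentiableAt {γ : ℝ → M} {t : ℝ} (h : ContMDiffAt 𝓘(ℝ, ℝ) I 2 γ t) :
    ∀ᶠ τ in 𝓝 t, MDifferentiableAt 𝓘(ℝ, ℝ) I γ τ := by
  have : IsManifold I 2 M := IsManifold.of_le (n := ∞) (WithTop.coe_le_coe.2 le_top)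
  filter_upwards [(contMDiffAt_iff_contMDiffAt_nhds (by simp)).1 h] with τ hτ
  exact hτ.mdifferentiableAt (by simp)

lemma IsGeodesicOn.hasDerivAt_energy (hg : IsPseudoRiemannian g) {γ : ℝ → M} {U : Set ℝ}
    (hγ : IsGeodesicOn g γ U) {t : ℝ} (ht : t ∈ U) :
    HasDerivAt (fun τ ↦ g (γ τ) (velocity I γ τ) (velocity I γ τ)) 0 t := by
  obtain ⟨h1, h2⟩ := hg.isGeodesicOn_iff.1 hγ t ht
  have hs := mem_extChartAt_source (I := I) (γ t)
  have h3 := StaticSpacetime.hasDerivAt_energy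
    (hg.differentiableAt (q := γ t) ((extChartAt I (γ t)).map_source hs))
    (fun v w ↦ chartForm_symm hg.symm _ _ _ _) (contDiffAt_chart_curve h1 hs)
  rw [Function.comp_apply, h2, mul_zero] at h3
  refine h3.congr_of_eventuallyEq ?_
  filter_upwards [eventually_mdifferentiableAt h1,
    h1.continuousAt (extChartAt_source_mem_nhds_of_mem hs)] with τ h4 h5
  exact metric_velocity g h4 h5

lemma IsGeodesicOn.hasDerivAt_momentum (hg : IsPseudoRiemannian g)
    (hgs : g.IsSmooth) {K : ∀ x : M, TangentSpace I x}
    (hKs : ContMDiff I I.tangent ∞ (fun x ↦ (⟨x, K x⟩ : TangentBundle I M)))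
    (hK : IsKilling g K) {γ : ℝ → M} {U : Set ℝ}
    (hγ : IsGeodesicOn g γ U) {t : ℝ} (ht : t ∈ U) :
    HasDerivAt (fun τ ↦ g (γ τ) (velocity I γ τ) (K (γ τ))) 0 t := by
  obtain ⟨h1, h2⟩ := hg.isGeodesicOn_iff.1 hγ t ht
  have hs := mem_extChartAt_source (I := I) (γ t)
  have hm := (extChartAt I (γ t)).map_source hs
  have h3 := StaticSpacetime.hasDerivAt_momentum (hg.differentiableAt (q := γ t) hm)
    (fun v w ↦ chartForm_symm hg.symm _ _ _ _)
    ((contDiffAt_chartField hKs hm).differentiableAt (by simp))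
    (killingAt_chartField hgs hKs hK hm) (contDiffAt_chart_curve h1 hs)
  rw [Function.comp_apply, h2] at h3
  refine h3.congr_of_eventuallyEq ?_
  filter_upwards [eventually_mdifferentiableAt h1,
    h1.continuousAt (extChartAt_source_mem_nhds_of_mem hs)] with τ h4 h5
  exact metric_velocity_field g K h4 h5

lemma exists_const_of_hasDerivAt_zero {f : ℝ → ℝ} {U : Set ℝ} (hU : IsOpen U)
    (hUc : U.OrdConnected) (hf : ∀ t ∈ U, HasDerivAt f 0 t) : ∃ C, ∀ t ∈ U, f t = C :=
  hU.exists_is_const_of_deriv_eq_zero hUc.isPreconnected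
    (fun t ht ↦ (hf t ht).differentiableAt.differentiableWithinAt)
    fun t ht ↦ (hf t ht).deriv

variable [T2Space M]

/-- A geodesic whose position and velocity accumulate at the right end of its interval of
definition can be extended. -/
lemma IsGeodesicOn.exists_extension_right (hg : IsPseudoRiemannian g) {γ : ℝ → M} {a b : ℝ}
    (hab : a < b) (hγ : IsGeodesicOn g γ (Ioo a b)) {q : M} {z₀ : E × E}
    (hz₀ : z₀.1 ∈ (extChartAt I q).target)
    (hcl : ∀ r > 0, ∃ᶠ t in 𝓝[<] b, γ t ∈ (extChartAt I q).source ∧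
      chartState I q γ t ∈ Metric.ball z₀ r) :
    ∃ γ' : ℝ → M, γ' =ᶠ[𝓝[<] b] γ ∧ ∀ᶠ t in 𝓝 b, GeodesicAt g (γ' t) γ' t := by
  obtain ⟨r, hr, δ, hδ, h⟩ := exists_geodesic hg hz₀ one_pos
  have hnear : ∀ᶠ t in 𝓝[<] b, t ∈ Ioo (max a (b - δ)) b :=
    Ioo_mem_nhdsLT (max_lt hab (by linarith))
  obtain ⟨t₁, ⟨hs, hst⟩, ht₁⟩ := ((hcl r hr).and_eventually hnear).exists
  have hat : a < t₁ := (le_max_left _ _).trans_lt ht₁.1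
  have hbt : b - δ < t₁ := (le_max_right _ _).trans_lt ht₁.1
  have htb : t₁ < b := ht₁.2
  obtain ⟨γ', hγ', hst', hγs⟩ := h _ hst t₁
  have ht₁' : t₁ ∈ Ioo (t₁ - δ) (t₁ + δ) := ⟨by linarith, by linarith⟩
  have hU : IsOpen (Ioo (max a (t₁ - δ)) b) := isOpen_Ioo
  have hsub : Ioo (max a (t₁ - δ)) b ⊆ Ioo (t₁ - δ) (t₁ + δ) := fun t ht ↦
    ⟨(le_max_right _ _).trans_lt ht.1, by linarith [ht.2]⟩
  have hsub' : Ioo (max a (t₁ - δ)) b ⊆ Ioo a b := fun t ht ↦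
    ⟨(le_max_left _ _).trans_lt ht.1, ht.2⟩
  have ht₁U : t₁ ∈ Ioo (max a (t₁ - δ)) b := ⟨max_lt hat (by linarith), htb⟩
  have heq := (hγ'.mono hsub).eqOn hg hU ordConnected_Ioo (hγ.mono hsub') ht₁U
    ((hγ'.mono hsub).eventuallyEq hg hU (hγ.mono hsub') ht₁U (hγs t₁ ht₁').1 hs hst')
  refine ⟨γ', ?_, ?_⟩
  · filter_upwards [Ioo_mem_nhdsLT ht₁U.2] with t ht
    exact heq ⟨ht₁U.1.trans ht.1, ht.2⟩
  · filter_upwards [Ioo_mem_nhds (show t₁ - δ < b by linarith) (show b < t₁ + δ by linarith)]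
      with t ht
    exact hg.isGeodesicOn_iff.1 hγ' t ht

/-- Geodesic completeness follows if each geodesic accumulates, with its velocity, at the right end
of any bounded interval of definition. -/
theorem geodesicallyComplete_of_accumulates (hg : IsPseudoRiemannian g)
    (h : ∀ (γ : ℝ → M) (a b : ℝ), a < b → IsGeodesicOn g γ (Ioo a b) →
      ∃ (q : M) (z₀ : E × E), z₀.1 ∈ (extChartAt I q).target ∧
        ∀ r > 0, ∃ᶠ t in 𝓝[<] b, γ t ∈ (extChartAt I q).source ∧
          chartState I q γ t ∈ Metric.ball z₀ r) : GeodesicallyComplete g := by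
  intro s γ hs hsc hγ
  rcases s.eq_empty_or_nonempty with rfl | hne
  · exact ⟨fun _ ↦ γ 0, isGeodesicOn_const hg _ _, by simp⟩
  have hr : ∀ (f : ℝ → M) (a b : ℝ), a < b →
      (∀ t ∈ Ioo a b, ∀ᶠ u in 𝓝 t, GeodesicAt g (f u) f u) →
      ∃ f', f' =ᶠ[𝓝[<] b] f ∧ ∀ᶠ u in 𝓝 b, GeodesicAt g (f' u) f' u := by
    intro f a b hab hf
    have hf' : IsGeodesicOn g f (Ioo a b) :=
      hg.isGeodesicOn_iff.2 fun t ht ↦ (hf t ht).self_of_nhds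
    obtain ⟨q, z₀, hz₀, hcl⟩ := h f a b hab hf'
    exact hf'.exists_extension_right hg hab hz₀ hcl
  obtain ⟨γ', h1, h2⟩ := exists_extension (N := M)
    (P := fun f t ↦ ∀ᶠ u in 𝓝 t, GeodesicAt g (f u) f u) (A := univ)
    (fun f f' t hff hf ↦ by
      filter_upwards [hf, hff.eventuallyEq_nhds] with u h1 h2
      rw [← h2.eq_of_nhds]
      exact h1.congr h2) ordConnected_univ isOpen_univ
    (fun f a b hab _ _ hf ↦ hr f a b hab hf)
    (fun f a b hab _ _ hf ↦ by
      have h1 : IsGeodesicOn g f (Ioo a b) :=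
        hg.isGeodesicOn_iff.2 fun t ht ↦ (hf t ht).self_of_nhds
      have h2 := h1.comp_neg hg
      rw [Set.neg_Ioo] at h2
      obtain ⟨f', h3, h4⟩ := hr (fun t ↦ f (-t)) (-b) (-a) (by linarith) fun t ht ↦
        (Ioo_mem_nhds ht.1 ht.2 |> Filter.mem_of_superset <|
          fun u hu ↦ hg.isGeodesicOn_iff.1 h2 u hu)
      obtain ⟨V, hV, hVo, haV⟩ := mem_nhds_iff.1 h4
      have h5 : IsGeodesicOn g f' V := hg.isGeodesicOn_iff.2 fun t ht ↦ hV ht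
      have h6 := hg.isGeodesicOn_iff.1 (h5.comp_neg hg)
      refine ⟨fun t ↦ f' (-t), ?_, ?_⟩
      · rw [Filter.EventuallyEq, eventually_nhdsWithin_iff] at h3 ⊢
        filter_upwards [(continuous_neg (G := ℝ)).continuousAt.eventually h3] with u hu hu'
        simpa using hu (by simpa using hu')
      · filter_upwards [hVo.neg.mem_nhds (show a ∈ -V from haV)] with u hu using h6 u hu)
    (fun f t hf ↦ by
      filter_upwards [eventually_eventually_nhds.2 hf] with u hu _ using hu)
    hs hsc (subset_univ s) hne (f := γ) (fun t ht ↦ by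
      filter_upwards [hs.mem_nhds ht] with u hu using hg.isGeodesicOn_iff.1 hγ u hu)
  exact ⟨γ', hg.isGeodesicOn_iff.2 fun t _ ↦ (h2 t trivial).self_of_nhds, h1⟩

end Completeness

section Riemannian

open MeasureTheory

variable {E : Type*} [NormedAddCommGroup E] [NormedSpace ℝ E]
  {H : Type*} [TopologicalSpace H] {I : ModelWithCorners ℝ E H}
  {M : Type*} [TopologicalSpace M] [ChartedSpace H M]

lemma enormSMulClass_of_metric (g : MetricTensor I M) (z : M) :
    @ENormSMulClass ℝ (TangentSpace I z) _ ⟨fun v ↦ ENNReal.ofReal √(g z v v)⟩ _ := by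
  let : ENorm (TangentSpace I z) := ⟨fun v ↦ ENNReal.ofReal √(g z v v)⟩
  refine ⟨fun c v ↦ ?_⟩
  change ENNReal.ofReal √(g z (c • v) (c • v)) = ‖c‖ₑ * ENNReal.ofReal √(g z v v)
  have : g z (c • v) (c • v) = (c * c) * g z v v := by
    rw [map_smul, map_smul, smul_apply, smul_eq_mul, smul_eq_mul]; ring
  rw [this, Real.sqrt_mul (mul_self_nonneg c), Real.sqrt_mul_self_eq_abs,
    ENNReal.ofReal_mul (abs_nonneg c), Real.enorm_eq_ofReal_abs]

lemma riemEDist_comm (g : MetricTensor I M) (x y : M) : riemEDist g x y = riemEDist g y x := by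
  let : ∀ z : M, ENorm (TangentSpace I z) := fun z ↦ ⟨fun v ↦ ENNReal.ofReal √(g z v v)⟩
  have : ∀ z : M, ENormSMulClass ℝ (TangentSpace I z) := enormSMulClass_of_metric g
  exact Manifold.riemannianEDist_comm

lemma riemEDist_triangle (g : MetricTensor I M) (x y z : M) :
    riemEDist g x z ≤ riemEDist g x y + riemEDist g y z := by
  let : ∀ z : M, ENorm (TangentSpace I z) := fun z ↦ ⟨fun v ↦ ENNReal.ofReal √(g z v v)⟩
  have : ∀ z : M, ENormSMulClass ℝ (TangentSpace I z) := enormSMulClass_of_metric g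
  exact Manifold.riemannianEDist_triangle

/-- The distance between two points of a curve is at most the length of the curve. -/
lemma riemEDist_le_integral (g : MetricTensor I M) {x : ℝ → M} {s t : ℝ} (hst : s ≤ t)
    (hx : ∀ τ ∈ Icc s t, ContMDiffAt 𝓘(ℝ, ℝ) I 1 x τ)
    (hv : ContinuousOn (fun τ ↦ √(g (x τ) (velocity I x τ) (velocity I x τ))) (Icc s t)) :
    riemEDist g (x s) (x t) ≤
      ENNReal.ofReal (∫ τ in s..t, √(g (x τ) (velocity I x τ) (velocity I x τ))) := by
  let : ∀ z : M, ENorm (TangentSpace I z) := fun z ↦ ⟨fun v ↦ ENNReal.ofReal √(g z v v)⟩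
  have : ∀ z : M, ENormSMulClass ℝ (TangentSpace I z) := enormSMulClass_of_metric g
  have h1 : Manifold.riemannianEDist I (x s) (x t) ≤ Manifold.pathELength I x s t :=
    Manifold.riemannianEDist_le_pathELength
      (fun τ hτ ↦ (hx τ hτ).contMDiffWithinAt) rfl rfl hst
  refine h1.trans (le_of_eq ?_)
  rw [Manifold.pathELength_eq_lintegral_mfderiv_Icc, intervalIntegral.integral_of_le hst,
    ← integral_Icc_eq_integral_Ioc, ofReal_integral_eq_lintegral_ofReal]
  · rfl
  · exact hv.integrableOn_Icc
  · exact Eventually.of_forall fun τ ↦ Real.sqrt_nonneg _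

/-- A nonnegative function bounded by a linear function of its integral is bounded on bounded
intervals. -/
lemma exists_bound_of_linear_growth {v : ℝ → ℝ} {a t₁ b c : ℝ} (hc : 0 ≤ c) (hat : a < t₁)
    (hv : ContinuousOn v (Ioo a b)) (hv0 : ∀ t, 0 ≤ v t)
    (h : ∀ t ∈ Ico t₁ b, v t ≤ c * (1 + ∫ τ in t₁..t, v τ)) :
    ∃ L, ∀ t ∈ Ico t₁ b, ∫ τ in t₁..t, v τ ≤ L := by
  refine ⟨gronwallBound 0 c c (b - t₁), fun T hT ↦ ?_⟩
  have hd : ∀ t ∈ Icc t₁ T, HasDerivAt (fun u ↦ ∫ τ in t₁..u, v τ) (v t) t := by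
    intro t ht
    have htm : t ∈ Ioo a b := ⟨hat.trans_le ht.1, ht.2.trans_lt hT.2⟩
    refine intervalIntegral.integral_hasDerivAt_right ?_ ?_
      (hv.continuousAt (Ioo_mem_nhds htm.1 htm.2))
    · refine (hv.mono fun τ hτ ↦ ?_).intervalIntegrable
      rw [uIcc_of_le ht.1] at hτ
      exact ⟨hat.trans_le hτ.1, hτ.2.trans_lt htm.2⟩
    · exact hv.stronglyMeasurableAtFilter isOpen_Ioo t htm
  have h0 : ∀ t, t₁ ≤ t → 0 ≤ ∫ τ in t₁..t, v τ := fun t ht ↦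
    intervalIntegral.integral_nonneg ht fun τ _ ↦ hv0 τ
  have := norm_le_gronwallBound_of_norm_deriv_right_le (f := fun u ↦ ∫ τ in t₁..u, v τ) (f' := v)
    (δ := 0) (K := c) (ε := c) (a := t₁) (b := T)
    (fun t ht ↦ (hd t ht).continuousAt.continuousWithinAt)
    (fun t ht ↦ (hd t ⟨ht.1, ht.2.le⟩).hasDerivWithinAt) (by simp)
    (fun t ht ↦ by
      rw [Real.norm_of_nonneg (hv0 t), Real.norm_of_nonneg (h0 t ht.1)]
      have := h t ⟨ht.1, ht.2.trans hT.2⟩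
      linarith) T ⟨hT.1, le_rfl⟩
  rw [Real.norm_of_nonneg (h0 T hT.1)] at this
  exact this.trans (gronwallBound_mono le_rfl hc hc (by linarith [hT.2]))

variable [IsManifold I ∞ M] [I.Boundaryless] [FiniteDimensional ℝ E] {g : MetricTensor I M}

lemma continuousAt_metric_velocity (hg : IsPseudoRiemannian g) {x : ℝ → M} {t : ℝ}
    (hx : ContMDiffAt 𝓘(ℝ, ℝ) I 2 x t) :
    ContinuousAt (fun τ ↦ g (x τ) (velocity I x τ) (velocity I x τ)) t := by
  have hs := mem_extChartAt_source (I := I) (x t)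
  have h3 := StaticSpacetime.hasDerivAt_energy
    (hg.differentiableAt (q := x t) ((extChartAt I (x t)).map_source hs))
    (fun v w ↦ chartForm_symm hg.symm _ _ _ _) (contDiffAt_chart_curve hx hs)
  refine h3.continuousAt.congr ?_
  filter_upwards [eventually_mdifferentiableAt hx,
    hx.continuousAt (extChartAt_source_mem_nhds_of_mem hs)] with τ h4 h5
  exact (metric_velocity g h4 h5).symm

/-- A curve whose squared speed is at most affine in an at most quadratic function has bounded speed
on bounded intervals and accumulates at the right end. -/
theorem exists_accumulation_of_atMostQuadratic (hg : IsPseudoRiemannian g)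
    (hcomp : RiemannianComplete g)
    {V : M → ℝ} (hV : Continuous V) (hVq : AtMostQuadratic g V) {x : ℝ → M} {a b : ℝ} (hab : a < b)
    (hx : ∀ t ∈ Ioo a b, ContMDiffAt 𝓘(ℝ, ℝ) I 2 x t) {A₀ B₀ : ℝ} (hA₀ : 0 ≤ A₀) (hB₀ : 0 ≤ B₀)
    (hspeed : ∀ t ∈ Ioo a b, g (x t) (velocity I x t) (velocity I x t) ≤ A₀ + B₀ * V (x t)) :
    ∃ (p : M) (C t₁ : ℝ) (τ : ℕ → ℝ), t₁ ∈ Ioo a b ∧ (∀ t ∈ Ico t₁ b, V (x t) ≤ C) ∧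
      (∀ n, τ n ∈ Ioo t₁ b) ∧ Tendsto τ atTop (𝓝 b) ∧
      Tendsto (fun n ↦ x (τ n)) atTop (𝓝 p) := by
  obtain ⟨A, hA, x₀, Cc, hCc, hVA⟩ := hVq
  obtain ⟨N, hN0, hN⟩ : ∃ N, 0 ≤ N ∧ ∀ y, V y ≤ N + A * (riemEDist g x₀ y).toReal ^ 2 := by
    obtain ⟨N, hN⟩ := hCc.bddAbove_image hV.continuousOn
    refine ⟨max N 0, le_max_right _ _, fun y ↦ ?_⟩
    by_cases hy : y ∈ Cc
    · have h1 := hN (mem_image_of_mem V hy)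
      have h2 : 0 ≤ A * (riemEDist g x₀ y).toReal ^ 2 := by positivity
      linarith [le_max_left N 0]
    · linarith [hVA y hy, le_max_right N 0]
  set v : ℝ → ℝ := fun τ ↦ √(g (x τ) (velocity I x τ) (velocity I x τ)) with hv
  have hvc : ContinuousOn v (Ioo a b) := fun t ht ↦
    (continuousAt_metric_velocity hg (hx t ht)).sqrt.continuousWithinAt
  have hv0 : ∀ t, 0 ≤ v t := fun t ↦ Real.sqrt_nonneg _
  have hdist : ∀ s t, a < s → s ≤ t → t < b →
      riemEDist g (x s) (x t) ≤ ENNReal.ofReal (∫ τ in s..t, v τ) := fun s t hs hst ht ↦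
    riemEDist_le_integral g hst (fun τ hτ ↦ (hx τ ⟨hs.trans_le hτ.1, hτ.2.trans_lt ht⟩).of_le
      (by norm_num)) (hvc.mono fun τ hτ ↦ ⟨hs.trans_le hτ.1, hτ.2.trans_lt ht⟩)
  set t₁ := (a + b) / 2 with ht₁
  have hat₁ : a < t₁ := by linarith
  have ht₁b : t₁ < b := by linarith
  set D₁ := (riemEDist g x₀ (x t₁)).toReal with hD₁
  have hD₁0 : 0 ≤ D₁ := ENNReal.toReal_nonneg
  have hl0 : ∀ t, t₁ ≤ t → 0 ≤ ∫ τ in t₁..t, v τ := fun t ht ↦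
    intervalIntegral.integral_nonneg ht fun τ _ ↦ hv0 τ
  have hD : ∀ t ∈ Ico t₁ b, (riemEDist g x₀ (x t)).toReal ≤ D₁ + ∫ τ in t₁..t, v τ := by
    intro t ht
    have h1 := hdist t₁ t hat₁ ht.1 ht.2
    by_cases htop : riemEDist g x₀ (x t) = ⊤
    · rw [htop, ENNReal.toReal_top]
      linarith [hl0 t ht.1]
    have hfin : riemEDist g x₀ (x t₁) ≠ ⊤ := by
      have h2 := riemEDist_triangle g x₀ (x t) (x t₁)
      rw [riemEDist_comm g (x t)] at h2
      exact ne_top_of_le_ne_top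
        (ENNReal.add_ne_top.2 ⟨htop, ne_top_of_le_ne_top ENNReal.ofReal_ne_top h1⟩) h2
    have h2 := (riemEDist_triangle g x₀ (x t₁) (x t)).trans (add_le_add le_rfl h1)
    have h3 := ENNReal.toReal_mono (ENNReal.add_ne_top.2 ⟨hfin, ENNReal.ofReal_ne_top⟩) h2
    rwa [ENNReal.toReal_add hfin ENNReal.ofReal_ne_top,
      ENNReal.toReal_ofReal (hl0 t ht.1)] at h3
  have hVt : ∀ t ∈ Ico t₁ b, V (x t) ≤ N + A * (D₁ + ∫ τ in t₁..t, v τ) ^ 2 := by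
    intro t ht
    refine (hN (x t)).trans ?_
    gcongr
    exact hD t ht
  set c := √(A₀ + B₀ * N + B₀ * A * (D₁ + 1) ^ 2) with hc
  have hgrow : ∀ t ∈ Ico t₁ b, v t ≤ c * (1 + ∫ τ in t₁..t, v τ) := by
    intro t ht
    have hl := hl0 t ht.1
    set l := ∫ τ in t₁..t, v τ with hldef
    refine Real.sqrt_le_iff.2 ⟨by positivity, ?_⟩
    rw [mul_pow, hc, Real.sq_sqrt (by positivity)]
    refine (hspeed t ⟨hat₁.trans_le ht.1, ht.2⟩).trans ?_
    have h1 : B₀ * V (x t) ≤ B₀ * (N + A * (D₁ + l) ^ 2) :=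
      mul_le_mul_of_nonneg_left (hVt t ht) hB₀
    have h2 : (D₁ + l) ^ 2 ≤ ((D₁ + 1) * (1 + l)) ^ 2 := by
      gcongr
      nlinarith
    have h3 : B₀ * A * (D₁ + l) ^ 2 ≤ B₀ * A * ((D₁ + 1) * (1 + l)) ^ 2 := by gcongr
    have h4 : A₀ + B₀ * N ≤ (A₀ + B₀ * N) * (1 + l) ^ 2 :=
      le_mul_of_one_le_right (by positivity) (one_le_pow₀ (by linarith))
    calc A₀ + B₀ * V (x t) ≤ (A₀ + B₀ * N) + B₀ * A * (D₁ + l) ^ 2 := by linarith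
      _ ≤ (A₀ + B₀ * N) * (1 + l) ^ 2 + B₀ * A * ((D₁ + 1) * (1 + l)) ^ 2 := add_le_add h4 h3
      _ = _ := by ring
  obtain ⟨L, hL⟩ := exists_bound_of_linear_growth (Real.sqrt_nonneg _) hat₁ hvc hv0 hgrow
  have hL0 : 0 ≤ L := (hl0 t₁ le_rfl).trans (hL t₁ ⟨le_rfl, ht₁b⟩)
  have hvL : ∀ t ∈ Ico t₁ b, v t ≤ c * (1 + L) := fun t ht ↦ (hgrow t ht).trans
    (mul_le_mul_of_nonneg_left (by linarith [hL t ht]) (Real.sqrt_nonneg _))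
  set Λ := c * (1 + L) with hΛ
  have hΛ0 : 0 ≤ Λ := mul_nonneg (Real.sqrt_nonneg _) (by linarith)
  have hdist' : ∀ s t, t₁ ≤ s → s ≤ t → t < b →
      riemEDist g (x s) (x t) ≤ ENNReal.ofReal (Λ * |t - s|) := by
    intro s t hs hst ht
    refine (hdist s t (hat₁.trans_le hs) hst ht).trans (ENNReal.ofReal_le_ofReal ?_)
    have h1 : ‖∫ τ in s..t, v τ‖ ≤ Λ * |t - s| := by
      refine intervalIntegral.norm_integral_le_of_norm_le_const fun τ hτ ↦ ?_
      rw [uIoc_of_le hst] at hτ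
      rw [Real.norm_of_nonneg (hv0 τ)]
      exact hvL τ ⟨hs.trans hτ.1.le, hτ.2.trans_lt ht⟩
    exact (le_abs_self _).trans h1
  obtain ⟨τ, -, hτ, hτb⟩ := exists_seq_strictMono_tendsto' ht₁b
  have hcau : ∀ ε : ℝ≥0∞, 0 < ε → ∃ N, ∀ m ≥ N, ∀ n ≥ N,
      riemEDist g (x (τ m)) (x (τ n)) < ε := by
    intro ε hε
    obtain ⟨r, hr0, hrε⟩ := ENNReal.lt_iff_exists_nnreal_btwn.1 hε
    have hr0' : (0 : ℝ) < r := by exact_mod_cast hr0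
    obtain ⟨k, hk⟩ := Metric.cauchySeq_iff.1 hτb.cauchySeq (r / (Λ + 1)) (by positivity)
    have key : ∀ m ≥ k, ∀ n ≥ k, τ m ≤ τ n → riemEDist g (x (τ m)) (x (τ n)) < ε := by
      intro m hm n hn hmn
      refine (hdist' _ _ (hτ m).1.le hmn (hτ n).2).trans_lt (lt_of_le_of_lt ?_ hrε)
      rw [← ENNReal.ofReal_coe_nnreal]
      refine ENNReal.ofReal_le_ofReal ?_
      have h1 := hk n hn m hm
      rw [Real.dist_eq, lt_div_iff₀ (by positivity)] at h1
      nlinarith [abs_nonneg (τ n - τ m)]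
    refine ⟨k, fun m hm n hn ↦ ?_⟩
    rcases le_total (τ m) (τ n) with h | h
    · exact key m hm n hn h
    · rw [riemEDist_comm]; exact key n hn m hm h
  obtain ⟨p, hp⟩ := hcomp _ hcau
  refine ⟨p, N + A * (D₁ + L) ^ 2, t₁, τ, ⟨hat₁, ht₁b⟩, fun t ht ↦ (hVt t ht).trans ?_, hτ, hτb, hp⟩
  have h1 := hl0 t ht.1
  have h2 := hL t ht
  gcongr

end Riemannian

section LinearAlgebra

variable {V : Type*} [AddCommGroup V] [Module ℝ V] [TopologicalSpace V]

/-- In a Lorentzian vector space, the orthogonal complement of a timelike vector is positive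
definite. -/
lemma pos_of_orthogonal_timelike (b : V →L[ℝ] V →L[ℝ] ℝ) (hs : ∀ u v, b u v = b v u) {e k w : V}
    (hee : ∀ w, b e w = 0 → w ≠ 0 → 0 < b w w) (hk : b k k < 0)
    (hkw : b k w = 0) (hw : w ≠ 0) : 0 < b w w := by
  by_contra hneg
  push Not at hneg
  have hwk : b w k = 0 := by rw [hs, hkw]
  have hk0 : k ≠ 0 := by rintro rfl; simp at hk
  have hexp : ∀ a c : ℝ, b (a • k + c • w) (a • k + c • w) ≤ 0 := by
    intro a c
    simp only [map_add, map_smul, add_apply, smul_apply, smul_eq_mul, hkw, hwk]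
    nlinarith [mul_nonneg (sq_nonneg a) (neg_nonneg.2 hk.le),
      mul_nonneg (sq_nonneg c) (neg_nonneg.2 hneg)]
  by_cases hek : b e k = 0
  · exact absurd (hee k hek hk0) (not_lt.2 hk.le)
  · refine absurd (hee (b e w • k + (-b e k) • w) ?_ ?_) (not_lt.2 (hexp _ _))
    · simp only [map_add, map_smul, smul_eq_mul]; ring
    · intro h0
      have h1 : b k (b e w • k + (-b e k) • w) = 0 := by rw [h0, map_zero]
      simp only [map_add, map_smul, smul_eq_mul, hkw, mul_zero, add_zero, mul_eq_zero, hk.ne,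
        or_false] at h1
      rw [h1, zero_smul, zero_add, smul_eq_zero, neg_eq_zero] at h0
      exact h0.elim hek hw

lemma pos_aux_of_timelike (b : V →L[ℝ] V →L[ℝ] ℝ) (hs : ∀ u v, b u v = b v u) {e k : V}
    (hee : ∀ w, b e w = 0 → w ≠ 0 → 0 < b w w) (hk : b k k < 0) {v : V} (hv : v ≠ 0) :
    0 < b v v + 2 / (-(b k k)) * (b k v * b k v) := by
  set a := b k v / b k k with ha
  set w := v - a • k with hw
  have hkw : b k w = 0 := by
    rw [hw, map_sub, map_smul, smul_eq_mul, ha, div_mul_cancel₀ _ hk.ne, sub_self]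
  have hwk : b w k = 0 := by rw [hs, hkw]
  have hv' : v = a • k + w := by rw [hw]; abel
  have hkv : b k v = a * b k k := by rw [ha, div_mul_cancel₀ _ hk.ne]
  have hvv : b v v = a ^ 2 * b k k + b w w := by
    rw [hv']
    simp only [map_add, map_smul, add_apply, smul_apply, smul_eq_mul, hkw, hwk]
    ring
  have hsum : b v v + 2 / (-(b k k)) * (b k v * b k v) = a ^ 2 * (-(b k k)) + b w w := by
    rw [hvv, hkv]; field_simp [hk.ne]; ring
  rw [hsum]
  by_cases hw0 : w = 0
  · have ha0 : a ≠ 0 := by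
      rintro h
      apply hv
      rw [hv', hw0, h]; simp
    rw [hw0]
    simp only [map_zero, add_zero]
    have : 0 < a ^ 2 := by positivity
    nlinarith
  · have := pos_of_orthogonal_timelike b hs hee hk hkw hw0
    nlinarith [sq_nonneg a]

end LinearAlgebra

section StaticComplete

variable {E : Type*} [NormedAddCommGroup E] [NormedSpace ℝ E] [FiniteDimensional ℝ E]
  {H : Type*} [TopologicalSpace H] {I : ModelWithCorners ℝ E H}
  {M : Type*} [TopologicalSpace M] [ChartedSpace H M]

lemma exists_coercive {X : Type*} [TopologicalSpace X] {B : X → E →L[ℝ] E →L[ℝ] ℝ} {y₀ : X}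
    (hB : ContinuousAt B y₀)
    (hpos : ∀ v, v ≠ 0 → 0 < B y₀ v v) :
    ∃ m > 0, ∀ᶠ y in 𝓝 y₀, ∀ v, m * ‖v‖ ^ 2 ≤ B y v v := by
  have hcomp : IsCompact (Metric.sphere (0 : E) 1) := isCompact_sphere 0 1
  obtain ⟨m, hm, hmS⟩ : ∃ m > 0, ∀ v ∈ Metric.sphere (0 : E) 1, 2 * m ≤ B y₀ v v := by
    rcases (Metric.sphere (0 : E) 1).eq_empty_or_nonempty with h | h
    · exact ⟨1, one_pos, by simp [h]⟩
    · have hc : Continuous fun v ↦ B y₀ v v :=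
        (B y₀).continuous.clm_apply continuous_id
      obtain ⟨v, hv, hmin⟩ := hcomp.exists_isMinOn h hc.continuousOn
      have hv0 : v ≠ 0 := by
        rintro rfl; simp at hv
      refine ⟨B y₀ v v / 2, by have := hpos v hv0; positivity, fun w hw ↦ ?_⟩
      have := hmin hw
      simp only [mem_ofPred_eq] at this
      linarith
  refine ⟨m, hm, ?_⟩
  filter_upwards [hB.eventually (Metric.ball_mem_nhds _ hm)] with y hy v
  replace hy : dist (B y) (B y₀) < m := hy
  rw [dist_eq_norm] at hy
  have h1 : 2 * m * ‖v‖ ^ 2 ≤ B y₀ v v := by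
    by_cases hv : v = 0
    · simp [hv]
    have hn : 0 < ‖v‖ := norm_pos_iff.2 hv
    have h2 := hmS (‖v‖⁻¹ • v) (by simp [norm_smul, hn.ne'])
    rw [map_smul, map_smul, smul_apply, smul_eq_mul, smul_eq_mul] at h2
    have h3 : ‖v‖⁻¹ * (‖v‖⁻¹ * B y₀ v v) = B y₀ v v / ‖v‖ ^ 2 := by field_simp
    rw [h3, le_div_iff₀ (by positivity)] at h2
    exact h2
  have h2 : |(B y - B y₀) v v| ≤ m * ‖v‖ ^ 2 := by
    have h3 := (B y - B y₀).le_opNorm₂ v v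
    rw [Real.norm_eq_abs] at h3
    nlinarith [norm_nonneg v, mul_nonneg (norm_nonneg v) (norm_nonneg v)]
  have h3 : (B y - B y₀) v v = B y v v - B y₀ v v := by simp
  rw [h3] at h2
  linarith [(abs_le.1 h2).1]

variable [IsManifold I ∞ M] [I.Boundaryless] {g : MetricTensor I M}

lemma chartForm_pos {q : M} {y : E} (hy : y ∈ (extChartAt I q).target)
    (hpos : ∀ x (v : TangentSpace I x), v ≠ 0 → 0 < g x v v) {v : E} (hv : v ≠ 0) :
    0 < chartForm g q y v v := by
  refine hpos _ _ fun h0 ↦ hv ?_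
  have h1 : mfderiv I 𝓘(ℝ, E) (extChartAt I q) ((extChartAt I q).symm y)
      (mfderiv 𝓘(ℝ, E) I (extChartAt I q).symm y v) = 0 :=
    (congrArg _ h0).trans (map_zero _)
  exact (mfderiv_mfderiv_symm hy v).symm.trans h1

/-- Velocities of bounded length have bounded components. -/
lemma exists_bound_chart_velocity (hg : IsPseudoRiemannian g)
    (hpos : ∀ x (v : TangentSpace I x), v ≠ 0 → 0 < g x v v) {x : ℝ → M} {p : M} {τ : ℕ → ℝ} {C : ℝ}
    (hx : ∀ n, MDifferentiableAt 𝓘(ℝ, ℝ) I x (τ n))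
    (hxp : Tendsto (fun n ↦ x (τ n)) atTop (𝓝 p))
    (hC : ∀ n, g (x (τ n)) (velocity I x (τ n)) (velocity I x (τ n)) ≤ C) :
    ∃ R, ∀ᶠ n in atTop, x (τ n) ∈ (extChartAt I p).source ∧
      ‖deriv (extChartAt I p ∘ x) (τ n)‖ ≤ R := by
  have hp := mem_extChartAt_target (I := I) p
  obtain ⟨m, hm, hnear⟩ := exists_coercive (hg.smooth p _ hp).continuousAt
    fun v hv ↦ chartForm_pos hp hpos hv
  refine ⟨√(C / m), ?_⟩
  have h1 := hxp.eventually (extChartAt_source_mem_nhds (I := I) p)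
  have h2 := hxp.eventually ((continuousAt_extChartAt (I := I) p).eventually hnear)
  filter_upwards [h1, h2] with n h3 h4
  refine ⟨h3, Real.le_sqrt_of_sq_le ?_⟩
  rw [le_div_iff₀ hm]
  have h5 := hC n
  rw [metric_velocity g (hx n) h3] at h5
  linarith [h4 (deriv (extChartAt I p ∘ x) (τ n))]

/-- If positions converge and velocities have bounded components along a sequence of times, then
the states accumulate. -/
lemma exists_accumulation_state {γ : ℝ → M} {p : M} {τ : ℕ → ℝ} {a b : ℝ}
    (hτ : ∀ n, τ n ∈ Ioo a b) (hτb : Tendsto τ atTop (𝓝 b))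
    (hp : Tendsto (fun n ↦ γ (τ n)) atTop (𝓝 p)) {R : ℝ}
    (hR : ∀ᶠ n in atTop, γ (τ n) ∈ (extChartAt I p).source ∧
      ‖deriv (extChartAt I p ∘ γ) (τ n)‖ ≤ R) :
    ∃ (q : M) (z₀ : E × E), z₀.1 ∈ (extChartAt I q).target ∧
        ∀ r > 0, ∃ᶠ t in 𝓝[<] b, γ t ∈ (extChartAt I q).source ∧
          chartState I q γ t ∈ Metric.ball z₀ r := by
  obtain ⟨N, hN⟩ := eventually_atTop.1 hR
  obtain ⟨v₀, -, φ, hφ, hv⟩ := tendsto_subseq_of_bounded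
    (Metric.isBounded_closedBall (x := (0 : E)) (r := R))
    (x := fun n ↦ deriv (extChartAt I p ∘ γ) (τ (n + N))) (fun n ↦ by
      simpa using (hN (n + N) (by omega)).2)
  have hψ : Tendsto (fun n ↦ φ n + N) atTop atTop :=
    (tendsto_add_atTop_nat N).comp hφ.tendsto_atTop
  refine ⟨p, (extChartAt I p p, v₀), mem_extChartAt_target p, fun r hr ↦ ?_⟩
  have h1 : Tendsto (fun n ↦ chartState I p γ (τ (φ n + N))) atTop (𝓝 (extChartAt I p p, v₀)) :=
    (((continuousAt_extChartAt (I := I) p).tendsto.comp hp).comp hψ).prodMk_nhds hv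
  have h2 : Tendsto (fun n ↦ τ (φ n + N)) atTop (𝓝[<] b) :=
    tendsto_nhdsWithin_iff.2 ⟨hτb.comp hψ, Eventually.of_forall fun n ↦ (hτ _).2⟩
  refine h2.frequently (Eventually.frequently ?_)
  filter_upwards [h1 (Metric.ball_mem_nhds _ hr)] with n hn
  exact ⟨(hN (φ n + N) (by omega)).1, hn⟩

lemma IsStatic.isPseudoRiemannian {K : ∀ x : M, TangentSpace I x} (h : IsStatic g K) :
    IsPseudoRiemannian g where
  smooth _ _ hy := contDiffAt_chartForm h.lorentzian.smooth hy
  symm := h.lorentzian.symm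
  nondegenerate x u hu := by
    obtain ⟨e, -, he⟩ := h.lorentzian.signature x
    by_contra hne
    exact (he u (by rw [h.lorentzian.symm, hu]) hne).ne' (hu u)

lemma auxMetric_apply (g : MetricTensor I M) (K : ∀ x : M, TangentSpace I x) (x : M)
    (u v : TangentSpace I x) :
    auxMetric g K x u v = g x u v + 2 / (-(g x (K x) (K x))) * (g x (K x) u * g x (K x) v) := by
  simp [auxMetric, beta]

lemma IsStatic.auxMetric_pos {K : ∀ x : M, TangentSpace I x} (h : IsStatic g K) (x : M)
    (v : TangentSpace I x) (hv : v ≠ 0) : 0 < auxMetric g K x v v := by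
  obtain ⟨e, -, he⟩ := h.lorentzian.signature x
  rw [auxMetric_apply]
  exact pos_aux_of_timelike (g x) (h.lorentzian.symm x) he (h.timelike x) hv

lemma IsStatic.isPseudoRiemannian_auxMetric {K : ∀ x : M, TangentSpace I x} (h : IsStatic g K) :
    IsPseudoRiemannian (auxMetric g K) where
  smooth q y hy := by
    have hg := contDiffAt_chartForm h.lorentzian.smooth hy
    have hK := contDiffAt_chartField h.smooth hy
    have hne : chartForm g q y (chartField K q y) (chartField K q y) ≠ 0 := by
      have := chartForm_chartField (g := g) K K ((extChartAt I q).map_target hy)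
      rw [(extChartAt I q).right_inv hy] at this
      rw [this]; exact (h.timelike _).ne
    refine contDiffAt_clm_of_apply fun v ↦ contDiffAt_clm_of_apply fun w ↦ ?_
    have hKK := (hg.clm_apply hK).clm_apply hK
    have hKv := (hg.clm_apply hK).clm_apply (contDiffAt_const (c := v))
    have hKw := (hg.clm_apply hK).clm_apply (contDiffAt_const (c := w))
    have hvw := (hg.clm_apply (contDiffAt_const (c := v))).clm_apply (contDiffAt_const (c := w))
    refine (hvw.add ((contDiffAt_const (c := (2 : ℝ)).div hKK.neg (neg_ne_zero.2 hne)).mul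
      (hKv.mul hKw))).congr_of_eventuallyEq ?_
    filter_upwards [extChartAt_target_mem_nhds_of_mem hy] with z hz
    have hx := (extChartAt I q).map_target hz
    have hc : ∀ u : E, g ((extChartAt I q).symm z) (K ((extChartAt I q).symm z))
        (mfderiv 𝓘(ℝ, E) I (extChartAt I q).symm z u) =
        chartForm g q z (chartField K q z) u := by
      intro u
      rw [metric_eq_chartForm g hx, mfderiv_mfderiv_symm hz, mfderiv_extChartAt_field K hx,
        (extChartAt I q).right_inv hz]
    have hkk : g ((extChartAt I q).symm z) (K ((extChartAt I q).symm z))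
        (K ((extChartAt I q).symm z)) =
        chartForm g q z (chartField K q z) (chartField K q z) := by
      rw [← chartForm_chartField (g := g) K K hx, (extChartAt I q).right_inv hz]
    refine (auxMetric_apply g K _ _ _).trans ?_
    refine congrArg₂ (· + ·) rfl ?_
    exact congrArg₂ (· * ·) (congrArg (fun r : ℝ ↦ 2 / -r) hkk)
      (congrArg₂ (· * ·) (hc v) (hc w))
  symm x u v := by
    rw [auxMetric_apply, auxMetric_apply, h.lorentzian.symm x u v]; ring
  nondegenerate x u hu := by
    by_contra hne
    exact (h.auxMetric_pos x u hne).ne' (hu u)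

lemma IsStatic.continuous_beta {K : ∀ x : M, TangentSpace I x} (h : IsStatic g K) :
    Continuous (beta g K) := by
  rw [continuous_iff_continuousAt]
  intro x
  have hs := mem_extChartAt_source (I := I) x
  have hm := (extChartAt I x).map_source hs
  have hg := (contDiffAt_chartForm h.lorentzian.smooth hm).continuousAt
  have hK := (contDiffAt_chartField h.smooth hm).continuousAt
  have h1 := (((hg.clm_apply hK).clm_apply hK).neg).comp (continuousAt_extChartAt (I := I) x)
  refine h1.congr ?_
  filter_upwards [extChartAt_source_mem_nhds (I := I) x] with y hy
  have := chartForm_chartField (g := g) K K hy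
  simp only [beta, Function.comp_apply]
  rw [← this]
  rfl

lemma IsStatic.beta_pos {K : ∀ x : M, TangentSpace I x} (h : IsStatic g K) (x : M) :
    0 < beta g K x := neg_pos.2 (h.timelike x)

/-- Along a geodesic the auxiliary squared speed is an affine function of `β⁻¹`. -/
lemma IsStatic.auxMetric_velocity_le {K : ∀ x : M, TangentSpace I x} (h : IsStatic g K)
    {γ : ℝ → M} {U : Set ℝ} (hU : IsOpen U) (hUc : U.OrdConnected) (hγ : IsGeodesicOn g γ U) :
    ∃ A₀ B₀ : ℝ, 0 ≤ A₀ ∧ 0 ≤ B₀ ∧ ∀ t ∈ U,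
      auxMetric g K (γ t) (velocity I γ t) (velocity I γ t) ≤ A₀ + B₀ * (beta g K (γ t))⁻¹ := by
  have hg := h.isPseudoRiemannian
  obtain ⟨C₁, h₁⟩ := exists_const_of_hasDerivAt_zero hU hUc fun t ht ↦ hγ.hasDerivAt_energy hg ht
  obtain ⟨C₂, h₂⟩ := exists_const_of_hasDerivAt_zero hU hUc fun t ht ↦
    hγ.hasDerivAt_momentum hg h.lorentzian.smooth h.smooth h.killing ht
  refine ⟨|C₁|, 2 * C₂ ^ 2, abs_nonneg _, by positivity, fun t ht ↦ ?_⟩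
  rw [auxMetric_apply, h.lorentzian.symm _ (K (γ t)) (velocity I γ t), h₁ t ht, h₂ t ht]
  have : 2 / (-(g (γ t) (K (γ t)) (K (γ t)))) * (C₂ * C₂) = 2 * C₂ ^ 2 * (beta g K (γ t))⁻¹ := by
    rw [beta]; ring
  rw [this]
  linarith [le_abs_self C₁]

variable [T2Space M]

/-- If the auxiliary metric is complete and `β⁻¹` is at most quadratic, then the static metric is
geodesically complete. -/
theorem IsStatic.geodesicallyComplete_of_atMostQuadratic {K : ∀ x : M, TangentSpace I x}
    (h : IsStatic g K) (hc : RiemannianComplete (auxMetric g K))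
    (hq : AtMostQuadratic (auxMetric g K) (fun x ↦ (beta g K x)⁻¹)) : GeodesicallyComplete g := by
  refine geodesicallyComplete_of_accumulates h.isPseudoRiemannian fun γ a b hab hγ ↦ ?_
  obtain ⟨A₀, B₀, hA₀, hB₀, hle⟩ := h.auxMetric_velocity_le isOpen_Ioo ordConnected_Ioo hγ
  obtain ⟨p, C, t₁, τ, ht₁, h4, hτ, h2, h3⟩ := exists_accumulation_of_atMostQuadratic
    h.isPseudoRiemannian_auxMetric hc
    (h.continuous_beta.inv₀ fun x ↦ (h.beta_pos x).ne') hq hab (fun t ht ↦ (hγ t ht).1) hA₀ hB₀ hle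
  have h1 : ∀ n, τ n ∈ Ioo a b := fun n ↦ ⟨ht₁.1.trans (hτ n).1, (hτ n).2⟩
  obtain ⟨R, hR⟩ := exists_bound_chart_velocity (C := A₀ + B₀ * C) h.isPseudoRiemannian_auxMetric
    h.auxMetric_pos (fun n ↦ (hγ _ (h1 n)).1.mdifferentiableAt (by simp)) h3
    (fun n ↦ (hle _ (h1 n)).trans (by gcongr; exact h4 _ ⟨(hτ n).1.le, (hτ n).2⟩))
  exact exists_accumulation_state h1 h2 h3 hR

/-- Compact static manifolds are geodesically complete. -/
theorem IsStatic.geodesicallyComplete_of_compactSpace [SecondCountableTopology M] [CompactSpace M]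
    {K : ∀ x : M, TangentSpace I x} (h : IsStatic g K) : GeodesicallyComplete g := by
  refine geodesicallyComplete_of_accumulates h.isPseudoRiemannian fun γ a b hab hγ ↦ ?_
  obtain ⟨A₀, B₀, hA₀, hB₀, hle⟩ := h.auxMetric_velocity_le isOpen_Ioo ordConnected_Ioo hγ
  obtain ⟨C, hC⟩ := isCompact_univ.bddAbove_image
    (h.continuous_beta.inv₀ fun x ↦ (h.beta_pos x).ne').continuousOn
  obtain ⟨τ, -, hτ, hτb⟩ := exists_seq_strictMono_tendsto' hab
  obtain ⟨p, -, φ, hφ, hp⟩ := isCompact_univ.tendsto_subseq (x := fun n ↦ γ (τ n))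
    fun n ↦ mem_univ _
  obtain ⟨R, hR⟩ := exists_bound_chart_velocity (C := A₀ + B₀ * C) (τ := τ ∘ φ)
    h.isPseudoRiemannian_auxMetric h.auxMetric_pos
    (fun n ↦ (hγ _ (hτ (φ n))).1.mdifferentiableAt (by simp)) hp
    (fun n ↦ (hle _ (hτ (φ n))).trans
      (by gcongr; exact hC (mem_image_of_mem _ (mem_univ (γ ((τ ∘ φ) n))))))
  exact exists_accumulation_state (fun n ↦ hτ (φ n)) (hτb.comp hφ.tendsto_atTop) hp hR

end StaticComplete

section Standard

variable {F : Type*} [NormedAddCommGroup F] [NormedSpace ℝ F] [FiniteDimensional ℝ F]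
  {G : Type*} [TopologicalSpace G] {J : ModelWithCorners ℝ F G}
  {S : Type*} [TopologicalSpace S] [ChartedSpace G S]

lemma standardMetric_apply (β : S → ℝ) (gS : MetricTensor J S) (p : ℝ × S) (u w : ℝ × F) :
    standardMetric β gS p u w = -(β p.2) * (u.1 * w.1) + gS p.2 u.2 w.2 := by
  have h1 : ∀ u : ℝ × F, dt (J := J) p u = u.1 := fun u ↦ by
    rw [dt, mfderiv_fst]; rfl
  have h2 : ∀ u : ℝ × F, (mfderiv (𝓘(ℝ, ℝ).prod J) J (Prod.snd : ℝ × S → S) p u : F) = u.2 :=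
    fun u ↦ by rw [mfderiv_snd]; rfl
  have h3 : pullbackMetric (𝓘(ℝ, ℝ).prod J) (Prod.snd : ℝ × S → S) gS p u w = gS p.2 u.2 w.2 := by
    change gS p.2 (mfderiv (𝓘(ℝ, ℝ).prod J) J (Prod.snd : ℝ × S → S) p u)
      (mfderiv (𝓘(ℝ, ℝ).prod J) J (Prod.snd : ℝ × S → S) p w) = _
    exact congrArg₂ (fun a b : F ↦ gS p.2 a b) (h2 u) (h2 w)
  refine Eq.trans (b := -(β p.2) * (dt (J := J) p u * dt (J := J) p w) + _) rfl ?_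
  rw [h1, h1]
  exact congrArg (-(β p.2) * (u.1 * w.1) + ·) h3

variable [IsManifold J ∞ S] [J.Boundaryless] {gS : MetricTensor J S} {β : S → ℝ}

lemma mem_target_prod {q : ℝ × S} {z : ℝ × F} :
    z ∈ (extChartAt (𝓘(ℝ, ℝ).prod J) q).target ↔ z.2 ∈ (extChartAt J q.2).target := by
  rw [extChartAt_prod, extChartAt_model_space_eq_id]; simp

lemma mem_source_prod {q p : ℝ × S} :
    p ∈ (extChartAt (𝓘(ℝ, ℝ).prod J) q).source ↔ p.2 ∈ (extChartAt J q.2).source := by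
  rw [extChartAt_prod, extChartAt_model_space_eq_id]; simp

lemma extChartAt_prod_apply (q p : ℝ × S) :
    extChartAt (𝓘(ℝ, ℝ).prod J) q p = (p.1, extChartAt J q.2 p.2) := by
  rw [extChartAt_prod, extChartAt_model_space_eq_id]; simp

lemma extChartAt_prod_symm_apply (q : ℝ × S) (z : ℝ × F) :
    (extChartAt (𝓘(ℝ, ℝ).prod J) q).symm z = (z.1, (extChartAt J q.2).symm z.2) := by
  rw [extChartAt_prod, extChartAt_model_space_eq_id]; simp

lemma chartForm_standardMetric (β : S → ℝ) (gS : MetricTensor J S) {q : ℝ × S} {z : ℝ × F}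
    (hz : z.2 ∈ (extChartAt J q.2).target) (u w : ℝ × F) :
    chartForm (standardMetric β gS) q z u w =
      -(β ((extChartAt J q.2).symm z.2)) * (u.1 * w.1) + chartForm gS q.2 z.2 u.2 w.2 := by
  have hz' : z ∈ (extChartAt (𝓘(ℝ, ℝ).prod J) q).target := mem_target_prod.2 hz
  set Φ := (extChartAt (𝓘(ℝ, ℝ).prod J) q).symm with hΦ
  have hd := mdifferentiableAt_extChartAt_symm hz'
  have e1 : ∀ u : ℝ × F, (mfderiv 𝓘(ℝ, ℝ × F) (𝓘(ℝ, ℝ).prod J) Φ z u : ℝ × F).1 = u.1 := by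
    intro u
    have h1 := mfderiv_comp z (I'' := 𝓘(ℝ, ℝ)) (g := (Prod.fst : ℝ × S → ℝ))
        mdifferentiableAt_fst hd
    rw [mfderiv_fst] at h1
    have h2 : (Prod.fst : ℝ × S → ℝ) ∘ Φ = Prod.fst := by
      ext z; simp only [Function.comp_apply, hΦ, extChartAt_prod_symm_apply]
    rw [h2, mfderiv_eq_fderiv, fderiv_fst] at h1
    exact (DFunLike.congr_fun h1 u).symm
  have e2 : ∀ u : ℝ × F, (mfderiv 𝓘(ℝ, ℝ × F) (𝓘(ℝ, ℝ).prod J) Φ z u : ℝ × F).2 =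
      (mfderiv 𝓘(ℝ, F) J (extChartAt J q.2).symm z.2 u.2 : F) := by
    intro u
    have h1 := mfderiv_comp z (I'' := J) (g := (Prod.snd : ℝ × S → S)) mdifferentiableAt_snd hd
    rw [mfderiv_snd] at h1
    have h2 : (Prod.snd : ℝ × S → S) ∘ Φ = (extChartAt J q.2).symm ∘ Prod.snd := by
      ext z; simp only [Function.comp_apply, hΦ, extChartAt_prod_symm_apply]
    have h3 := mfderiv_comp z (I := 𝓘(ℝ, ℝ × F)) (I' := 𝓘(ℝ, F)) (I'' := J)
      (g := (extChartAt J q.2).symm) (f := (Prod.snd : ℝ × F → F))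
      (mdifferentiableAt_extChartAt_symm hz) differentiableAt_snd.mdifferentiableAt
    rw [mfderiv_eq_fderiv, fderiv_snd] at h3
    rw [h2] at h1
    exact (DFunLike.congr_fun (h1.symm.trans h3) u)
  have h1 := standardMetric_apply β gS (Φ z) (mfderiv 𝓘(ℝ, ℝ × F) (𝓘(ℝ, ℝ).prod J) Φ z u)
    (mfderiv 𝓘(ℝ, ℝ × F) (𝓘(ℝ, ℝ).prod J) Φ z w)
  rw [e1, e1, e2, e2] at h1
  refine Eq.trans ?_ (h1.trans ?_)
  · rfl
  · have hp : (Φ z).2 = (extChartAt J q.2).symm z.2 := by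
      rw [hΦ, extChartAt_prod_symm_apply]
    rw [hp]
    refine congrArg₂ (· + ·) rfl ?_
    exact metric_congr gS hp _ _

lemma isPseudoRiemannian_of_isRiemannian (h : gS.IsRiemannian) : IsPseudoRiemannian gS where
  smooth _ _ hy := contDiffAt_chartForm h.smooth hy
  symm := h.symm
  nondegenerate x u hu := by
    by_contra hne
    exact (h.pos x u hne).ne' (hu u)

lemma isPseudoRiemannian_standardMetric (h : gS.IsRiemannian) (hβ : ContMDiff J 𝓘(ℝ, ℝ) ∞ β)
    (hβ0 : ∀ x, 0 < β x) : IsPseudoRiemannian (standardMetric β gS) where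
  smooth q z hz := by
    have hz2 := mem_target_prod.1 hz
    refine contDiffAt_clm_of_apply fun v ↦ contDiffAt_clm_of_apply fun w ↦ ?_
    have h1 : ContDiffAt ℝ ∞ (fun y ↦ β ((extChartAt J q.2).symm y)) z.2 :=
      (ContMDiffAt.comp z.2 (hβ _) (contMDiffAt_extChartAt_symm hz2)).contDiffAt
    have h2 : ContDiffAt ℝ ∞ (fun z' : ℝ × F ↦ β ((extChartAt J q.2).symm z'.2)) z :=
      ContDiffAt.comp (g := fun y ↦ β ((extChartAt J q.2).symm y)) z h1 contDiffAt_snd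
    have h3 : ContDiffAt ℝ ∞ (fun z' : ℝ × F ↦ chartForm gS q.2 z'.2) z :=
      ContDiffAt.comp (g := chartForm gS q.2) z (contDiffAt_chartForm h.smooth hz2) contDiffAt_snd
    refine ((h2.neg.mul (contDiffAt_const (c := v.1 * w.1))).add
      ((h3.clm_apply (contDiffAt_const (c := v.2))).clm_apply
        (contDiffAt_const (c := w.2)))).congr_of_eventuallyEq ?_
    filter_upwards [extChartAt_target_mem_nhds_of_mem hz] with z' hz'
    exact chartForm_standardMetric β gS (mem_target_prod.1 hz') v w
  symm p u w := by
    refine (standardMetric_apply β gS p u w).trans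
      (Eq.trans ?_ (standardMetric_apply β gS p w u).symm)
    exact congrArg₂ (· + ·) (congrArg _ (mul_comm _ _)) (h.symm p.2 _ _)
  nondegenerate p u hu := by
    set u' : ℝ × F := u with hu'
    have h1 := (standardMetric_apply β gS p u' (1, 0)).symm.trans (hu _)
    have h2 := (standardMetric_apply β gS p u' (0, u'.2)).symm.trans (hu _)
    have e1 : u'.1 = 0 := by
      have h3 : (gS p.2 u'.2) 0 = 0 := map_zero _
      simp only [mul_one] at h1
      rw [show gS p.2 u'.2 (0 : F) = 0 from h3, add_zero] at h1
      exact (mul_eq_zero.1 h1).resolve_left (neg_ne_zero.2 (hβ0 _).ne')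
    have e2 : u'.2 = 0 := by
      by_contra hne
      simp only [mul_zero, zero_add] at h2
      exact (h.pos p.2 u'.2 hne).ne' h2
    exact Prod.ext e1 e2

/-- The conserved quantities of a geodesic of a standard static spacetime. -/
lemma IsGeodesicOn.exists_const_standard (h : gS.IsRiemannian) (hβ : ContMDiff J 𝓘(ℝ, ℝ) ∞ β)
    (hβ0 : ∀ x, 0 < β x) {γ : ℝ → ℝ × S} {U : Set ℝ} (hU : IsOpen U) (hUc : U.OrdConnected)
    (hγ : IsGeodesicOn (standardMetric β gS) γ U) :
    ∃ C₁ C₂ : ℝ, ∀ t ∈ U, HasDerivAt (fun τ ↦ (γ τ).1) (C₂ * (β (γ t).2)⁻¹) t ∧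
      gS (γ t).2 (velocity J (fun τ ↦ (γ τ).2) t) (velocity J (fun τ ↦ (γ τ).2) t) =
        C₁ + C₂ ^ 2 * (β (γ t).2)⁻¹ := by
  have hg := isPseudoRiemannian_standardMetric h hβ hβ0
  have hmd : ∀ t ∈ U, MDifferentiableAt 𝓘(ℝ, ℝ) (𝓘(ℝ, ℝ).prod J) γ t := fun t ht ↦
    (hγ t ht).1.mdifferentiableAt (by simp)
  have hd1 : ∀ t ∈ U, HasDerivAt (fun τ ↦ (γ τ).1)
      (velocity (𝓘(ℝ, ℝ).prod J) γ t : ℝ × F).1 t := by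
    intro t ht
    have h1 := mfderiv_comp t (I'' := 𝓘(ℝ, ℝ)) (g := (Prod.fst : ℝ × S → ℝ))
      mdifferentiableAt_fst (hmd t ht)
    have h2 : MDifferentiableAt 𝓘(ℝ, ℝ) 𝓘(ℝ, ℝ) (Prod.fst ∘ γ) t :=
      mdifferentiableAt_fst.comp t (hmd t ht)
    rw [mfderiv_fst, mfderiv_eq_fderiv] at h1
    have h3 := (mdifferentiableAt_iff_differentiableAt.1 h2).hasFDerivAt.hasDerivAt
    rwa [h1] at h3
  have hd2 : ∀ t ∈ U, (velocity J (fun τ ↦ (γ τ).2) t : F) =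
      (velocity (𝓘(ℝ, ℝ).prod J) γ t : ℝ × F).2 := by
    intro t ht
    have h1 := mfderiv_comp t (I'' := J) (g := (Prod.snd : ℝ × S → S))
      mdifferentiableAt_snd (hmd t ht)
    rw [mfderiv_snd] at h1
    exact DFunLike.congr_fun h1 1
  obtain ⟨C₁, hC₁⟩ := exists_const_of_hasDerivAt_zero hU hUc fun t ht ↦ hγ.hasDerivAt_energy hg ht
  have hmom : ∀ t ∈ U, HasDerivAt
      (fun τ ↦ β (γ τ).2 * (velocity (𝓘(ℝ, ℝ).prod J) γ τ : ℝ × F).1) 0 t := by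
    intro t ht
    obtain ⟨q, hs⟩ : ∃ q, γ t ∈ (extChartAt (𝓘(ℝ, ℝ).prod J) q).source :=
      ⟨γ t, mem_extChartAt_source (γ t)⟩
    obtain ⟨h1, h2⟩ := hγ.geodesicAt hg ht hs
    set B := chartForm (standardMetric β gS) q with hB
    have hm := (extChartAt (𝓘(ℝ, ℝ).prod J) q).map_source hs
    have hBd : DifferentiableAt ℝ B (extChartAt (𝓘(ℝ, ℝ).prod J) q (γ t)) := hg.differentiableAt hm
    have hkill : KillingAt B (fun _ ↦ ((1 : ℝ), (0 : F)))
        (extChartAt (𝓘(ℝ, ℝ).prod J) q (γ t)) := by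
      intro u w
      set z := extChartAt (𝓘(ℝ, ℝ).prod J) q (γ t) with hz
      have h3 : HasDerivAt (fun s : ℝ ↦ z + s • ((1 : ℝ), (0 : F))) ((1 : ℝ), (0 : F)) 0 := by
        simpa using ((hasDerivAt_id (0 : ℝ)).smul_const ((1 : ℝ), (0 : F))).const_add z
      have h4 := hasFDerivAt_bilin_apply hBd u w
      have h5 := HasFDerivAt.comp_hasDerivAt (0 : ℝ) (l := fun z ↦ B z u w)
        (f := fun s : ℝ ↦ z + s • ((1 : ℝ), (0 : F))) (by simpa using h4) h3
      have h6 : (fun z ↦ B z u w) ∘ (fun s : ℝ ↦ z + s • ((1 : ℝ), (0 : F))) =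
          fun _ ↦ B z u w := by
        ext s
        simp only [Function.comp_apply]
        have hz2 := mem_target_prod.1 hm
        rw [hB, chartForm_standardMetric β gS (by simpa using hz2),
          chartForm_standardMetric β gS hz2]
        simp
      rw [h6] at h5
      have h7 := h5.unique (hasDerivAt_const 0 _)
      simp only [ContinuousLinearMap.flip_apply] at h7
      rw [h7]
      simp
    have h3 := StaticSpacetime.hasDerivAt_momentum hBd (fun v w ↦ chartForm_symm hg.symm _ _ _ _)
      (differentiableAt_const _) hkill (contDiffAt_chart_curve h1 hs)
    rw [Function.comp_apply, h2] at h3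
    have h4 := h3.neg
    rw [neg_zero] at h4
    refine h4.congr_of_eventuallyEq ?_
    filter_upwards [hU.mem_nhds ht, h1.continuousAt (extChartAt_source_mem_nhds_of_mem hs)]
      with τ h5 h6
    have h7 := mem_target_prod.1 ((extChartAt (𝓘(ℝ, ℝ).prod J) q).map_source h6)
    have h9 : (deriv (extChartAt (𝓘(ℝ, ℝ).prod J) q ∘ γ) τ).1 =
        (velocity (𝓘(ℝ, ℝ).prod J) γ τ : ℝ × F).1 := by
      have e1 := (contDiffAt_chart_curve (hγ τ h5).1 h6).differentiableAt (by simp)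
      have e2 := hasDerivAt_fst_comp e1.hasDerivAt
      refine e2.unique ?_
      have e3 := hd1 τ h5
      refine e3.congr_of_eventuallyEq (Eventually.of_forall fun σ ↦ ?_)
      simp only [Function.comp_apply, extChartAt_prod_apply]
    rw [Pi.neg_apply, Function.comp_apply]
    rw [chartForm_standardMetric β gS h7, h9, extChartAt_prod_apply]
    have h10 : (extChartAt J q.2).symm (extChartAt J q.2 (γ τ).2) = (γ τ).2 :=
      (extChartAt J q.2).left_inv (mem_source_prod.1 h6)
    simp only [h10, map_zero]
    ring
  obtain ⟨C₂, hC₂⟩ := exists_const_of_hasDerivAt_zero hU hUc hmom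
  have hT : ∀ t ∈ U, (velocity (𝓘(ℝ, ℝ).prod J) γ t : ℝ × F).1 = C₂ * (β (γ t).2)⁻¹ := by
    intro t ht
    rw [← hC₂ t ht]
    field_simp [(hβ0 (γ t).2).ne']
  refine ⟨C₁, C₂, fun t ht ↦ ⟨hT t ht ▸ hd1 t ht, ?_⟩⟩
  have h1 := (standardMetric_apply β gS (γ t) (velocity (𝓘(ℝ, ℝ).prod J) γ t)
    (velocity (𝓘(ℝ, ℝ).prod J) γ t)).symm.trans (hC₁ t ht)
  rw [hT t ht] at h1
  have h2 : gS (γ t).2 (velocity J (fun τ ↦ (γ τ).2) t) (velocity J (fun τ ↦ (γ τ).2) t) =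
      gS (γ t).2 (velocity (𝓘(ℝ, ℝ).prod J) γ t : ℝ × F).2
        (velocity (𝓘(ℝ, ℝ).prod J) γ t : ℝ × F).2 :=
    congrArg₂ (fun a b : F ↦ gS (γ t).2 a b) (hd2 t ht) (hd2 t ht)
  rw [h2]
  have hne := (hβ0 (γ t).2).ne'
  have h3 : β (γ t).2 * (C₂ * (β (γ t).2)⁻¹ * (C₂ * (β (γ t).2)⁻¹)) = C₂ ^ 2 * (β (γ t).2)⁻¹ := by
    field_simp
  linarith

/-- Geodesic completeness of standard static spacetimes. -/
theorem geodesicallyComplete_standardMetric [T2Space S] (h : gS.IsRiemannian)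
    (hβ : ContMDiff J 𝓘(ℝ, ℝ) ∞ β) (hβ0 : ∀ x, 0 < β x) (hc : RiemannianComplete gS)
    (hq : AtMostQuadratic gS (fun x ↦ (β x)⁻¹)) :
    GeodesicallyComplete (standardMetric β gS) := by
  have hg := isPseudoRiemannian_standardMetric h hβ hβ0
  refine geodesicallyComplete_of_accumulates hg fun γ a b hab hγ ↦ ?_
  obtain ⟨C₁, C₂, hC⟩ := hγ.exists_const_standard h hβ hβ0 isOpen_Ioo ordConnected_Ioo
  have hx : ∀ t ∈ Ioo a b, ContMDiffAt 𝓘(ℝ, ℝ) J 2 (fun τ ↦ (γ τ).2) t := fun t ht ↦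
    contMDiffAt_snd.comp t (hγ t ht).1
  have hle : ∀ t ∈ Ioo a b, gS (γ t).2 (velocity J (fun τ ↦ (γ τ).2) t)
      (velocity J (fun τ ↦ (γ τ).2) t) ≤ |C₁| + C₂ ^ 2 * (β (γ t).2)⁻¹ := fun t ht ↦ by
    rw [(hC t ht).2]; linarith [le_abs_self C₁]
  obtain ⟨p, C, t₁, τ, ht₁, hVC, hτ, hτb, hp⟩ := exists_accumulation_of_atMostQuadratic
    (isPseudoRiemannian_of_isRiemannian h) hc (hβ.continuous.inv₀ fun x ↦ (hβ0 x).ne') hq hab hx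
    (abs_nonneg C₁) (sq_nonneg C₂) hle
  have hτab : ∀ n, τ n ∈ Ioo a b := fun n ↦ ⟨ht₁.1.trans (hτ n).1, (hτ n).2⟩
  obtain ⟨R, hR⟩ := exists_bound_chart_velocity (C := |C₁| + C₂ ^ 2 * C)
    (isPseudoRiemannian_of_isRiemannian h) h.pos
    (fun n ↦ (hx _ (hτab n)).mdifferentiableAt (by simp)) hp
    (fun n ↦ (hle _ (hτab n)).trans (by gcongr; exact hVC _ ⟨(hτ n).1.le, (hτ n).2⟩))
  have hdt : ∀ t ∈ Ico t₁ b, ‖C₂ * (β (γ t).2)⁻¹‖ ≤ |C₂| * C := fun t ht ↦ by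
    rw [norm_mul, Real.norm_eq_abs, norm_inv, Real.norm_of_nonneg (hβ0 _).le]
    exact mul_le_mul_of_nonneg_left (hVC t ht) (abs_nonneg _)
  have hCnn : 0 ≤ |C₂| * C := (norm_nonneg _).trans (hdt t₁ ⟨le_rfl, ht₁.2⟩)
  have hbdd : ∀ n, (γ (τ n)).1 ∈ Metric.closedBall (γ t₁).1 (|C₂| * C * (b - t₁)) := by
    intro n
    have := (convex_Ico t₁ b).norm_image_sub_le_of_norm_hasDerivWithin_le
      (f := fun t ↦ (γ t).1) (x := t₁) (y := τ n)
      (fun t ht ↦ (hC t ⟨ht₁.1.trans_le ht.1, ht.2⟩).1.hasDerivWithinAt) hdt ⟨le_rfl, ht₁.2⟩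
      ⟨(hτ n).1.le, (hτ n).2⟩
    rw [mem_closedBall_iff_norm]
    refine this.trans (mul_le_mul_of_nonneg_left ?_ hCnn)
    rw [Real.norm_of_nonneg (by linarith [(hτ n).1])]
    linarith [(hτ n).2]
  obtain ⟨s, -, φ, hφ, hs⟩ := tendsto_subseq_of_bounded Metric.isBounded_closedBall hbdd
  have hlim : Tendsto (fun n ↦ γ ((τ ∘ φ) n)) atTop (𝓝 (s, p)) :=
    Tendsto.prodMk_nhds hs (hp.comp hφ.tendsto_atTop)
  refine exists_accumulation_state (τ := τ ∘ φ) (p := (s, p)) (R := max (|C₂| * C) R)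
    (fun n ↦ hτab (φ n)) (hτb.comp hφ.tendsto_atTop) hlim ?_
  filter_upwards [hφ.tendsto_atTop.eventually hR] with n hn
  have hsrc : γ ((τ ∘ φ) n) ∈ (extChartAt (𝓘(ℝ, ℝ).prod J) (s, p)).source :=
    mem_source_prod.2 hn.1
  refine ⟨hsrc, ?_⟩
  set t := (τ ∘ φ) n with ht
  have htab : t ∈ Ioo a b := hτab (φ n)
  have e1 := (contDiffAt_chart_curve (hx t htab) hn.1).differentiableAt (by simp)
  have e2 : HasDerivAt (extChartAt (𝓘(ℝ, ℝ).prod J) (s, p) ∘ γ)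
      (C₂ * (β (γ t).2)⁻¹, deriv (extChartAt J p ∘ fun τ ↦ (γ τ).2) t) t := by
    refine ((hC t htab).1.prodMk e1.hasDerivAt).congr_of_eventuallyEq
      (Eventually.of_forall fun σ ↦ ?_)
    simp only [Function.comp_apply, extChartAt_prod_apply]
  rw [e2.deriv, Prod.norm_def]
  exact max_le_max (hdt t ⟨(hτ (φ n)).1.le, (hτ (φ n)).2⟩) hn.2

end Standard

section Lift

variable {E : Type*} [NormedAddCommGroup E] [NormedSpace ℝ E]

/-- Integral curves of lifted fields are mapped by the differential of `f` to integral curves of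
the lift of an `f`-related field. -/
lemma hasDerivAt_map_liftField {F : Type*} [NormedAddCommGroup F] [NormedSpace ℝ F] {f : E → F}
    {K : E → E} {K' : F → F} {ζ : ℝ → E × E} {t : ℝ} (hf : ContDiffAt ℝ 2 f (ζ t).1)
    (hK : DifferentiableAt ℝ K (ζ t).1) (hK' : DifferentiableAt ℝ K' (f (ζ t).1))
    (hrel : ∀ᶠ y in 𝓝 (ζ t).1, K' (f y) = fderiv ℝ f y (K y))
    (hζ : HasDerivAt ζ (liftField K (ζ t)) t) :
    HasDerivAt (fun u ↦ (f (ζ u).1, fderiv ℝ f (ζ u).1 (ζ u).2))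
      (liftField K' (f (ζ t).1, fderiv ℝ f (ζ t).1 (ζ t).2)) t := by
  have h1 : HasDerivAt (fun u ↦ (ζ u).1) (K (ζ t).1) t := hasDerivAt_fst_comp hζ
  have h2 : HasDerivAt (fun u ↦ (ζ u).2) (fderiv ℝ K (ζ t).1 (ζ t).2) t := hasDerivAt_snd_comp hζ
  have hfd := (hf.differentiableAt (by norm_num)).hasFDerivAt
  have hfd2 := ((hf.fderiv_right (m := 1) (by norm_num)).differentiableAt (by norm_num)).hasFDerivAt
  have h3 : HasDerivAt (fun u ↦ f (ζ u).1) (fderiv ℝ f (ζ t).1 (K (ζ t).1)) t :=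
    hfd.comp_hasDerivAt t h1
  have h3' : HasDerivAt (fun u ↦ fderiv ℝ f (ζ u).1)
      (fderiv ℝ (fderiv ℝ f) (ζ t).1 (K (ζ t).1)) t := hfd2.comp_hasDerivAt t h1
  have h4 := h3'.clm_apply h2
  have e1 : fderiv ℝ f (ζ t).1 (K (ζ t).1) = K' (f (ζ t).1) := hrel.self_of_nhds.symm
  have h5 : HasFDerivAt (fun y ↦ fderiv ℝ f y (K y)) _ (ζ t).1 := hfd2.clm_apply hK.hasFDerivAt
  have h6 : HasFDerivAt (fun y ↦ K' (f y)) ((fderiv ℝ K' (f (ζ t).1)).comp (fderiv ℝ f (ζ t).1))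
      (ζ t).1 := hK'.hasFDerivAt.comp (ζ t).1 hfd
  have h7 := DFunLike.congr_fun (h6.unique (h5.congr_of_eventuallyEq hrel)) (ζ t).2
  have hsym := hf.isSymmSndFDerivAt (by simp) (K (ζ t).1) (ζ t).2
  have e2 : fderiv ℝ (fderiv ℝ f) (ζ t).1 (K (ζ t).1) (ζ t).2 +
      fderiv ℝ f (ζ t).1 (fderiv ℝ K (ζ t).1 (ζ t).2) =
      fderiv ℝ K' (f (ζ t).1) (fderiv ℝ f (ζ t).1 (ζ t).2) := by
    simp only [ContinuousLinearMap.comp_apply, add_apply,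
      ContinuousLinearMap.flip_apply] at h7
    rw [h7, hsym, add_comm]
  rw [e1] at h3
  rw [e2] at h4
  exact h3.prodMk h4

variable {H : Type*} [TopologicalSpace H] {I : ModelWithCorners ℝ E H}
  {M : Type*} [TopologicalSpace M] [ChartedSpace H M]
  [FiniteDimensional ℝ E] [IsManifold I ∞ M] [I.Boundaryless] {g : MetricTensor I M}

lemma fderiv_chart_change_mfderiv {q q' x : M} (hq : x ∈ (extChartAt I q).source)
    (hq' : x ∈ (extChartAt I q').source) (v : TangentSpace I x) :
    fderiv ℝ (extChartAt I q' ∘ (extChartAt I q).symm) (extChartAt I q x)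
      (mfderiv I 𝓘(ℝ, E) (extChartAt I q) x v) = mfderiv I 𝓘(ℝ, E) (extChartAt I q') x v := by
  have e1 : (extChartAt I q).symm (extChartAt I q x) = x := (extChartAt I q).left_inv hq
  have h1 : (extChartAt I q' ∘ (extChartAt I q).symm) ∘ extChartAt I q =ᶠ[𝓝 x]
      extChartAt I q' := by
    filter_upwards [extChartAt_source_mem_nhds_of_mem hq] with z hz
    simp only [Function.comp_apply, (extChartAt I q).left_inv hz]
  have h2 : MDifferentiableAt 𝓘(ℝ, E) 𝓘(ℝ, E) (extChartAt I q' ∘ (extChartAt I q).symm)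
      (extChartAt I q x) := ((contDiffAt_chart_change ((extChartAt I q).map_source hq)
        (by rwa [e1])).differentiableAt (by simp)).mdifferentiableAt
  have h3 := mfderiv_comp x h2 (mdifferentiableAt_extChartAt' hq)
  rw [h1.mfderiv_eq, mfderiv_eq_fderiv] at h3
  exact (DFunLike.congr_fun h3 v).symm

lemma chartField_chart_change (K : ∀ x : M, TangentSpace I x) {q q' x : M}
    (hq : x ∈ (extChartAt I q).source) (hq' : x ∈ (extChartAt I q').source) :
    chartField K q' (extChartAt I q' x) =
      fderiv ℝ (extChartAt I q' ∘ (extChartAt I q).symm) (extChartAt I q x)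
        (chartField K q (extChartAt I q x)) := by
  rw [← mfderiv_extChartAt_field K hq, ← mfderiv_extChartAt_field K hq',
    fderiv_chart_change_mfderiv hq hq']

/-- A vector field along a curve, in the chart at `q`. -/
def chartLift (I : ModelWithCorners ℝ E H) (q : M) (x : ℝ → M) (J : ℝ → E) (t : ℝ) : E × E :=
  (extChartAt I q (x t), mfderiv I 𝓘(ℝ, E) (extChartAt I q) (x t) (J t))

/-- In the chart at `q`, the curve `x` is at time `t` tangent to `K`, and `J` is Lie transported
along it. -/
def LieTransportAt (K : ∀ x : M, TangentSpace I x) (q : M) (x : ℝ → M) (J : ℝ → E) (t : ℝ) : Prop :=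
  ContinuousAt x t ∧
    HasDerivAt (chartLift I q x J) (liftField (chartField K q) (chartLift I q x J t)) t

lemma LieTransportAt.congr {K : ∀ x : M, TangentSpace I x} {q : M} {x x' : ℝ → M} {J J' : ℝ → E}
    {t : ℝ} (hx : x =ᶠ[𝓝 t] x') (hJ : J =ᶠ[𝓝 t] J') (h : LieTransportAt K q x J t) :
    LieTransportAt K q x' J' t := by
  have h1 : chartLift I q x J =ᶠ[𝓝 t] chartLift I q x' J' := by
    filter_upwards [hx, hJ] with u h1 h2
    rw [chartLift, chartLift, h1, h2]
  refine ⟨h.1.congr hx, ?_⟩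
  rw [← h1.eq_of_nhds]
  exact h.2.congr_of_eventuallyEq h1.symm

lemma LieTransportAt.chart_change {K : ∀ x : M, TangentSpace I x}
    (hK : ContMDiff I I.tangent ∞ (fun x ↦ (⟨x, K x⟩ : TangentBundle I M))) {q q' : M} {x : ℝ → M}
    {J : ℝ → E} {t : ℝ} (h : LieTransportAt K q x J t) (hq : x t ∈ (extChartAt I q).source)
    (hq' : x t ∈ (extChartAt I q').source) : LieTransportAt K q' x J t := by
  refine ⟨h.1, ?_⟩
  set f := extChartAt I q' ∘ (extChartAt I q).symm with hf
  have hch : ∀ {y}, y ∈ (extChartAt I q).source → f (extChartAt I q y) = extChartAt I q' y :=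
    fun {y} hy ↦ by simp only [hf, Function.comp_apply, (extChartAt I q).left_inv hy]
  have key : ∀ u, x u ∈ (extChartAt I q).source → x u ∈ (extChartAt I q').source →
      (f (chartLift I q x J u).1, fderiv ℝ f (chartLift I q x J u).1 (chartLift I q x J u).2) =
        chartLift I q' x J u := fun u h1 h2 ↦
    Prod.ext (hch h1) (fderiv_chart_change_mfderiv h1 h2 (J u))
  have hyt := (extChartAt I q).map_source hq
  have e1 : (extChartAt I q).symm (extChartAt I q (x t)) = x t := (extChartAt I q).left_inv hq
  have hfy : f (chartLift I q x J t).1 = extChartAt I q' (x t) := hch hq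
  have h1 := hasDerivAt_map_liftField (f := f) (K := chartField K q) (K' := chartField K q')
    (ζ := chartLift I q x J) (t := t)
    ((contDiffAt_chart_change hyt (by rwa [e1])).of_le (WithTop.coe_le_coe.2 le_top))
    ((contDiffAt_chartField hK hyt).differentiableAt (by simp))
    (by
      rw [hfy]
      exact (contDiffAt_chartField hK ((extChartAt I q').map_source hq')).differentiableAt
        (by simp))
    (by
      have hc : ContinuousAt (extChartAt I q).symm (extChartAt I q (x t)) :=
        continuousAt_extChartAt_symm'' hyt
      filter_upwards [extChartAt_target_mem_nhds_of_mem hyt,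
        hc (by rw [e1]; exact extChartAt_source_mem_nhds_of_mem hq')] with y h1 h2
      have h3 := chartField_chart_change K ((extChartAt I q).map_target h1) h2
      rw [(extChartAt I q).right_inv h1] at h3
      exact h3)
    h.2
  rw [key t hq hq'] at h1
  refine h1.congr_of_eventuallyEq ?_
  filter_upwards [h.1 (extChartAt_source_mem_nhds_of_mem hq),
    h.1 (extChartAt_source_mem_nhds_of_mem hq')] with u h1 h2
  exact (key u h1 h2).symm

/-- Integral curves of vector fields in charts. -/
lemma hasMFDerivAt_iff_chart {K : ∀ x : M, TangentSpace I x} {q : M} {x : ℝ → M} {t : ℝ}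
    (hc : ContinuousAt x t) (hq : x t ∈ (extChartAt I q).source) :
    HasMFDerivAt 𝓘(ℝ, ℝ) I x t ((1 : ℝ →L[ℝ] ℝ).smulRight (K (x t))) ↔
      HasDerivAt (extChartAt I q ∘ x) (chartField K q (extChartAt I q (x t))) t := by
  constructor
  · intro h
    have h0 : MDifferentiableAt 𝓘(ℝ, ℝ) I x t := h.mdifferentiableAt
    have h1 : velocity I x t = K (x t) :=
      (DFunLike.congr_fun h.mfderiv (1 : ℝ)).trans (one_smul ℝ (K (x t)))
    have h2 := mfderiv_velocity h0 hq
    rw [h1, mfderiv_extChartAt_field K hq] at h2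
    rw [h2]
    exact (mdifferentiableAt_iff_differentiableAt.1
      (MDifferentiableAt.comp t (mdifferentiableAt_extChartAt' hq) h0)).hasDerivAt
  · intro h
    have hy := (extChartAt I q).map_source hq
    have h1 : MDifferentiableAt 𝓘(ℝ, ℝ) I ((extChartAt I q).symm ∘ (extChartAt I q ∘ x)) t :=
      MDifferentiableAt.comp t (mdifferentiableAt_extChartAt_symm hy)
        h.differentiableAt.mdifferentiableAt
    have h2 : (extChartAt I q).symm ∘ (extChartAt I q ∘ x) =ᶠ[𝓝 t] x := by
      filter_upwards [hc (extChartAt_source_mem_nhds_of_mem hq)] with u hu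
      exact (extChartAt I q).left_inv hu
    have h0 : MDifferentiableAt 𝓘(ℝ, ℝ) I x t := h1.congr_of_eventuallyEq h2.symm
    have h3 := mfderiv_velocity h0 hq
    rw [h.deriv, ← mfderiv_extChartAt_field K hq] at h3
    have h4 : mfderiv 𝓘(ℝ, ℝ) I x t (1 : ℝ) = K (x t) := eq_of_mfderiv_eq hq h3
    refine h0.hasMFDerivAt.congr_mfderiv ?_
    refine ContinuousLinearMap.ext_ring ?_
    exact h4.trans (one_smul ℝ (K (x t))).symm

lemma LieTransportAt.hasMFDerivAt {K : ∀ x : M, TangentSpace I x} {q : M} {x : ℝ → M} {J : ℝ → E}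
    {t : ℝ} (h : LieTransportAt K q x J t) (hq : x t ∈ (extChartAt I q).source) :
    HasMFDerivAt 𝓘(ℝ, ℝ) I x t ((1 : ℝ →L[ℝ] ℝ).smulRight (K (x t))) :=
  (hasMFDerivAt_iff_chart h.1 hq).2 (hasDerivAt_fst_comp h.2)

end Lift

section Transport

variable {E : Type*} [NormedAddCommGroup E] [NormedSpace ℝ E]
  {H : Type*} [TopologicalSpace H] {I : ModelWithCorners ℝ E H}
  {M : Type*} [TopologicalSpace M] [ChartedSpace H M]
  [FiniteDimensional ℝ E] [IsManifold I ∞ M] [I.Boundaryless] {g : MetricTensor I M}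

lemma mfderiv_mfderiv_symm_of_mem {q x : M} (hx : x ∈ (extChartAt I q).source) (w : E) :
    (mfderiv I 𝓘(ℝ, E) (extChartAt I q) x
      (mfderiv 𝓘(ℝ, E) I (extChartAt I q).symm (extChartAt I q x) w : E) : E) = w := by
  have h := mfderiv_mfderiv_symm ((extChartAt I q).map_source hx) w
  rw [(extChartAt I q).left_inv hx] at h
  exact h

/-- Local existence and uniqueness of Lie transport along an integral curve. -/
lemma exists_lieTransport_local {K : ∀ x : M, TangentSpace I x}
    (hK : ContMDiff I I.tangent ∞ (fun x ↦ (⟨x, K x⟩ : TangentBundle I M))) {x : ℝ → M}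
    {A : Set ℝ} (hA : IsOpen A) (hx : IsMIntegralCurveOn x K A) {t₁ : ℝ} (ht₁ : t₁ ∈ A) :
    ∃ δ > 0, (∀ t ∈ Ioo (t₁ - δ) (t₁ + δ), t ∈ A ∧ x t ∈ (extChartAt I (x t₁)).source) ∧
      (∀ t₂ ∈ Ioo (t₁ - δ) (t₁ + δ), ∀ v : E, ∃ J : ℝ → E, J t₂ = v ∧
        ∀ t ∈ Ioo (t₁ - δ) (t₁ + δ), LieTransportAt K (x t₁) x J t) ∧
      ∀ (c d t₂ : ℝ) (J J' : ℝ → E), Ioo c d ⊆ Ioo (t₁ - δ) (t₁ + δ) → t₂ ∈ Ioo c d →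
        (∀ t ∈ Ioo c d, LieTransportAt K (x t₁) x J t) →
        (∀ t ∈ Ioo c d, LieTransportAt K (x t₁) x J' t) → J t₂ = J' t₂ → EqOn J J' (Ioo c d) := by
  obtain ⟨q, hq⟩ : ∃ q, q = x t₁ := ⟨_, rfl⟩
  rw [← hq]
  have hxc : ∀ t ∈ A, ContinuousAt x t := fun t ht ↦
    (hx t ht).continuousWithinAt.continuousAt (hA.mem_nhds ht)
  have hq₁ : x t₁ ∈ (extChartAt I q).source := by rw [hq]; exact mem_extChartAt_source _
  set L : ℝ → E →L[ℝ] E := fun t ↦ fderiv ℝ (chartField K q) (extChartAt I q (x t)) with hL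
  have hφc : ∀ t ∈ A, x t ∈ (extChartAt I q).source →
      ContinuousAt (fun t ↦ extChartAt I q (x t)) t := fun t ht hs ↦
    ContinuousAt.comp (g := extChartAt I q) (continuousAt_extChartAt' (by simpa using hs))
      (hxc t ht)
  have hLc : ∀ t ∈ A, x t ∈ (extChartAt I q).source → ContinuousAt L t := fun t ht hs ↦ by
    have h1 := ((contDiffAt_chartField hK ((extChartAt I q).map_source hs)).fderiv_right
      (m := 0) (by simp)).continuousAt
    exact ContinuousAt.comp (g := fderiv ℝ (chartField K q)) h1 (hφc t ht hs)
  have hev : ∀ᶠ t in 𝓝 t₁, t ∈ A ∧ x t ∈ (extChartAt I q).source ∧ ‖L t‖ < ‖L t₁‖ + 1 := by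
    filter_upwards [hA.mem_nhds ht₁, hxc t₁ ht₁ (extChartAt_source_mem_nhds_of_mem hq₁),
      (hLc t₁ ht₁ hq₁).norm.eventually_lt_const (lt_add_one _)] with t h1 h2 h3
      using ⟨h1, h2, h3⟩
  obtain ⟨η, hη, hηs⟩ := Metric.eventually_nhds_iff_ball.1 hev
  set C := ‖L t₁‖ + 1 with hC
  have hC0 : 0 < C := by positivity
  obtain ⟨δ, hδ, hδη, hδC⟩ : ∃ δ > 0, 4 * δ ≤ η ∧ C * (2 * δ) ≤ 1 / 2 := by
    refine ⟨min (η / 4) (1 / (4 * C)), by positivity, ?_, ?_⟩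
    · linarith [min_le_left (η / 4) (1 / (4 * C))]
    · have h1 := min_le_right (η / 4) (1 / (4 * C))
      calc C * (2 * min (η / 4) (1 / (4 * C))) ≤ C * (2 * (1 / (4 * C))) := by gcongr
        _ = 1 / 2 := by field_simp; norm_num
  have hball : ∀ t, |t - t₁| < 4 * δ →
      t ∈ A ∧ x t ∈ (extChartAt I q).source ∧ ‖L t‖ < C := fun t ht ↦
    hηs t (by rw [Metric.mem_ball, Real.dist_eq]; linarith)
  have hball' : ∀ t ∈ Ioo (t₁ - δ) (t₁ + δ), t ∈ A ∧ x t ∈ (extChartAt I q).source ∧ ‖L t‖ < C :=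
    fun t ht ↦ hball t (by rw [abs_lt]; constructor <;> linarith [ht.1, ht.2])
  refine ⟨δ, hδ, fun t ht ↦ ⟨(hball' t ht).1, (hball' t ht).2.1⟩, fun t₂ ht₂ v ↦ ?_,
    fun c d t₂ J J' hcd ht₂ hJ hJ' he ↦ ?_⟩
  · have hwin : ∀ t ∈ Icc (t₂ - 2 * δ) (t₂ + 2 * δ), |t - t₁| < 4 * δ := fun t ht ↦ by
      rw [abs_lt]; constructor <;> linarith [ht.1, ht.2, ht₂.1, ht₂.2]
    obtain ⟨w, hw₂, hw⟩ := exists_linear_solution (A := L) (t₀ := t₂) (by linarith : 0 < 2 * δ)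
      hC0.le (fun t ht ↦ (hLc t (hball t (hwin t ht)).1
        (hball t (hwin t ht)).2.1).continuousWithinAt) (fun t ht ↦ (hball t (hwin t ht)).2.2.le)
      hδC (mfderiv I 𝓘(ℝ, E) (extChartAt I q) (x t₂) v)
    refine ⟨fun t ↦ mfderiv 𝓘(ℝ, E) I (extChartAt I q).symm (extChartAt I q (x t)) (w t), ?_,
      fun t ht ↦ ?_⟩
    · simp only [hw₂]
      exact mfderiv_symm_mfderiv (hball' t₂ ht₂).2.1 v
    · have hlift : ∀ u, x u ∈ (extChartAt I q).source → chartLift I q x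
          (fun t ↦ mfderiv 𝓘(ℝ, E) I (extChartAt I q).symm (extChartAt I q (x t)) (w t)) u =
            (extChartAt I q (x u), w u) := fun u hu ↦
        Prod.ext rfl (mfderiv_mfderiv_symm_of_mem hu (w u))
      obtain ⟨h1, h2, h3⟩ := hball' t ht
      refine ⟨hxc t h1, ?_⟩
      rw [hlift t h2]
      have h4 := (hasMFDerivAt_iff_chart (q := q) (hxc t h1) h2).1
        ((hx t h1).hasMFDerivAt (hA.mem_nhds h1))
      have h5 := h4.prodMk (hw t ⟨by linarith [ht.1, ht₂.2], by linarith [ht.2, ht₂.1]⟩)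
      refine HasDerivAt.congr_of_eventuallyEq (f := fun u ↦ (extChartAt I q (x u), w u)) h5 ?_
      filter_upwards [hxc t h1 (extChartAt_source_mem_nhds_of_mem h2)] with u hu
      exact hlift u hu
  · have key : ∀ J : ℝ → E, (∀ t ∈ Ioo c d, LieTransportAt K q x J t) → ∀ t ∈ Ioo c d,
        HasDerivAt (fun t ↦ (chartLift I q x J t).2) (L t (chartLift I q x J t).2) t :=
      fun J hJ t ht ↦ hasDerivAt_snd_comp (hJ t ht).2
    have h1 := linear_solution_unique (A := L) (C := C)
      (fun t ht ↦ (hball' t (hcd ht)).2.2.le) ht₂ (key J hJ) (key J' hJ')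
      (by simp only [chartLift, he]; rfl)
    intro t ht
    exact eq_of_mfderiv_eq (hball' t (hcd ht)).2.1 (h1 ht)

/-- Lie transport along an integral curve. -/
lemma exists_lieTransport {K : ∀ x : M, TangentSpace I x}
    (hK : ContMDiff I I.tangent ∞ (fun x ↦ (⟨x, K x⟩ : TangentBundle I M))) {x : ℝ → M}
    {A : Set ℝ} (hA : IsOpen A) (hAc : A.OrdConnected) (hx : IsMIntegralCurveOn x K A) {t₀ : ℝ}
    (ht₀ : t₀ ∈ A) (v : E) :
    ∃ J : ℝ → E, J t₀ = v ∧ ∀ t ∈ A, LieTransportAt K (x t) x J t := by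
  have hloc : ∀ (J J' : ℝ → E) (t : ℝ), J =ᶠ[𝓝 t] J' →
      (∀ᶠ u in 𝓝 t, LieTransportAt K (x u) x J u) →
      ∀ᶠ u in 𝓝 t, LieTransportAt K (x u) x J' u := fun J J' t h h' ↦ by
    filter_upwards [h.eventually_nhds, h'] with u h1 h2 using h2.congr .rfl h1
  have hnear : ∀ {t₁ δ : ℝ} {J : ℝ → E}, 0 < δ →
      (∀ t ∈ Ioo (t₁ - δ) (t₁ + δ), t ∈ A ∧ x t ∈ (extChartAt I (x t₁)).source) →
      (∀ t ∈ Ioo (t₁ - δ) (t₁ + δ), LieTransportAt K (x t₁) x J t) →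
      ∀ t ∈ Ioo (t₁ - δ) (t₁ + δ), LieTransportAt K (x t) x J t := fun hδ h1 h2 t ht ↦
    (h2 t ht).chart_change hK (h1 t ht).2 (mem_extChartAt_source _)
  obtain ⟨δ, hδ, hs, hex, -⟩ := exists_lieTransport_local hK hA hx ht₀
  obtain ⟨J₀, hJ₀, hJ₀t⟩ := hex t₀ ⟨by linarith, by linarith⟩ v
  have hP₀ := hnear hδ hs hJ₀t
  obtain ⟨J, hJ, hJt⟩ := exists_extension (A := A) (s := Ioo (t₀ - δ) (t₀ + δ)) (f := J₀)
    hloc hAc hA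
    (fun f a b hab hb hAab hf ↦ by
      obtain ⟨δ, hδ, hs, hex, huniq⟩ := exists_lieTransport_local hK hA hx hb
      obtain ⟨c, hc1, hc2⟩ : ∃ c, max a (b - δ) < c ∧ c < b :=
        exists_between (max_lt hab (by linarith))
      rw [max_lt_iff] at hc1
      obtain ⟨J, hJ, hJt⟩ := hex c ⟨hc1.2, by linarith⟩ (f c)
      have hsub : Ioo (max a (b - δ)) b ⊆ Ioo (b - δ) (b + δ) := fun t ht ↦
        ⟨(max_lt_iff.1 ht.1).2, by linarith [ht.2]⟩
      have heq := huniq (max a (b - δ)) b c J f hsub ⟨max_lt_iff.2 hc1, hc2⟩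
        (fun t ht ↦ hJt t (hsub ht))
        (fun t ht ↦ (hf t ⟨(max_lt_iff.1 ht.1).1, ht.2⟩).self_of_nhds.chart_change hK
          (mem_extChartAt_source _) (hs t (hsub ht)).2) hJ
      refine ⟨J, ?_, ?_⟩
      · filter_upwards [Ioo_mem_nhdsLT (max_lt hab (by linarith : b - δ < b))] with t ht
          using heq ht
      · filter_upwards [Ioo_mem_nhds (by linarith : b - δ < b) (by linarith : b < b + δ)]
          with t ht using hnear hδ hs hJt t ht)
    (fun f a b hab ha hAab hf ↦ by
      obtain ⟨δ, hδ, hs, hex, huniq⟩ := exists_lieTransport_local hK hA hx ha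
      obtain ⟨c, hc2, hc1⟩ : ∃ c, a < c ∧ c < min b (a + δ) :=
        exists_between (lt_min hab (by linarith))
      rw [lt_min_iff] at hc1
      obtain ⟨J, hJ, hJt⟩ := hex c ⟨by linarith, hc1.2⟩ (f c)
      have hsub : Ioo a (min b (a + δ)) ⊆ Ioo (a - δ) (a + δ) := fun t ht ↦
        ⟨by linarith [ht.1], (lt_min_iff.1 ht.2).2⟩
      have heq := huniq a (min b (a + δ)) c J f hsub ⟨hc2, lt_min_iff.2 hc1⟩
        (fun t ht ↦ hJt t (hsub ht))
        (fun t ht ↦ (hf t ⟨ht.1, (lt_min_iff.1 ht.2).1⟩).self_of_nhds.chart_change hK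
          (mem_extChartAt_source _) (hs t (hsub ht)).2) hJ
      refine ⟨J, ?_, ?_⟩
      · filter_upwards [Ioo_mem_nhdsGT (lt_min hab (by linarith : a < a + δ))] with t ht
          using heq ht
      · filter_upwards [Ioo_mem_nhds (by linarith : a - δ < a) (by linarith : a < a + δ)]
          with t ht using hnear hδ hs hJt t ht)
    (fun f t h ↦ h.eventually_nhds.mono fun u hu _ ↦ hu)
    isOpen_Ioo ordConnected_Ioo (fun t ht ↦ (hs t ht).1) ⟨t₀, by linarith, by linarith⟩
    (fun t ht ↦ by
      filter_upwards [isOpen_Ioo.mem_nhds ht] with u hu using hP₀ u hu)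
  exact ⟨J, (hJ ⟨by linarith, by linarith⟩).trans hJ₀, fun t ht ↦ (hJt t ht).self_of_nhds⟩

end Transport

section CompleteField

variable {E : Type*} [NormedAddCommGroup E] [NormedSpace ℝ E]
  {H : Type*} [TopologicalSpace H] {I : ModelWithCorners ℝ E H}
  {M : Type*} [TopologicalSpace M] [ChartedSpace H M]
  [FiniteDimensional ℝ E] [IsManifold I ∞ M] [I.Boundaryless] {g : MetricTensor I M}

lemma IsGeodesicOn.mdifferentiableAt {γ : ℝ → M} {U : Set ℝ} (hγ : IsGeodesicOn g γ U) {t : ℝ}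
    (ht : t ∈ U) : MDifferentiableAt 𝓘(ℝ, ℝ) I γ t :=
  (hγ t ht).1.mdifferentiableAt (by norm_num)

lemma chartLift_velocity {σ : ℝ → ℝ → M} {q : M} {t s : ℝ}
    (hσ : MDifferentiableAt 𝓘(ℝ, ℝ) I (σ t) s) (hq : σ t s ∈ (extChartAt I q).source) :
    chartLift I q (fun t ↦ σ t s) (fun t ↦ velocity I (σ t) s) t = chartState I q (σ t) s :=
  Prod.ext rfl (mfderiv_velocity hσ hq)

/-- A one-parameter family of geodesics that moves infinitesimally by a Killing field at one
parameter does so at nearby parameters. -/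
lemma lieTransportAt_velocity_near [T2Space M] (hg : IsPseudoRiemannian g) (hgs : g.IsSmooth)
    {K : ∀ x : M, TangentSpace I x}
    (hKs : ContMDiff I I.tangent ∞ (fun x ↦ (⟨x, K x⟩ : TangentBundle I M))) (hK : IsKilling g K)
    {σ : ℝ → ℝ → M} (hσ : ∀ t, IsGeodesicOn g (σ t) univ) (t₁ s₁ : ℝ) :
    ∀ᶠ s₂ in 𝓝 s₁, ∀ᶠ s in 𝓝 s₁,
      LieTransportAt K (σ t₁ s₂) (fun t ↦ σ t s₂) (fun t ↦ velocity I (σ t) s₂) t₁ →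
      LieTransportAt K (σ t₁ s) (fun t ↦ σ t s) (fun t ↦ velocity I (σ t) s) t₁ := by
  obtain ⟨q, hq⟩ : ∃ q, σ t₁ s₁ ∈ (extChartAt I q).source := ⟨_, mem_extChartAt_source _⟩
  have hy₀ := (extChartAt I q).map_source hq
  have hmd : ∀ t s, MDifferentiableAt 𝓘(ℝ, ℝ) I (σ t) s := fun t s ↦
    (hσ t).mdifferentiableAt (mem_univ s)
  have hcd := fun t s (h : σ t s ∈ (extChartAt I q).source) ↦
    ((hσ t).geodesicAt hg (mem_univ s) h).hasDerivAt hg h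
  obtain ⟨z₀, hz₀⟩ : ∃ z₀, z₀ = chartState I q (σ t₁) s₁ := ⟨_, rfl⟩
  have hz₀t : z₀.1 ∈ (extChartAt I q).target := by rw [hz₀]; exact hy₀
  have hX : ContDiffAt ℝ ∞ (liftField (chartField K q)) z₀ :=
    contDiffAt_liftField (contDiffAt_chartField hKs hz₀t) z₀.2
  have hY := contDiffAt_geodesicField_chartForm hg hz₀t
  have htn : ∀ᶠ z : E × E in 𝓝 z₀, z.1 ∈ (extChartAt I q).target :=
    continuousAt_fst (extChartAt_target_mem_nhds_of_mem hz₀t)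
  have hcomm : ∀ᶠ z in 𝓝 z₀, fderiv ℝ (liftField (chartField K q)) z
      (geodesicField (chartForm g q) z) = fderiv ℝ (geodesicField (chartForm g q)) z
        (liftField (chartField K q) z) := by
    filter_upwards [htn] with z hz
    have hnear := extChartAt_target_mem_nhds_of_mem hz
    exact commute_liftField_geodesicField (hg.smooth q z.1 hz) (contDiffAt_chartField hKs hz)
      (by filter_upwards [hnear] with y hy using killingAt_chartField hgs hKs hK hy)
      (Eventually.of_forall fun y v w ↦ chartForm_symm hg.symm q y v w)
      (by filter_upwards [hnear] with y hy using chartForm_nondegenerate hg hy) z.2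
  obtain ⟨R, hR, hflow⟩ := commuting_flow (hX.of_le (WithTop.coe_le_coe.2 le_top))
    (hY.of_le (WithTop.coe_le_coe.2 le_top)) hcomm
  obtain ⟨r, hr, δ, hδ, hgeo⟩ := exists_geodesic hg hz₀t hR
  have hev : ∀ᶠ s in 𝓝 s₁, σ t₁ s ∈ (extChartAt I q).source ∧
      chartState I q (σ t₁) s ∈ Metric.ball z₀ r ∧ s ∈ Ioo (s₁ - δ / 2) (s₁ + δ / 2) := by
    have h1 := (hcd t₁ s₁ hq).continuousAt
    filter_upwards [(hmd t₁ s₁).continuousAt (extChartAt_source_mem_nhds_of_mem hq),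
      h1 (by rw [← hz₀]; exact Metric.ball_mem_nhds z₀ hr),
      Ioo_mem_nhds (sub_lt_self s₁ (half_pos hδ)) (lt_add_of_pos_right s₁ (half_pos hδ))]
      with s h1 h2 h3 using ⟨h1, h2, h3⟩
  filter_upwards [hev] with s₂ hs₂
  filter_upwards [hev] with s hs
  intro hL
  have hL' := hL.chart_change hKs (mem_extChartAt_source _) hs₂.1
  have hev2 : ∀ᶠ t in 𝓝 t₁, ∀ s' ∈ Ioo (s₂ - δ) (s₂ + δ), σ t s' ∈ (extChartAt I q).source ∧
      chartState I q (σ t) s' ∈ Metric.ball z₀ R := by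
    have h1 := hL'.2.continuousAt
    rw [ContinuousAt, chartLift_velocity (hmd t₁ s₂) hs₂.1] at h1
    filter_upwards [hL'.1 (extChartAt_source_mem_nhds_of_mem hs₂.1),
      h1 (Metric.isOpen_ball.mem_nhds hs₂.2.1)] with t h2 h3
    have h3' : chartState I q (σ t) s₂ ∈ Metric.ball z₀ r := by
      rw [← chartLift_velocity (hmd t s₂) h2]; exact h3
    obtain ⟨γ, hγ, hγ₂, hγs⟩ := hgeo _ h3' s₂
    have hmem : s₂ ∈ Ioo (s₂ - δ) (s₂ + δ) := ⟨by linarith, by linarith⟩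
    have hsub := ((hσ t).mono (subset_univ (Ioo (s₂ - δ) (s₂ + δ))))
    have heq := hsub.eqOn hg isOpen_Ioo ordConnected_Ioo hγ hmem
      (hsub.eventuallyEq hg isOpen_Ioo hγ hmem h2 (hγs s₂ hmem).1 hγ₂.symm)
    intro s' hs'
    have : σ t =ᶠ[𝓝 s'] γ := heq.eventuallyEq_of_mem (isOpen_Ioo.mem_nhds hs')
    rw [chartState_congr this, heq hs']
    exact hγs s' hs'
  have hsub : uIcc s₂ s ⊆ Ioo (s₂ - δ) (s₂ + δ) := by
    refine ordConnected_Ioo.uIcc_subset ⟨by linarith, by linarith⟩ ⟨?_, ?_⟩ <;>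
    linarith [hs.2.2.1, hs.2.2.2, hs₂.2.2.1, hs₂.2.2.2]
  have hchart : ∀ {s'}, s' ∈ Ioo (s₂ - δ) (s₂ + δ) →
      chartLift I q (fun t ↦ σ t s') (fun t ↦ velocity I (σ t) s') =ᶠ[𝓝 t₁]
        fun t ↦ chartState I q (σ t) s' := fun {s'} hs' ↦ by
    filter_upwards [hev2] with t ht
    exact chartLift_velocity (hmd t s') (ht s' hs').1
  have hs₂m : s₂ ∈ Ioo (s₂ - δ) (s₂ + δ) := hsub left_mem_uIcc
  have hsm : s ∈ Ioo (s₂ - δ) (s₂ + δ) := hsub right_mem_uIcc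
  have hd := hflow (fun t s ↦ chartState I q (σ t) s) t₁ s₂ s
    (by
      filter_upwards [hev2] with t ht s' hs'
      exact ⟨hcd t s' (ht s' (hsub hs')).1, (ht s' (hsub hs')).2⟩)
    (by
      have h1 := hL'.2.congr_of_eventuallyEq (hchart hs₂m).symm
      rwa [(hchart hs₂m).eq_of_nhds] at h1)
  have hfin : LieTransportAt K q (fun t ↦ σ t s) (fun t ↦ velocity I (σ t) s) t₁ := by
    refine ⟨?_, ?_⟩
    · have h1 : ContinuousAt (fun t ↦ extChartAt I q (σ t s)) t₁ :=
        (hasDerivAt_fst_comp hd).continuousAt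
      have h2 : ContinuousAt (fun t ↦ (extChartAt I q).symm (extChartAt I q (σ t s))) t₁ :=
        ContinuousAt.comp (g := (extChartAt I q).symm)
          (continuousAt_extChartAt_symm'' ((extChartAt I q).map_source hs.1)) h1
      refine h2.congr ?_
      filter_upwards [hev2] with t ht
      exact (extChartAt I q).left_inv (ht s hsm).1
    · rw [(hchart hsm).eq_of_nhds]
      exact hd.congr_of_eventuallyEq (hchart hsm)
  exact hfin.chart_change hKs hs.1 (mem_extChartAt_source _)

lemma lieTransportAt_velocity [T2Space M] (hg : IsPseudoRiemannian g) (hgs : g.IsSmooth)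
    {K : ∀ x : M, TangentSpace I x}
    (hKs : ContMDiff I I.tangent ∞ (fun x ↦ (⟨x, K x⟩ : TangentBundle I M))) (hK : IsKilling g K)
    {σ : ℝ → ℝ → M} (hσ : ∀ t, IsGeodesicOn g (σ t) univ) {t₁ s₁ : ℝ}
    (h : LieTransportAt K (σ t₁ s₁) (fun t ↦ σ t s₁) (fun t ↦ velocity I (σ t) s₁) t₁) (s : ℝ) :
    LieTransportAt K (σ t₁ s) (fun t ↦ σ t s) (fun t ↦ velocity I (σ t) s) t₁ := by
  set T := {s | LieTransportAt K (σ t₁ s) (fun t ↦ σ t s) (fun t ↦ velocity I (σ t) s) t₁} with hT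
  have hnear := lieTransportAt_velocity_near hg hgs hKs hK hσ t₁
  have ho : IsOpen T := isOpen_iff_mem_nhds.2 fun s hs ↦
    (hnear s).self_of_nhds.mono fun u hu ↦ hu hs
  have hc : IsClosed T := isClosed_iff_frequently.2 fun s hs ↦ by
    obtain ⟨u, hu, hu'⟩ := (hs.and_eventually (hnear s)).exists
    exact hu'.self_of_nhds hu
  have : T = univ := IsClopen.eq_univ ⟨hc, ho⟩ ⟨s₁, h⟩
  exact this.symm.subset (mem_univ s)

/-- Local existence of geodesics with given position and velocity. -/
lemma exists_geodesic_velocity (hg : IsPseudoRiemannian g) (p : M) (v : E) (s₁ : ℝ) :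
    ∃ δ > 0, ∃ γ : ℝ → M, IsGeodesicOn g γ (Ioo (s₁ - δ) (s₁ + δ)) ∧ γ s₁ = p ∧
      (velocity I γ s₁ : E) = v := by
  have hp := mem_extChartAt_source (I := I) p
  obtain ⟨r, hr, δ, hδ, h⟩ := exists_geodesic hg (q := p)
    (z₀ := (extChartAt I p p, mfderiv I 𝓘(ℝ, E) (extChartAt I p) p v)) (mem_extChartAt_target p)
    one_pos
  obtain ⟨γ, hγ, hγ₁, hγs⟩ := h _ (Metric.mem_ball_self hr) s₁
  have hmem : s₁ ∈ Ioo (s₁ - δ) (s₁ + δ) := ⟨by linarith, by linarith⟩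
  have hsrc := (hγs s₁ hmem).1
  have h1 : γ s₁ = p := (extChartAt I p).injOn hsrc hp (congrArg Prod.fst hγ₁)
  refine ⟨δ, hδ, γ, hγ, h1, ?_⟩
  have h2 := (mfderiv_velocity (hγ.mdifferentiableAt hmem) hsrc).trans (congrArg Prod.snd hγ₁)
  clear hγ₁ hγs h
  subst h1
  exact eq_of_mfderiv_eq hsrc h2

lemma velocity_congr {γ₁ γ₂ : ℝ → M} {t : ℝ} (h : γ₁ =ᶠ[𝓝 t] γ₂) :
    (velocity I γ₁ t : E) = velocity I γ₂ t :=
  DFunLike.congr_fun (h.mfderiv_eq (I := 𝓘(ℝ, ℝ)) (I' := I)) (1 : ℝ)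

/-- Geodesics are determined near a point by position and velocity. -/
lemma IsGeodesicOn.eventuallyEq_of_velocity (hg : IsPseudoRiemannian g) {γ₁ γ₂ : ℝ → M}
    {U : Set ℝ} (hU : IsOpen U) (h₁ : IsGeodesicOn g γ₁ U) (h₂ : IsGeodesicOn g γ₂ U) {t : ℝ}
    (ht : t ∈ U) (h : γ₁ t = γ₂ t) (hv : (velocity I γ₁ t : E) = velocity I γ₂ t) :
    γ₁ =ᶠ[𝓝 t] γ₂ := by
  have hs2 := mem_extChartAt_source (I := I) (γ₂ t)
  have hs1 : γ₁ t ∈ (extChartAt I (γ₂ t)).source := by rw [h]; exact hs2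
  refine h₁.eventuallyEq hg hU h₂ ht hs1 hs2 (Prod.ext (congrArg (extChartAt I (γ₂ t)) h) ?_)
  have e1 := mfderiv_velocity (h₁.mdifferentiableAt ht) hs1
  have e2 := mfderiv_velocity (h₂.mdifferentiableAt ht) hs2
  refine e1.symm.trans (Eq.trans ?_ e2)
  exact congrArg₂ (fun (p : M) (v : E) ↦ (mfderiv I 𝓘(ℝ, E) (extChartAt I (γ₂ t)) p v : E)) h hv

lemma GeodesicallyComplete.exists_geodesic (hc : GeodesicallyComplete g)
    (hg : IsPseudoRiemannian g) (p : M) (v : E) (s₁ : ℝ) :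
    ∃ σ : ℝ → M, IsGeodesicOn g σ univ ∧ σ s₁ = p ∧ (velocity I σ s₁ : E) = v := by
  obtain ⟨δ, hδ, γ, hγ, hγ₁, hγv⟩ := exists_geodesic_velocity hg p v s₁
  have hmem : s₁ ∈ Ioo (s₁ - δ) (s₁ + δ) := ⟨by linarith, by linarith⟩
  obtain ⟨σ, hσ, hσγ⟩ := hc _ γ isOpen_Ioo ordConnected_Ioo hγ
  have hev : σ =ᶠ[𝓝 s₁] γ := hσγ.eventuallyEq_of_mem (isOpen_Ioo.mem_nhds hmem)
  exact ⟨σ, hσ, hev.eq_of_nhds.trans hγ₁, (velocity_congr hev).trans hγv⟩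

/-- If `g` is complete, the domain of the integral curves of a Killing field is constant along
geodesics. -/
lemma exists_integralCurve_along [T2Space M] (hc : GeodesicallyComplete g)
    (hg : IsPseudoRiemannian g) (hgs : g.IsSmooth) {K : ∀ x : M, TangentSpace I x}
    (hKs : ContMDiff I I.tangent ∞ (fun x ↦ (⟨x, K x⟩ : TangentBundle I M))) (hK : IsKilling g K)
    {γ : ℝ → M} (hγ : IsGeodesicOn g γ univ) {ε s₁ : ℝ} (s₂ : ℝ) (hε : 0 < ε)
    (h : ∃ x : ℝ → M, x 0 = γ s₁ ∧ IsMIntegralCurveOn x K (Ioo (-ε) ε)) :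
    ∃ x : ℝ → M, x 0 = γ s₂ ∧ IsMIntegralCurveOn x K (Ioo (-ε) ε) := by
  obtain ⟨x, hx0, hx⟩ := h
  have h0 : (0 : ℝ) ∈ Ioo (-ε) ε := ⟨by linarith, hε⟩
  obtain ⟨J, hJ0, hJ⟩ := exists_lieTransport hKs isOpen_Ioo ordConnected_Ioo hx h0
    (velocity I γ s₁ : E)
  choose σ hσ hσx hσJ using fun t ↦ hc.exists_geodesic hg (x t) (J t) s₁
  have key : ∀ t ∈ Ioo (-ε) ε, ∀ s,
      LieTransportAt K (σ t s) (fun t ↦ σ t s) (fun t ↦ velocity I (σ t) s) t := by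
    intro t ht s
    refine lieTransportAt_velocity hg hgs hKs hK hσ (s₁ := s₁) ?_ s
    rw [hσx t]
    exact (hJ t ht).congr (Eventually.of_forall fun u ↦ (hσx u).symm)
      (Eventually.of_forall fun u ↦ (hσJ u).symm)
  refine ⟨fun t ↦ σ t s₂, ?_, fun t ht ↦
    ((key t ht s₂).hasMFDerivAt (mem_extChartAt_source _)).hasMFDerivWithinAt⟩
  have e1 : σ 0 s₁ = γ s₁ := (hσx 0).trans hx0
  have e2 : (velocity I (σ 0) s₁ : E) = velocity I γ s₁ := (hσJ 0).trans hJ0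
  exact (hσ 0).eqOn hg isOpen_univ ordConnected_univ hγ (mem_univ s₁)
    ((hσ 0).eventuallyEq_of_velocity hg isOpen_univ hγ (mem_univ s₁) e1 e2) (mem_univ s₂)

/-- In a complete manifold, nearby points are joined by complete geodesics. -/
lemma GeodesicallyComplete.eventually_exists_geodesic (hc : GeodesicallyComplete g)
    (hg : IsPseudoRiemannian g) (p : M) :
    ∀ᶠ p' in 𝓝 p, ∃ (γ : ℝ → M) (h : ℝ), IsGeodesicOn g γ univ ∧ γ 0 = p ∧ γ h = p' := by
  have hp := mem_extChartAt_source (I := I) p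
  have hpt := mem_extChartAt_target (I := I) p
  obtain ⟨R, hR, hsub⟩ := Metric.isOpen_iff.1
    ((isOpen_extChartAt_target (I := I) p).preimage (continuous_fst (Y := E)))
    (extChartAt I p p, (0 : E)) hpt
  have hY := contDiffAt_geodesicField_chartForm hg (z := (extChartAt I p p, (0 : E))) hpt
  obtain ⟨h, hh, δ, hδ, hev⟩ := exists_solution_through
    (S := fun z ↦ spray (chartForm g p) z.1 z.2) (y₀ := extChartAt I p p)
    ((contDiff_snd.contDiffAt.comp _ hY).of_le (by simp)) 
    ((geoRes_eq_zero_iff (chartForm_nondegenerate hg hpt) 0 0).1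
      (by simp [geoRes, christ])).symm hR
  have hcont : ContinuousAt (extChartAt I p) p := continuousAt_extChartAt p
  filter_upwards [hcont.eventually hev, extChartAt_source_mem_nhds (I := I) p] with p' hp' hps
  obtain ⟨α, hα0, hαh, hα⟩ := hp'
  obtain ⟨h1, -⟩ := isGeodesicOn_of_hasDerivAt hg (q := p) isOpen_Ioo (fun t ht ↦ (hα t ht).1)
    (fun t ht ↦ hsub (hα t ht).2)
  obtain ⟨γ, hγ, hγe⟩ := hc _ _ isOpen_Ioo ordConnected_Ioo h1
  refine ⟨γ, h, hγ, ?_, ?_⟩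
  · rw [hγe ⟨by linarith, by linarith⟩]
    simp only [hα0, (extChartAt I p).left_inv hp]
  · rw [hγe ⟨by linarith, by linarith⟩]
    simp only [hαh, (extChartAt I p).left_inv hps]

/-- A Killing field of a complete metric is complete. -/
theorem GeodesicallyComplete.completeField [T2Space M] [ConnectedSpace M]
    (hc : GeodesicallyComplete g)
    (hg : IsPseudoRiemannian g) (hgs : g.IsSmooth) {K : ∀ x : M, TangentSpace I x}
    (hKs : ContMDiff I I.tangent ∞ (fun x ↦ (⟨x, K x⟩ : TangentBundle I M))) (hK : IsKilling g K) :
    CompleteField K := by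
  have hK1 : ContMDiff I I.tangent 1 (fun x ↦ (⟨x, K x⟩ : TangentBundle I M)) :=
    hKs.of_le (by simp)
  obtain ⟨p₀⟩ : Nonempty M := inferInstance
  obtain ⟨x, hx0, hx⟩ := exists_isMIntegralCurveAt_of_contMDiffAt_boundaryless (t₀ := 0) (hK1 p₀)
  obtain ⟨ε, hε, hx⟩ := isMIntegralCurveAt_iff'.1 hx
  rw [Real.ball_eq_Ioo, zero_sub, zero_add] at hx
  set D := {p : M | ∃ x : ℝ → M, x 0 = p ∧ IsMIntegralCurveOn x K (Ioo (-ε) ε)} with hD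
  have hnear := fun p ↦ hc.eventually_exists_geodesic hg p
  have ho : IsOpen D := isOpen_iff_mem_nhds.2 fun p hp ↦ by
    filter_upwards [hnear p] with p' hp'
    obtain ⟨γ, h, hγ, rfl, rfl⟩ := hp'
    exact exists_integralCurve_along hc hg hgs hKs hK hγ h hε hp
  have hcl : IsClosed D := isClosed_iff_frequently.2 fun p hp ↦ by
    obtain ⟨p', hp', γ, h, hγ, rfl, rfl⟩ := (hp.and_eventually (hnear p)).exists
    exact exists_integralCurve_along hc hg hgs hKs hK hγ 0 hε hp'
  have huniv : D = univ := IsClopen.eq_univ ⟨hcl, ho⟩ ⟨p₀, x, hx0, hx⟩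
  exact exists_isMIntegralCurve_of_isMIntegralCurveOn hK1 hε fun p ↦ huniv.symm.subset (mem_univ p)

end CompleteField

section Plaque

variable {E : Type*} [NormedAddCommGroup E] [NormedSpace ℝ E] [FiniteDimensional ℝ E]

/-- A nonzero linear form is a coordinate. -/
lemma exists_linearEquiv_snd_eq {m : ℕ} (θ : E →L[ℝ] ℝ) (hθ : θ ≠ 0)
    (hm : Module.finrank ℝ E = m + 1) :
    ∃ A : E ≃L[ℝ] EuclideanSpace ℝ (Fin m) × ℝ, ∀ y, (A y).2 = θ y := by
  obtain ⟨k, hk⟩ : ∃ k, θ k ≠ 0 := by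
    by_contra! h
    exact hθ (ContinuousLinearMap.ext h)
  have hker : Module.finrank ℝ (LinearMap.ker θ.toLinearMap) =
      Module.finrank ℝ (EuclideanSpace ℝ (Fin m)) := by
    have h1 := LinearMap.finrank_range_add_finrank_ker θ.toLinearMap
    have h2 : LinearMap.range θ.toLinearMap = ⊤ :=
      LinearMap.range_eq_top.2 (LinearMap.surjective fun h ↦ hk (DFunLike.congr_fun h k))
    rw [h2, finrank_top, Module.finrank_self] at h1
    rw [finrank_euclideanSpace_fin]
    omega
  let e := LinearEquiv.ofFinrankEq _ _ hker
  let Q : E →ₗ[ℝ] LinearMap.ker θ.toLinearMap :=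
    LinearMap.codRestrict _ (LinearMap.id - ((θ k)⁻¹ • θ.toLinearMap).smulRight k) fun y ↦ by
      have h : θ y - (θ k)⁻¹ * θ y * θ k = 0 := by field_simp; ring
      simpa using h
  let F : E →ₗ[ℝ] EuclideanSpace ℝ (Fin m) × ℝ := (e.toLinearMap ∘ₗ Q).prod θ.toLinearMap
  have hinj : Function.Injective F := by
    rw [← LinearMap.ker_eq_bot, LinearMap.ker_eq_bot']
    intro y hy
    have h1 : θ y = 0 := congrArg Prod.snd hy
    have h2 : e (Q y) = 0 := congrArg Prod.fst hy
    have h3 : Q y = 0 := e.map_eq_zero_iff.1 h2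
    have h4 : (Q y : E) = 0 := congrArg Subtype.val h3
    simpa [Q, h1] using h4
  have hfin : Module.finrank ℝ E = Module.finrank ℝ (EuclideanSpace ℝ (Fin m) × ℝ) := by
    rw [Module.finrank_prod, finrank_euclideanSpace_fin, Module.finrank_self, hm]
  refine ⟨(LinearMap.linearEquivOfInjective F hinj hfin).toContinuousLinearEquiv, fun y ↦ ?_⟩
  rfl

/-- The level set through `y₀` of a primitive of a closed form, as a parametrized
hypersurface. -/
lemma exists_plaque {m : ℕ} {θ : E → E →L[ℝ] ℝ} {U : Set E} (hU : IsOpen U) {y₀ : E}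
    (hy₀ : y₀ ∈ U) (hθ : ∀ y ∈ U, ContDiffAt ℝ ∞ θ y)
    (hsym : ∀ y ∈ U, ∀ u w, fderiv ℝ θ y u w = fderiv ℝ θ y w u) (hne : θ y₀ ≠ 0)
    (hm : Module.finrank ℝ E = m + 1) :
    ∃ (G : EuclideanSpace ℝ (Fin m) → E) (ρ : ℝ), 0 < ρ ∧
      (∀ u ∈ Metric.ball 0 ρ, ContDiffAt ℝ ∞ G u ∧ G u ∈ U ∧
        Function.Injective (fderiv ℝ G u) ∧ range (fderiv ℝ G u) = {v | θ (G u) v = 0}) ∧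
      InjOn G (Metric.ball 0 ρ) ∧
      ∀ (c : ℝ → E) (t₁ : ℝ), c t₁ = y₀ →
        (∀ᶠ t in 𝓝 t₁, DifferentiableAt ℝ c t ∧ θ (c t) (deriv c t) = 0) →
        ∀ᶠ t in 𝓝 t₁, c t ∈ G '' Metric.ball 0 ρ := by
  obtain ⟨r, hr, hrU⟩ := Metric.isOpen_iff.1 hU y₀ hy₀
  obtain ⟨τ, hτ⟩ := (convex_ball y₀ r).exists_forall_hasFDerivAt_of_fderiv_symmetric
    Metric.isOpen_ball
    (fun y hy ↦ ((hθ y (hrU hy)).differentiableAt (by simp)).differentiableWithinAt)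
    (fun y hy ↦ hsym y (hrU hy))
  have hτs : ContDiffOn ℝ ∞ τ (Metric.ball y₀ r) := by
    rw [contDiffOn_infty_iff_fderiv_of_isOpen Metric.isOpen_ball]
    exact ⟨fun y hy ↦ (hτ y hy).differentiableAt.differentiableWithinAt,
      ContDiffOn.congr (fun y hy ↦ (hθ y (hrU hy)).contDiffWithinAt) fun y hy ↦ (hτ y hy).fderiv⟩
  have hyr := Metric.mem_ball_self (x := y₀) hr
  obtain ⟨A, hA⟩ := exists_linearEquiv_snd_eq (θ y₀) hne hm
  let P : E →L[ℝ] EuclideanSpace ℝ (Fin m) :=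
    (ContinuousLinearMap.fst ℝ (EuclideanSpace ℝ (Fin m)) ℝ).comp A.toContinuousLinearMap
  let Θ : E → EuclideanSpace ℝ (Fin m) × ℝ := fun y ↦ (P (y - y₀), τ y - τ y₀)
  let D : E → E →L[ℝ] EuclideanSpace ℝ (Fin m) × ℝ := fun y ↦ P.prod (θ y)
  have hΘd : ∀ y ∈ Metric.ball y₀ r, HasFDerivAt Θ (D y) y := fun y hy ↦
    (P.hasFDerivAt.comp y ((hasFDerivAt_id y).sub_const y₀)).prodMk ((hτ y hy).sub_const _)
  have hΘs : ∀ y ∈ Metric.ball y₀ r, ContDiffAt ℝ ∞ Θ y := fun y hy ↦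
    (P.contDiff.contDiffAt.comp y (contDiffAt_id.sub contDiffAt_const)).prodMk
      ((hτs.contDiffAt (Metric.isOpen_ball.mem_nhds hy)).sub contDiffAt_const)
  have hDA : D y₀ = (A : E →L[ℝ] EuclideanSpace ℝ (Fin m) × ℝ) :=
    ContinuousLinearMap.ext fun y ↦ Prod.ext rfl (hA y).symm
  have hΘA : HasFDerivAt Θ (A : E →L[ℝ] EuclideanSpace ℝ (Fin m) × ℝ) y₀ := hDA ▸ hΘd y₀ hyr
  let e := (hΘs y₀ hyr).toOpenPartialHomeomorph Θ hΘA (by simp)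
  have he : ∀ y, e y = Θ y := fun y ↦ rfl
  have hes : y₀ ∈ e.source := (hΘs y₀ hyr).mem_toOpenPartialHomeomorph_source hΘA (by simp)
  have he₀ : e y₀ = (0, 0) := by simp [he, Θ]
  have het : ((0 : EuclideanSpace ℝ (Fin m)), (0 : ℝ)) ∈ e.target := he₀ ▸ e.map_source hes
  have hs₀ : e.symm (0, 0) = y₀ := by rw [← he₀]; exact e.left_inv hes
  have hDcont : ContinuousAt D y₀ :=
    (ContinuousLinearMap.prodₗᵢ (𝕜 := ℝ) (E := E) (F := EuclideanSpace ℝ (Fin m))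
      (G := ℝ) ℝ).continuous.continuousAt.comp
      (f := fun y ↦ (P, θ y)) (continuousAt_const.prodMk (hθ y₀ hy₀).continuousAt)
  have hgood : ∀ᶠ y in 𝓝 y₀, y ∈ Metric.ball y₀ r ∧
      ∃ B : E ≃L[ℝ] EuclideanSpace ℝ (Fin m) × ℝ,
        (B : E →L[ℝ] EuclideanSpace ℝ (Fin m) × ℝ) = D y := by
    filter_upwards [Metric.isOpen_ball.mem_nhds hyr,
      hDcont (by rw [hDA]; exact A.nhds)] with y h1 h2 using ⟨h1, h2⟩
  have hincl : ContinuousAt (fun u : EuclideanSpace ℝ (Fin m) ↦ (u, (0 : ℝ))) 0 := by fun_prop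
  have hGc : ContinuousAt (fun u : EuclideanSpace ℝ (Fin m) ↦ e.symm (u, 0)) 0 :=
    ContinuousAt.comp (g := e.symm) (e.continuousAt_symm het) hincl
  have hev : ∀ᶠ u : EuclideanSpace ℝ (Fin m) in 𝓝 0, (u, (0 : ℝ)) ∈ e.target ∧
      (e.symm (u, 0) ∈ Metric.ball y₀ r ∧ ∃ B : E ≃L[ℝ] EuclideanSpace ℝ (Fin m) × ℝ,
        (B : E →L[ℝ] EuclideanSpace ℝ (Fin m) × ℝ) = D (e.symm (u, 0))) := by
    have hgood' : ∀ᶠ y in 𝓝 (e.symm ((0 : EuclideanSpace ℝ (Fin m)), (0 : ℝ))),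
        y ∈ Metric.ball y₀ r ∧ ∃ B : E ≃L[ℝ] EuclideanSpace ℝ (Fin m) × ℝ,
          (B : E →L[ℝ] EuclideanSpace ℝ (Fin m) × ℝ) = D y := by rwa [hs₀]
    exact (hincl.eventually (e.open_target.mem_nhds het)).and (hGc.eventually hgood')
  obtain ⟨ρ, hρ, hball⟩ := Metric.eventually_nhds_iff_ball.1 hev
  refine ⟨fun u ↦ e.symm (u, 0), ρ, hρ, fun u hu ↦ ?_, fun u hu u' hu' h ↦ ?_,
    fun c t₁ hc₁ hc ↦ ?_⟩
  · obtain ⟨h1, h2, B, hB⟩ := hball u hu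
    have hsm : ContDiffAt ℝ ∞ e.symm (u, 0) :=
      e.contDiffAt_symm h1 (f₀' := B) (by rw [hB]; exact hΘd _ h2) (hΘs _ h2)
    have hG : ContDiffAt ℝ ∞ (fun u : EuclideanSpace ℝ (Fin m) ↦ e.symm (u, 0)) u :=
      ContDiffAt.comp (g := e.symm) u hsm (contDiffAt_id.prodMk contDiffAt_const)
    have hGd := (hG.differentiableAt (by simp)).hasFDerivAt
    have key : ∀ v, D (e.symm (u, 0)) (fderiv ℝ
        (fun u : EuclideanSpace ℝ (Fin m) ↦ e.symm (u, 0)) u v) = (v, 0) := by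
      intro v
      have k1 : HasFDerivAt (fun u' : EuclideanSpace ℝ (Fin m) ↦ Θ (e.symm (u', 0))) _ u :=
        HasFDerivAt.comp (g := Θ) u (hΘd _ h2) hGd
      have k2 : HasFDerivAt (fun u' : EuclideanSpace ℝ (Fin m) ↦ (u', (0 : ℝ)))
          ((ContinuousLinearMap.id ℝ _).prod 0) u :=
        (hasFDerivAt_id u).prodMk (hasFDerivAt_const _ _)
      have k3 : (fun u' : EuclideanSpace ℝ (Fin m) ↦ Θ (e.symm (u', 0))) =ᶠ[𝓝 u]
          fun u' ↦ (u', (0 : ℝ)) := by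
        filter_upwards [Metric.isOpen_ball.mem_nhds hu] with u' hu'
        exact e.right_inv (hball u' hu').1
      exact DFunLike.congr_fun (k1.unique (k2.congr_of_eventuallyEq k3)) v
    refine ⟨hG, hrU h2, fun v v' hv ↦ ?_, ?_⟩
    · have := (key v).symm.trans ((congrArg _ hv).trans (key v'))
      exact congrArg Prod.fst this
    · ext v
      constructor
      · rintro ⟨v', rfl⟩
        exact congrArg Prod.snd (key v')
      · intro hv
        refine ⟨P v, ?_⟩
        have hinj : Function.Injective (D (e.symm (u, 0))) := by
          rw [← hB]; exact B.injective
        exact hinj ((key (P v)).trans (Prod.ext rfl (mem_ofPred_eq ▸ hv).symm))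
  · have h1 := congrArg e h
    simp only at h1
    rw [e.right_inv (hball u hu).1, e.right_inv (hball u' hu').1] at h1
    exact congrArg Prod.fst h1
  · have hcc : ContinuousAt c t₁ := hc.self_of_nhds.1.continuousAt
    have hsrc : ∀ᶠ t in 𝓝 t₁, c t ∈ e.source :=
      hcc (by rw [hc₁]; exact e.open_source.mem_nhds hes)
    have hPb : ∀ᶠ t in 𝓝 t₁, P (c t - y₀) ∈ Metric.ball 0 ρ := by
      have h1 : ContinuousAt (fun t ↦ P (c t - y₀)) t₁ :=
        P.continuous.continuousAt.comp (hcc.sub continuousAt_const)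
      have h2 : P (c t₁ - y₀) = 0 := by rw [hc₁, sub_self, map_zero]
      exact h1 (Metric.isOpen_ball.mem_nhds (by
        show P (c t₁ - y₀) ∈ Metric.ball 0 ρ
        rw [h2]
        exact Metric.mem_ball_self hρ))
    have hτc : ∀ᶠ t in 𝓝 t₁, τ (c t) = τ y₀ := by
      have h1 : ∀ᶠ t in 𝓝 t₁, HasDerivAt (fun t ↦ τ (c t)) 0 t := by
        filter_upwards [hc, hcc (by rw [hc₁]; exact Metric.ball_mem_nhds y₀ hr)] with t h1 h2
        have := (hτ (c t) h2).comp_hasDerivAt t h1.1.hasDerivAt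
        rw [h1.2] at this
        exact this
      obtain ⟨η, hη, h2⟩ := Metric.eventually_nhds_iff_ball.1 h1
      rw [Real.ball_eq_Ioo] at h2
      obtain ⟨C, hC⟩ := exists_const_of_hasDerivAt_zero isOpen_Ioo ordConnected_Ioo h2
      have h3 : t₁ ∈ Ioo (t₁ - η) (t₁ + η) := ⟨by linarith, by linarith⟩
      filter_upwards [isOpen_Ioo.mem_nhds h3] with t ht
      rw [hC t ht, ← hC t₁ h3, hc₁]
    filter_upwards [hsrc, hPb, hτc] with t h1 h2 h3
    refine ⟨P (c t - y₀), h2, ?_⟩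
    have h4 : e (c t) = (P (c t - y₀), 0) := Prod.ext rfl (sub_eq_zero.2 h3)
    simp only [← h4]
    exact e.left_inv h1

end Plaque

section IntegralManifolds

variable {E : Type*} [NormedAddCommGroup E] [NormedSpace ℝ E]
  {H : Type*} [TopologicalSpace H] {I : ModelWithCorners ℝ E H}
  {M : Type u} [TopologicalSpace M] [ChartedSpace H M]
  {g : MetricTensor I M} {K : ∀ x : M, TangentSpace I x}

/-- A parametrized integral manifold. -/
lemma isIntegralManifold_comp {m : ℕ} {S : Type*} [TopologicalSpace S] [ConnectedSpace S]
    {f : S → EuclideanSpace ℝ (Fin m)} (hf : IsOpenEmbedding f) {Ψ : EuclideanSpace ℝ (Fin m) → M}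
    (hΨ : ∀ s, ContMDiffAt (𝓡 m) I ∞ Ψ (f s)) (hinj : InjOn Ψ (range f))
    (himm : ∀ s, Function.Injective (mfderiv (𝓡 m) I Ψ (f s)))
    (htan : ∀ s, range (mfderiv (𝓡 m) I Ψ (f s)) = {v | g (Ψ (f s)) v (K (Ψ (f s))) = 0}) :
    letI := hf.singletonChartedSpace
    IsIntegralManifold (𝓡 m) g K (Ψ ∘ f) := by
  let _ := hf.singletonChartedSpace
  have hM : IsManifold (𝓡 m) ∞ S := hf.isManifold_singleton
  have hM1 : IsManifold (𝓡 m) 1 S := hf.isManifold_singleton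
  have hfs : ContMDiff (𝓡 m) (𝓡 m) ∞ f := contMDiff_isOpenEmbedding hf
  have hfe : ∀ s : S, f = extChartAt (𝓡 m) s := fun s ↦ by
    ext1 x
    simp only [extChartAt_coe, modelWithCornersSelf_coe, Function.comp_apply, id]
    rfl
  have hinv : ∀ s, (mfderiv (𝓡 m) (𝓡 m) f s).IsInvertible := fun s ↦ by
    have := isInvertible_mfderiv_extChartAt (I := 𝓡 m) (mem_extChartAt_source (I := 𝓡 m) s)
    rwa [← hfe s] at this
  have hd : ∀ s, mfderiv (𝓡 m) I (Ψ ∘ f) s =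
      (mfderiv (𝓡 m) I Ψ (f s)).comp (mfderiv (𝓡 m) (𝓡 m) f s) := fun s ↦
    mfderiv_comp s ((hΨ s).mdifferentiableAt (by simp)) (hfs.mdifferentiableAt (by simp))
  refine ⟨inferInstance, hM, fun s ↦ (hΨ s).comp s (hfs s), fun s s' h ↦
    hf.injective (hinj ⟨s, rfl⟩ ⟨s', rfl⟩ h), fun s ↦ ?_, fun s ↦ ?_⟩
  · rw [hd s]
    exact (himm s).comp (hinv s).injective
  · rw [hd s]
    refine Eq.trans ?_ (htan s)
    exact (hinv s).surjective.range_comp _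

variable [FiniteDimensional ℝ E] [I.Boundaryless] [IsManifold I ∞ M]

/-- Through every point there is an integral manifold of the distribution orthogonal to a static
field, containing locally the curves through the point tangent to the distribution. -/
lemma IsStatic.exists_isIntegralManifold {m : ℕ} (h : IsStatic g K)
    (hm : Module.finrank ℝ E = m + 1) (p : M) :
    ∃ (S : Type u) (_ : TopologicalSpace S) (_ : ChartedSpace (EuclideanSpace ℝ (Fin m)) S)
      (ι : S → M), IsIntegralManifold (𝓡 m) g K ι ∧
      ∀ (σ : ℝ → M) (t₁ : ℝ), σ t₁ = p →
        (∀ᶠ t in 𝓝 t₁, MDifferentiableAt 𝓘(ℝ, ℝ) I σ t ∧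
          g (σ t) (velocity I σ t) (K (σ t)) = 0) → ∀ᶠ t in 𝓝 t₁, σ t ∈ range ι := by
  have hps := mem_extChartAt_source (I := I) p
  have hne : ∀ y ∈ (extChartAt I p).target,
      chartForm g p y (chartField K p y) (chartField K p y) ≠ 0 := fun y hy ↦ by
    have h1 := chartForm_chartField (g := g) K K ((extChartAt I p).map_target hy)
    rw [(extChartAt I p).right_inv hy] at h1
    rw [h1]
    exact (h.timelike _).ne
  have hts : ∀ y ∈ (extChartAt I p).target, ∀ v : E,
      timeForm (chartForm g p) (chartField K p) y v = 0 ↔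
        chartForm g p y v (chartField K p y) = 0 := fun y hy v ↦ by
    rw [timeForm_apply, chartForm_symm h.lorentzian.symm p y v]
    simp [hne y hy]
  obtain ⟨G, ρ, hρ, hG, hGi, hGc⟩ := exists_plaque (m := m)
    (θ := timeForm (chartForm g p) (chartField K p)) (isOpen_extChartAt_target (I := I) p)
    (mem_extChartAt_target p)
    (fun y hy ↦ contDiffAt_timeForm (contDiffAt_chartForm h.lorentzian.smooth hy)
      (contDiffAt_chartField h.smooth hy) (hne y hy))
    (fun y hy ↦ fderiv_timeForm_symm (contDiffAt_chartForm h.lorentzian.smooth hy)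
      (contDiffAt_chartField h.smooth hy)
      (killingAt_chartField h.lorentzian.smooth h.smooth h.killing hy) (hne y hy)
      (irrotational_chartField h.lorentzian.smooth h.lorentzian.symm h.smooth
        (fun x ↦ (h.timelike x).ne) h.irrotational hy))
    (fun h0 ↦ by
      have h1 := timeForm_self (hne _ (mem_extChartAt_target p))
      rw [h0] at h1
      simp at h1)
    hm
  let f : ULift.{u} (Metric.ball (0 : EuclideanSpace ℝ (Fin m)) ρ) → EuclideanSpace ℝ (Fin m) :=
    fun s ↦ s.down.1
  have hf : IsOpenEmbedding f :=
    Metric.isOpen_ball.isOpenEmbedding_subtypeVal.comp Homeomorph.ulift.isOpenEmbedding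
  have hfb : ∀ s, f s ∈ Metric.ball 0 ρ := fun s ↦ s.down.2
  have hfr : range f = Metric.ball 0 ρ :=
    Subset.antisymm (by rintro _ ⟨s, rfl⟩; exact hfb s) fun u hu ↦ ⟨⟨⟨u, hu⟩⟩, rfl⟩
  have hconn : ConnectedSpace (ULift.{u} (Metric.ball (0 : EuclideanSpace ℝ (Fin m)) ρ)) := by
    have : ConnectedSpace (Metric.ball (0 : EuclideanSpace ℝ (Fin m)) ρ) :=
      isConnected_iff_connectedSpace.1 ((convex_ball 0 ρ).isConnected ⟨0, Metric.mem_ball_self hρ⟩)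
    exact Homeomorph.ulift.symm.surjective.connectedSpace Homeomorph.ulift.symm.continuous
  have hd : ∀ (s) (u : EuclideanSpace ℝ (Fin m)),
      (mfderiv (𝓡 m) I ((extChartAt I p).symm ∘ G) (f s) u : E) =
        mfderiv 𝓘(ℝ, E) I (extChartAt I p).symm (G (f s)) (fderiv ℝ G (f s) u) := fun s u ↦ by
    have h1 := mfderiv_comp (I := 𝓡 m) (I' := 𝓘(ℝ, E)) (I'' := I) (f s)
      (mdifferentiableAt_extChartAt_symm (hG _ (hfb s)).2.1)
      ((hG _ (hfb s)).1.differentiableAt (by simp)).mdifferentiableAt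
    rw [mfderiv_eq_fderiv] at h1
    exact DFunLike.congr_fun h1 u
  refine ⟨_, inferInstance, hf.singletonChartedSpace, ((extChartAt I p).symm ∘ G) ∘ f,
    isIntegralManifold_comp hf (fun s ↦ ?_) ?_ (fun s ↦ ?_) (fun s ↦ ?_), fun σ t₁ hσ₁ hσ ↦ ?_⟩
  · exact ContMDiffAt.comp _ (contMDiffAt_extChartAt_symm (hG _ (hfb s)).2.1)
      (hG _ (hfb s)).1.contMDiffAt
  · rw [hfr]
    exact fun u hu u' hu' he ↦ hGi hu hu' ((extChartAt I p).symm.injOn (hG u hu).2.1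
      (hG u' hu').2.1 he)
  · intro v w hvw
    have h0 := (hd s v).symm.trans (Eq.trans hvw (hd s w))
    have h1 := mfderiv_mfderiv_symm (hG _ (hfb s)).2.1 (fderiv ℝ G (f s) v)
    have h2 := mfderiv_mfderiv_symm (hG _ (hfb s)).2.1 (fderiv ℝ G (f s) w)
    refine (hG _ (hfb s)).2.2.1 (h1.symm.trans (Eq.trans ?_ h2))
    exact congrArg (mfderiv I 𝓘(ℝ, E) (extChartAt I p) ((extChartAt I p).symm (G (f s)))) h0
  · obtain ⟨-, hGt, -, hGr⟩ := hG _ (hfb s)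
    have hx := (extChartAt I p).map_target hGt
    have hxy : extChartAt I p ((extChartAt I p).symm (G (f s))) = G (f s) :=
      (extChartAt I p).right_inv hGt
    ext v
    have hv : g ((extChartAt I p).symm (G (f s))) v (K ((extChartAt I p).symm (G (f s)))) =
        chartForm g p (G (f s)) (mfderiv I 𝓘(ℝ, E) (extChartAt I p)
          ((extChartAt I p).symm (G (f s))) v) (chartField K p (G (f s))) := by
      rw [metric_eq_chartForm g hx, mfderiv_extChartAt_field K hx, hxy]
    constructor
    · rintro ⟨u, rfl⟩
      have h1 : fderiv ℝ G (f s) u ∈ range (fderiv ℝ G (f s)) := ⟨u, rfl⟩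
      rw [hGr] at h1
      refine hv.trans ?_
      have h2 := (congrArg (mfderiv I 𝓘(ℝ, E) (extChartAt I p)
        ((extChartAt I p).symm (G (f s)))) (hd s u)).trans
          (mfderiv_mfderiv_symm hGt (fderiv ℝ G (f s) u))
      refine Eq.trans (congrArg (fun w : E ↦ chartForm g p (G (f s)) w _) h2) ?_
      exact (hts _ hGt _).1 h1
    · intro h1
      have h2 := (hts _ hGt _).2 (hv.symm.trans h1)
      obtain ⟨u, hu⟩ := hGr.symm.subset h2
      refine ⟨u, ?_⟩
      have h3 := mfderiv_symm_mfderiv hx v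
      rw [hxy] at h3
      refine (hd s u).trans ?_
      exact (congrArg (mfderiv 𝓘(ℝ, E) I (extChartAt I p).symm (G (f s))) hu).trans h3
  · have hcont : ContinuousAt σ t₁ := hσ.self_of_nhds.1.continuousAt
    have hsrc : ∀ᶠ t in 𝓝 t₁, σ t ∈ (extChartAt I p).source :=
      hcont (by rw [hσ₁]; exact extChartAt_source_mem_nhds p)
    have h1 := hGc (extChartAt I p ∘ σ) t₁ (congrArg (extChartAt I p) hσ₁) (by
      filter_upwards [hσ, hsrc] with t h1 h2
      refine ⟨mdifferentiableAt_iff_differentiableAt.1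
        (MDifferentiableAt.comp t (mdifferentiableAt_extChartAt' h2) h1.1), ?_⟩
      refine (hts _ ((extChartAt I p).map_source h2) _).2 ?_
      exact (metric_velocity_field g K h1.1 h2).symm.trans h1.2)
    filter_upwards [h1, hsrc] with t h1 h2
    obtain ⟨u, hu, hu'⟩ := h1
    refine ⟨⟨⟨u, hu⟩⟩, ?_⟩
    refine (congrArg (extChartAt I p).symm hu').trans ((extChartAt I p).left_inv h2)

end IntegralManifolds

section Leaves

variable {E : Type*} [NormedAddCommGroup E] [NormedSpace ℝ E] [FiniteDimensional ℝ E]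
  {H : Type*} [TopologicalSpace H] {I : ModelWithCorners ℝ E H} [I.Boundaryless]
  {M : Type*} [TopologicalSpace M] [ChartedSpace H M] [IsManifold I ∞ M]
  {g : MetricTensor I M} {K : ∀ x : M, TangentSpace I x}
  {E' : Type*} [NormedAddCommGroup E'] [NormedSpace ℝ E'] [FiniteDimensional ℝ E']
  {H' : Type*} [TopologicalSpace H'] {I' : ModelWithCorners ℝ E' H'} [I'.Boundaryless]
  {S : Type*} [TopologicalSpace S] [ChartedSpace H' S] {ι : S → M}

lemma IsIntegralManifold.mdifferentiableAt (hι : IsIntegralManifold I' g K ι) (s : S) :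
    MDifferentiableAt I' I ι s :=
  (hι.smooth s).mdifferentiableAt (by simp)

lemma IsIntegralManifold.metric_mfderiv (hι : IsIntegralManifold I' g K ι) (s : S)
    (u : TangentSpace I' s) : g (ι s) (mfderiv I' I ι s u) (K (ι s)) = 0 :=
  (hι.tangent s).subset ⟨u, rfl⟩

lemma IsIntegralManifold.contDiffAt_chart (hι : IsIntegralManifold I' g K ι) {s₀ : S} {q : M}
    {y : E'} (hy : y ∈ (extChartAt I' s₀).target)
    (hq : ι ((extChartAt I' s₀).symm y) ∈ (extChartAt I q).source) :
    ContDiffAt ℝ ∞ (extChartAt I q ∘ ι ∘ (extChartAt I' s₀).symm) y := by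
  have := hι.manifold
  exact contDiffAt_chart_comp (n := ⊤) (ContMDiffAt.comp y (hι.smooth _)
    (contMDiffAt_extChartAt_symm hy)) hq

/-- The restriction of the metric to an integral manifold of the distribution orthogonal to a
static field is a metric. -/
lemma IsIntegralManifold.isPseudoRiemannian (hι : IsIntegralManifold I' g K ι)
    (h : IsStatic g K) : IsPseudoRiemannian (pullbackMetric I' ι g) where
  smooth s₀ y hy := by
    have := hι.manifold
    refine contDiffAt_clm_of_apply fun v ↦ contDiffAt_clm_of_apply fun w ↦ ?_
    obtain ⟨q, hq⟩ : ∃ q, ι ((extChartAt I' s₀).symm y) ∈ (extChartAt I q).source :=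
      ⟨_, mem_extChartAt_source _⟩
    have hF := hι.contDiffAt_chart hy hq
    have hDF := hF.fderiv_right (m := ∞) (by simp)
    have hB : ContDiffAt ℝ ∞ (fun z ↦ chartForm g q
        ((extChartAt I q ∘ ι ∘ (extChartAt I' s₀).symm) z)) y :=
      ContDiffAt.comp (g := chartForm g q) y
        (contDiffAt_chartForm h.lorentzian.smooth ((extChartAt I q).map_source hq)) hF
    refine ContDiffAt.congr_of_eventuallyEq ((hB.clm_apply (hDF.clm_apply
      (contDiffAt_const (c := v)))).clm_apply (hDF.clm_apply (contDiffAt_const (c := w)))) ?_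
    have hc : ContinuousAt (fun z ↦ ι ((extChartAt I' s₀).symm z)) y :=
      ContinuousAt.comp (g := ι) hι.smooth.continuous.continuousAt
        (continuousAt_extChartAt_symm'' hy)
    filter_upwards [extChartAt_target_mem_nhds_of_mem hy,
      hc (extChartAt_source_mem_nhds_of_mem hq)] with z h1 h2
    exact chartForm_pullbackMetric g h1 (hι.mdifferentiableAt _) h2 v w
  symm s u v := h.lorentzian.symm _ _ _
  nondegenerate s u hu := by
    obtain ⟨e, -, he⟩ := h.lorentzian.signature (ι s)
    by_contra hne
    have h1 : mfderiv I' I ι s u ≠ 0 := fun h0 ↦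
      hne (hι.immersion s (h0.trans (map_zero (mfderiv I' I ι s)).symm))
    have h2 : (g (ι s)) (K (ι s)) (mfderiv I' I ι s u) = 0 :=
      (h.lorentzian.symm _ _ _).trans (hι.metric_mfderiv s u)
    have h3 := pos_of_orthogonal_timelike (g (ι s)) (h.lorentzian.symm (ι s)) he
      (h.timelike (ι s)) h2 h1
    exact h3.ne' (hu u)

lemma IsIntegralManifold.velocity_comp (hι : IsIntegralManifold I' g K ι) {γ : ℝ → S} {t : ℝ}
    (hγ : MDifferentiableAt 𝓘(ℝ, ℝ) I' γ t) :
    velocity I (ι ∘ γ) t = mfderiv I' I ι (γ t) (velocity I' γ t) :=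
  DFunLike.congr_fun (mfderiv_comp t (hι.mdifferentiableAt (γ t)) hγ) (1 : ℝ)

lemma IsIntegralManifold.metric_velocity_comp (hι : IsIntegralManifold I' g K ι) {γ : ℝ → S}
    {t : ℝ} (hγ : MDifferentiableAt 𝓘(ℝ, ℝ) I' γ t) :
    g (ι (γ t)) (velocity I (ι ∘ γ) t) (K (ι (γ t))) = 0 :=
  (congrArg (fun v ↦ g (ι (γ t)) v (K (ι (γ t)))) (hι.velocity_comp hγ)).trans
    (hι.metric_mfderiv _ _)

/-- In charts, vectors orthogonal to `K` are tangent to an integral manifold. -/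
lemma IsIntegralManifold.exists_fderiv_eq (hι : IsIntegralManifold I' g K ι) {s₀ : S} {q : M}
    (hq : ι s₀ ∈ (extChartAt I q).source) {w : E}
    (hw : chartForm g q (extChartAt I q (ι s₀)) w (chartField K q (extChartAt I q (ι s₀))) = 0) :
    ∃ u : E', fderiv ℝ (extChartAt I q ∘ ι ∘ (extChartAt I' s₀).symm) (extChartAt I' s₀ s₀) u =
      w := by
  have := hι.manifold
  have hs := mem_extChartAt_source (I := I') s₀
  have e1 : (extChartAt I' s₀).symm (extChartAt I' s₀ s₀) = s₀ := (extChartAt I' s₀).left_inv hs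
  obtain ⟨v, hv⟩ : ∃ v : TangentSpace I (ι s₀),
      (mfderiv I 𝓘(ℝ, E) (extChartAt I q) (ι s₀) v : E) = w :=
    ⟨_, mfderiv_mfderiv_symm_of_mem hq w⟩
  have h1 : v ∈ range (mfderiv I' I ι s₀) := by
    rw [hι.tangent s₀, mem_ofPred_eq, metric_eq_chartForm g hq, mfderiv_extChartAt_field K hq, hv]
    exact hw
  obtain ⟨u, rfl⟩ := h1
  refine ⟨mfderiv I' 𝓘(ℝ, E') (extChartAt I' s₀) s₀ u, ?_⟩
  have h2 : (extChartAt I q ∘ ι ∘ (extChartAt I' s₀).symm) ∘ extChartAt I' s₀ =ᶠ[𝓝 s₀]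
      extChartAt I q ∘ ι := by
    filter_upwards [extChartAt_source_mem_nhds_of_mem hs] with z hz
    simp only [Function.comp_apply, (extChartAt I' s₀).left_inv hz]
  have h3 : MDifferentiableAt 𝓘(ℝ, E') 𝓘(ℝ, E) (extChartAt I q ∘ ι ∘ (extChartAt I' s₀).symm)
      (extChartAt I' s₀ s₀) := ((hι.contDiffAt_chart ((extChartAt I' s₀).map_source hs)
        (by rwa [e1])).differentiableAt (by simp)).mdifferentiableAt
  have h4 := mfderiv_comp s₀ h3 (mdifferentiableAt_extChartAt' hs)
  rw [h2.mfderiv_eq, mfderiv_eq_fderiv,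
    mfderiv_comp s₀ (mdifferentiableAt_extChartAt' hq) (hι.mdifferentiableAt s₀)] at h4
  exact (DFunLike.congr_fun h4 u).symm.trans hv

/-- Integral manifolds of the distribution orthogonal to a static field are totally geodesic. -/
lemma IsIntegralManifold.isGeodesicOn_comp (hι : IsIntegralManifold I' g K ι) (h : IsStatic g K)
    {γ : ℝ → S} {U : Set ℝ} (hγ : IsGeodesicOn (pullbackMetric I' ι g) γ U) :
    IsGeodesicOn g (ι ∘ γ) U := by
  have := hι.manifold
  have hg := h.isPseudoRiemannian
  have hgS := hι.isPseudoRiemannian h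
  rw [hg.isGeodesicOn_iff]
  rw [hgS.isGeodesicOn_iff] at hγ
  intro t ht
  obtain ⟨h1, h2⟩ := hγ t ht
  have hc2 : ContMDiffAt 𝓘(ℝ, ℝ) I 2 (ι ∘ γ) t :=
    ContMDiffAt.comp t ((hι.smooth (γ t)).of_le (WithTop.coe_le_coe.2 le_top)) h1
  obtain ⟨q, hqd⟩ : ∃ q, q = ι (γ t) := ⟨_, rfl⟩
  have hq : ι (γ t) ∈ (extChartAt I q).source := by rw [hqd]; exact mem_extChartAt_source _
  have hgq : GeodesicAt g q (ι ∘ γ) t := by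
    refine ⟨hc2, fun w ↦ ?_⟩
    have hs := mem_extChartAt_source (I := I') (γ t)
    have hy := (extChartAt I' (γ t)).map_source hs
    have e1 : (extChartAt I' (γ t)).symm (extChartAt I' (γ t) (γ t)) = γ t :=
      (extChartAt I' (γ t)).left_inv hs
    have hF := hι.contDiffAt_chart (q := q) hy (by rwa [e1])
    set F := extChartAt I q ∘ ι ∘ (extChartAt I' (γ t)).symm with hFdef
    have hFy : F (extChartAt I' (γ t) (γ t)) = extChartAt I q (ι (γ t)) := by
      simp only [hFdef, Function.comp_apply, e1]
    have hcurve := contDiffAt_chart_curve h1 hs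
    have hcM := contDiffAt_chart_curve (q := q) hc2 hq
    have hev : extChartAt I q ∘ ι ∘ γ =ᶠ[𝓝 t] F ∘ (extChartAt I' (γ t) ∘ γ) := by
      filter_upwards [h1.continuousAt (extChartAt_source_mem_nhds_of_mem hs)] with τ hτ
      simp only [hFdef, Function.comp_apply, (extChartAt I' (γ t)).left_inv hτ]
    have hm := (extChartAt I q).map_source hq
    have hF2 : ContDiffAt ℝ 2 F (extChartAt I' (γ t) (γ t)) :=
      hF.of_le (WithTop.coe_le_coe.2 le_top)
    have hpull : ∀ u : E', geoRes (chartForm g q) (extChartAt I q (ι (γ t)))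
        (deriv (extChartAt I q ∘ ι ∘ γ) t) (deriv (deriv (extChartAt I q ∘ ι ∘ γ)) t)
        (fderiv ℝ F (extChartAt I' (γ t) (γ t)) u) = 0 := by
      intro u
      have hr := geoRes_pullback (f := F) (B₁ := chartForm (pullbackMetric I' ι g) (γ t))
        (B₂ := chartForm g q) (hgS.differentiableAt hy)
        (by rw [hFy]; exact hg.differentiableAt hm) hF2
        (fun v w ↦ chartForm_symm hg.symm _ _ _ _)
        (by
          have hc : ContinuousAt (fun z ↦ ι ((extChartAt I' (γ t)).symm z))
              (extChartAt I' (γ t) (γ t)) :=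
            ContinuousAt.comp (g := ι) hι.smooth.continuous.continuousAt
              (continuousAt_extChartAt_symm'' hy)
          filter_upwards [extChartAt_target_mem_nhds_of_mem hy,
            hc (extChartAt_source_mem_nhds_of_mem (by simp only [e1]; exact hq))] with z h1 h2
          exact chartForm_pullbackMetric g h1 (hι.mdifferentiableAt _) h2)
        (deriv (extChartAt I' (γ t) ∘ γ) t) (deriv (deriv (extChartAt I' (γ t) ∘ γ)) t) u
      rw [h2 u, hFy] at hr
      have hd := deriv_deriv_comp (c := extChartAt I' (γ t) ∘ γ) hF2 hcurve
      rw [hev.deriv_eq, hev.deriv.deriv_eq, hd.1, hd.2]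
      exact hr.symm
    have hmom : geoRes (chartForm g q) (extChartAt I q (ι (γ t)))
        (deriv (extChartAt I q ∘ ι ∘ γ) t) (deriv (deriv (extChartAt I q ∘ ι ∘ γ)) t)
        (chartField K q (extChartAt I q (ι (γ t)))) = 0 := by
      have k1 := hasDerivAt_momentum (c := extChartAt I q ∘ ι ∘ γ) (t := t)
        (hg.differentiableAt hm) (fun v w ↦ chartForm_symm hg.symm _ _ _ _)
        ((contDiffAt_chartField h.smooth hm).differentiableAt (by simp))
        (killingAt_chartField h.lorentzian.smooth h.smooth h.killing hm) hcM
      have k2 : (fun τ ↦ chartForm g q ((extChartAt I q ∘ ι ∘ γ) τ)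
          (deriv (extChartAt I q ∘ ι ∘ γ) τ)
          (chartField K q ((extChartAt I q ∘ ι ∘ γ) τ))) =ᶠ[𝓝 t] fun _ ↦ 0 := by
        filter_upwards [eventually_mdifferentiableAt h1,
          hc2.continuousAt (extChartAt_source_mem_nhds_of_mem hq)] with τ k3 k4
        have k5 := metric_velocity_field g K
          (MDifferentiableAt.comp τ (hι.mdifferentiableAt (γ τ)) k3) k4
        exact k5.symm.trans (hι.metric_velocity_comp k3)
      exact k1.unique ((hasDerivAt_const t (0 : ℝ)).congr_of_eventuallyEq k2)
    have hne : chartForm g q (extChartAt I q (ι (γ t))) (chartField K q (extChartAt I q (ι (γ t))))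
        (chartField K q (extChartAt I q (ι (γ t)))) ≠ 0 := by
      rw [chartForm_chartField K K hq]
      exact (h.timelike _).ne
    have hort := timeForm_horizontalField hne w
    rw [chartForm_symm hg.symm] at hort
    obtain ⟨u, hu⟩ := hι.exists_fderiv_eq hq hort
    have hpu := hpull u
    rw [hu] at hpu
    have hlin : ∀ (B : E → E →L[ℝ] E →L[ℝ] ℝ) (y v a w k : E) (r : ℝ),
        geoRes B y v a (w - r • k) = geoRes B y v a w - r * geoRes B y v a k := by
      intro B y v a w k r
      simp only [geoRes, christ, map_sub, map_smul, sub_apply, smul_apply, smul_eq_mul]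
      ring
    rw [horizontalField, hlin, hmom, mul_zero, sub_zero] at hpu
    exact hpu
  exact hgq.chart_change hg hq (mem_extChartAt_source _)

end Leaves

section LeavesComplete

variable {E : Type*} [NormedAddCommGroup E] [NormedSpace ℝ E] [FiniteDimensional ℝ E]
  {H : Type*} [TopologicalSpace H] {I : ModelWithCorners ℝ E H} [I.Boundaryless]
  {M : Type u} [TopologicalSpace M] [ChartedSpace H M] [IsManifold I ∞ M]
  {g : MetricTensor I M} {K : ∀ x : M, TangentSpace I x}

lemma metric_velocity_congr {γ₁ γ₂ : ℝ → M} {t : ℝ} (h : γ₁ =ᶠ[𝓝 t] γ₂) :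
    g (γ₁ t) (velocity I γ₁ t) (K (γ₁ t)) = g (γ₂ t) (velocity I γ₂ t) (K (γ₂ t)) :=
  congrArg₂ (fun (p : M) (v : E) ↦ g p v (K p)) h.eq_of_nhds (velocity_congr h)

lemma IsIntegralManifold.finrank_eq {m : ℕ} {S : Type*} [TopologicalSpace S]
    [ChartedSpace (EuclideanSpace ℝ (Fin m)) S] {ι : S → M}
    (hι : IsIntegralManifold (𝓡 m) g K ι) (h : IsStatic g K) : Module.finrank ℝ E = m + 1 := by
  have := hι.connected
  obtain ⟨s⟩ : Nonempty S := inferInstance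
  let L : EuclideanSpace ℝ (Fin m) →ₗ[ℝ] E := (mfderiv (𝓡 m) I ι s).toLinearMap
  let θ : E →ₗ[ℝ] ℝ := (g (ι s) (K (ι s))).toLinearMap
  have hθ : θ ≠ 0 := fun h0 ↦ (h.timelike (ι s)).ne (DFunLike.congr_fun h0 (K (ι s)))
  have hrange : LinearMap.range L = LinearMap.ker θ := by
    ext v
    have h1 : v ∈ range (mfderiv (𝓡 m) I ι s) ↔ g (ι s) v (K (ι s)) = 0 := by
      rw [hι.tangent s]; rfl
    have h2 : g (ι s) v (K (ι s)) = θ v := h.lorentzian.symm _ _ _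
    refine Iff.trans h1 ?_
    rw [LinearMap.mem_ker, ← h2]
  have h1 := LinearMap.finrank_range_of_inj (f := L) (hι.immersion s)
  have h2 := LinearMap.finrank_range_add_finrank_ker θ
  rw [LinearMap.range_eq_top.2 (LinearMap.surjective hθ), finrank_top, Module.finrank_self,
    ← hrange, h1, finrank_euclideanSpace_fin] at h2
  omega

/-- A geodesic orthogonal to the static field that meets an integral manifold stays in it for some
time, and is a geodesic of it. -/
lemma IsIntegralManifold.exists_lift {m : ℕ} {S : Type*} [TopologicalSpace S]
    [ChartedSpace (EuclideanSpace ℝ (Fin m)) S] {ι : S → M}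
    (hι : IsIntegralManifold (𝓡 m) g K ι) (h : IsStatic g K) {σ : ℝ → M}
    (hσ : IsGeodesicOn g σ univ) {t : ℝ} (hσK : g (σ t) (velocity I σ t) (K (σ t)) = 0) {x : S}
    (hx : ι x = σ t) :
    ∃ δ : ℝ → S, GeodesicAt (pullbackMetric (𝓡 m) ι g) (δ t) δ t ∧ ι ∘ δ =ᶠ[𝓝 t] σ := by
  have := hι.manifold
  have hgS := hι.isPseudoRiemannian h
  obtain ⟨w, hw⟩ : ∃ w : E, w = velocity I σ t := ⟨_, rfl⟩
  have h1 : g (ι x) w (K (ι x)) = 0 := by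
    rw [hw]
    exact (congrArg (fun p : M ↦ g p (velocity I σ t : E) (K p)) hx).trans hσK
  obtain ⟨v, hv⟩ := (hι.tangent x).symm.subset h1
  obtain ⟨ε, hε, δ, hδ, hδt, hδv⟩ := exists_geodesic_velocity hgS x v t
  have ht : t ∈ Ioo (t - ε) (t + ε) := ⟨by linarith, by linarith⟩
  refine ⟨δ, hgS.isGeodesicOn_iff.1 hδ t ht, ?_⟩
  refine (hι.isGeodesicOn_comp h hδ).eventuallyEq_of_velocity h.isPseudoRiemannian isOpen_Ioo
    (hσ.mono (subset_univ _)) ht ((congrArg ι hδt).trans hx) ?_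
  refine (hι.velocity_comp (hδ.mdifferentiableAt ht)).trans ?_
  refine Eq.trans ?_ (Eq.trans hv hw)
  exact congrArg₂ (fun (p : S) (v : EuclideanSpace ℝ (Fin m)) ↦ (mfderiv (𝓡 m) I ι p v : E)) hδt hδv

/-- The leaves orthogonal to a static field of a complete metric are complete. -/
theorem IsStatic.leavesComplete [T2Space M] (h : IsStatic g K) (hc : GeodesicallyComplete g) :
    LeavesComplete g K := by
  intro m S _ _ ι hleaf s γ hs hsc hγ
  obtain ⟨hι, hmax⟩ := hleaf
  have := hι.manifold
  have := hι.connected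
  have hg := h.isPseudoRiemannian
  have hgS := hι.isPseudoRiemannian h
  rcases s.eq_empty_or_nonempty with rfl | ⟨t₀, ht₀⟩
  · obtain ⟨x₀⟩ : Nonempty S := inferInstance
    exact ⟨fun _ ↦ x₀, isGeodesicOn_const hgS x₀ univ, eqOn_empty _ _⟩
  obtain ⟨σ, hσ, hσγ⟩ := hc s (ι ∘ γ) hs hsc (hι.isGeodesicOn_comp h hγ)
  have hσK : ∀ t, g (σ t) (velocity I σ t) (K (σ t)) = 0 := by
    obtain ⟨C, hC⟩ := exists_const_of_hasDerivAt_zero isOpen_univ ordConnected_univ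
      fun t ht ↦ hσ.hasDerivAt_momentum hg h.lorentzian.smooth h.smooth h.killing ht
    have h1 := metric_velocity_congr (g := g) (K := K)
      (hσγ.eventuallyEq_of_mem (hs.mem_nhds ht₀))
    have h2 := h1.trans (hι.metric_velocity_comp (hγ.mdifferentiableAt ht₀))
    intro t
    rw [hC t (mem_univ t), ← hC t₀ (mem_univ t₀), h2]
  have hT : {t | σ t ∈ range ι} = univ := by
    refine IsClopen.eq_univ ⟨isClosed_iff_frequently.2 fun t ht ↦ ?_,
      isOpen_iff_mem_nhds.2 fun t ht ↦ ?_⟩ ⟨t₀, γ t₀, (hσγ ht₀).symm⟩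
    · obtain ⟨S', _, _, ι', hι', hloc⟩ := h.exists_isIntegralManifold (hι.finrank_eq h) (σ t)
      have hev := hloc σ t rfl (Eventually.of_forall fun u ↦
        ⟨hσ.mdifferentiableAt (mem_univ u), hσK u⟩)
      obtain ⟨u, hu, hu'⟩ := (ht.and_eventually hev).exists
      exact hmax S' ι' hι' ⟨σ u, hu, hu'⟩ hev.self_of_nhds
    · obtain ⟨x, hx⟩ := ht
      obtain ⟨δ, -, hδ⟩ := hι.exists_lift h hσ (hσK t) hx
      filter_upwards [hδ] with u hu using ⟨δ u, hu⟩
  choose γ' hγ' using fun t ↦ hT.symm.subset (mem_univ t)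
  refine ⟨γ', hgS.isGeodesicOn_iff.2 fun t _ ↦ ?_, fun t ht ↦
    hι.injective ((hγ' t).trans (hσγ ht))⟩
  obtain ⟨δ, hδ, hδσ⟩ := hι.exists_lift h hσ (hσK t) (hγ' t)
  have heq : δ =ᶠ[𝓝 t] γ' := by
    filter_upwards [hδσ] with u hu using hι.injective (hu.trans (hγ' u).symm)
  rw [← heq.eq_of_nhds]
  exact hδ.congr heq

end LeavesComplete

end StaticSpacetime

end


theorem theorem2p1 :
    (∀ (E : Type*) [NormedAddCommGroup E] [NormedSpace ℝ E] [FiniteDimensional ℝ E]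
      (H : Type*) [TopologicalSpace H] (I : ModelWithCorners ℝ E H) [I.Boundaryless]
      (M : Type*) [TopologicalSpace M] [ChartedSpace H M] [IsManifold I ∞ M]
      [T2Space M] [SecondCountableTopology M] [ConnectedSpace M]
      (g : MetricTensor I M) (K : ∀ x : M, TangentSpace I x),
      2 ≤ Module.finrank ℝ E → IsStatic g K →
        (GeodesicallyComplete g → CompleteField K ∧ LeavesComplete g K) ∧
        (RiemannianComplete (auxMetric g K) →
          AtMostQuadratic (auxMetric g K) (fun x ↦ (beta g K x)⁻¹) →
          GeodesicallyComplete g) ∧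
        (CompactSpace M → GeodesicallyComplete g)) ∧
    (∀ (F : Type*) [NormedAddCommGroup F] [NormedSpace ℝ F] [FiniteDimensional ℝ F]
      (G : Type*) [TopologicalSpace G] (J : ModelWithCorners ℝ F G) [J.Boundaryless]
      (S : Type*) [TopologicalSpace S] [ChartedSpace G S] [IsManifold J ∞ S]
      [T2Space S] [SecondCountableTopology S] [ConnectedSpace S]
      (gS : MetricTensor J S) (β : S → ℝ),
      1 ≤ Module.finrank ℝ F → gS.IsRiemannian →
      ContMDiff J 𝓘(ℝ, ℝ) ∞ β → (∀ x, 0 < β x) →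
        RiemannianComplete gS → AtMostQuadratic gS (fun x ↦ (β x)⁻¹) →
        GeodesicallyComplete (standardMetric β gS)) := by
  refine ⟨?_, ?_⟩
  · intro E _ _ _ H _ I _ M _ _ _ _ _ _ g K _ h
    exact ⟨fun hc ↦ ⟨hc.completeField h.isPseudoRiemannian h.lorentzian.smooth h.smooth h.killing,
      h.leavesComplete hc⟩, h.geodesicallyComplete_of_atMostQuadratic,
      fun _ ↦ h.geodesicallyComplete_of_compactSpace⟩
  · intro F _ _ _ G _ J _ S _ _ _ _ _ _ gS β _ h hβ hβ0 hc hq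
    exact geodesicallyComplete_standardMetric h hβ hβ0 hc hq
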